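/- **Definitions.** A *monotone algebraic circuit* is a fan-in two algebraic circuit over $\mathbb{R}$ (sum and product gates, inputs that are variables or constants) all of whose constants are non-negative; its size is its number of gates. $\mathrm{MVP}$ is the class of sequences $(P_n(x_1,\dots,x_n))_{n\ge1}$ of polynomials of degree $n^{O(1)}$ that have monotone algebraic circuits of size $n^{O(1)}$. $\mathrm{MVNP}$ is the class of sequences $(Q_n(x_1,\dots,x_n))_{n\ge1}$ with $Q_n(x)=\sum_{b\in\{0,1\}^{m}}R_{n+m}(x,b)$, where $m=m(n)\le n^{O(1)}$ and $(R_r)_{r\ge1}\in\mathrm{MVP}$. For a constant $d\ge 1$, a sequence $(G_n)_n$ of simple graphs $G_n$ on vertex set $[n]$ is a *sequence of $d$-regular expanders* if there is a constant $\varepsilon>0$ such that for all $n>d$ the graph $G_n$ is $d$-regular and the second largest eigenvalue, in absolute value, of its adjacency matrix is at most $(1-\varepsilon)d$. The polynomial of $G_n$ is $$P_n(x_1,\dots,x_n)=\frac1{2^{|E(G_n)|}}\sum_{H\subseteq E(G_n)}\ \prod_{i\in[n]}\bigl(1+x_i\,2^{\deg_H(i)}\bigr),$$ where $\deg_H(i)$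 is the number of edges of $H$ that contain $i$. **Theorem.** (a) For every constant $d\ge1$ and every sequence $(G_n)$ of $d$-regular expanders, the polynomials $P_n$ are multilinear with non-negative coefficients; for all $n>d$, $$P_n=\sum_{S\subseteq[n]}x^S\,B^{|S|}A^{|E(S)|},\qquad A=\tfrac{10}{9},\quad B=\left(\tfrac32\right)^d,$$ where $x^S=\prod_{i\in S}x_i$ and $E(S)$ is the set of edges of $G_n$ with both endpoints in $S$; the sequence $(P_n)$ lies in $\mathrm{MVNP}$; and every monotone algebraic circuit computing $P_n$ has size $2^{\Omega(n)}$, i.e. there are $c>0$ and $n_0$ such that for all $n\ge n_0$ its size is at least $2^{cn}$. In particular $(P_n)\notin\mathrm{MVP}$. (b) The following explicit sequence $(G_n)$ is a sequence of $4$-regular expanders, so that the corresponding $P_n$ are an explicit sequence of multilinear polynomials with non-negative coefficients in $\mathrm{MVNP}$ that requires monotone algebraic circuits of size $2^{\Omega(n)}$. Let $m=\lfloor\sqrt{\lfloor n/5\rfloor}\rfloor$. If $n\le 6m^2$ (which holds for all large $n$), take $m^2$ clusters indexed by $c=(x,y)\in(\mathbb{Z}/m)^2$, each with five vertices $(c,s)$,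 $s\in\mathbb{Z}/5$, and put each of the remaining $n-5m^2$ vertices into a cluster of its own (the first $n-5m^2$ clusters). Join $(c,s)$ to $(\pi_s(c),s+1)$, where $\pi_0(x,y)=(x+2y,y)$, $\pi_1(x,y)=(x+2y+1,y)$, $\pi_2(x,y)=(x,y+2x)$, $\pi_3(x,y)=(x,y+2x+1)$ and $\pi_4=\mathrm{id}$; join $(c,s)$ to $(c,s+2)$, except for $s\in\{1,2\}$ in clusters with an additional vertex; and join each additional vertex to the vertices $(c,1),(c,2),(c,3),(c,4)$ of its cluster $c$. If $n>6m^2$, $G_n$ is the circulant graph on $\mathbb{Z}/n$ in which $v$ is joined to $v\pm1$ and $v\pm2$. -/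

import Mathlib

open Finset

namespace MonotoneVNP

section Circuits

/-- A gate of an algebraic circuit over `ℝ` in the variables `σ`: an input (a constant or a
variable), or a fan-in two sum or product of two of the `k` gates that precede it. -/
inductive Gate (σ : Type) (k : ℕ) : Type
  | const (c : ℝ) : Gate σ k
  | var (i : σ) : Gate σ k
  | add (a b : Fin k) : Gate σ k
  | mul (a b : Fin k) : Gate σ k

/-- An algebraic circuit over `ℝ`: its gates in topological order, with a designated output gate.
Its size is the number of gates (inputs included). Gates may be reused (unbounded fan-out). -/
structure Circuit (σ : Type) : Type where
  size : ℕ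
  gate : (k : Fin size) → Gate σ k
  output : Fin size

namespace Circuit

variable {σ : Type}

/-- The polynomial computed at gate number `k`. -/
noncomputable def value (C : Circuit σ) (k : ℕ) (hk : k < C.size) : MvPolynomial σ ℝ :=
  match C.gate ⟨k, hk⟩ with
  | .const c => MvPolynomial.C c
  | .var i => MvPolynomial.X i
  | .add a b => C.value a.1 (a.2.trans hk) + C.value b.1 (b.2.trans hk)
  | .mul a b => C.value a.1 (a.2.trans hk) * C.value b.1 (b.2.trans hk)
termination_by k
decreasing_by all_goals first | exact a.2 | exact b.2

/-- `C` computes the polynomial `P`. -/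
def Computes (C : Circuit σ) (P : MvPolynomial σ ℝ) : Prop :=
  C.value C.output.1 C.output.2 = P

/-- A circuit is monotone if all the constants appearing in it are non-negative. -/
def IsMonotone (C : Circuit σ) : Prop :=
  ∀ (k : Fin C.size) (c : ℝ), C.gate k = Gate.const c → 0 ≤ c

end Circuit

end Circuits

section Classes

/-- `f n ≤ n ^ O(1)` for `n ≥ 1`. -/
def PolyBounded (f : ℕ → ℕ) : Prop :=
  ∃ k : ℕ, ∀ n, 1 ≤ n → f n ≤ n ^ k + k

/-- The class `MVP`: sequences `(P_n(x_1, …, x_n))_{n ≥ 1}` of polynomially bounded degree that are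
computed by monotone algebraic circuits of polynomially bounded size. -/
def InMVP (P : ∀ n : ℕ, MvPolynomial (Fin n) ℝ) : Prop :=
  PolyBounded (fun n => (P n).totalDegree) ∧
  ∃ s : ℕ → ℕ, PolyBounded s ∧
    ∀ n, 1 ≤ n → ∃ C : Circuit (Fin n), C.IsMonotone ∧ C.Computes (P n) ∧ C.size ≤ s n

/-- `∑_{b ∈ {0,1}^m} R(x_1, …, x_n, b_1, …, b_m)`. -/
noncomputable def booleanSum {n m : ℕ} (R : MvPolynomial (Fin (n + m)) ℝ) :
    MvPolynomial (Fin n) ℝ :=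
  ∑ b : Fin m → Bool,
    MvPolynomial.aeval
      (Fin.append (fun i : Fin n => (MvPolynomial.X i : MvPolynomial (Fin n) ℝ))
        (fun j : Fin m => if b j then 1 else 0)) R

/-- The class `MVNP`: sequences `(Q_n(x_1, …, x_n))_{n ≥ 1}` of the form
`Q_n(x) = ∑_{b ∈ {0,1}^m} R_{n+m}(x, b)` with `m = m(n)` polynomially bounded and `(R_r)_{r ≥ 1}`
in `MVP`. -/
def InMVNP (Q : ∀ n : ℕ, MvPolynomial (Fin n) ℝ) : Prop :=
  ∃ (m : ℕ → ℕ) (R : ∀ r : ℕ, MvPolynomial (Fin r) ℝ),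
    PolyBounded m ∧ InMVP R ∧ ∀ n, 1 ≤ n → Q n = booleanSum (R (n + m n))

end Classes

section Expanders

theorem adjMatrix_isHermitian {V : Type*} [Fintype V] [DecidableEq V] (G : SimpleGraph V)
    [DecidableRel G.Adj] : (G.adjMatrix ℝ).IsHermitian := by
  rw [Matrix.IsHermitian, Matrix.conjTranspose_eq_transpose_of_trivial]
  exact G.isSymm_adjMatrix

/-- The second largest eigenvalue in absolute value (counted with multiplicity) of the adjacency
matrix of `G` is at most `b`: all eigenvalues but one lie in `[-b, b]`. -/
def SecondEigenvalueLE {n : ℕ} (G : SimpleGraph (Fin n)) [DecidableRel G.Adj] (b : ℝ) : Prop :=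
  ∃ i, ∀ j, j ≠ i → |(adjMatrix_isHermitian G).eigenvalues j| ≤ b

/-- `(G n)` is a sequence of `d`-regular expanders, `G n` being a graph on `n` vertices (for
`n > d`), with `d ≥ 1` constant: the second largest eigenvalue in absolute value is at most
`(1 - ε) d` for a constant `ε > 0`. -/
def IsExpanderSeq (d : ℕ) (G : ∀ n : ℕ, SimpleGraph (Fin n)) [∀ n, DecidableRel (G n).Adj] :
    Prop :=
  0 < d ∧ ∃ ε : ℝ, 0 < ε ∧ ∀ n, d < n →
    (G n).IsRegularOfDegree d ∧ SecondEigenvalueLE (G n) ((1 - ε) * d)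

end Expanders

section ExplicitGraph

/-- The Gabber–Galil permutations `(x, y) ↦ (x + 2y, y), (x + 2y + 1, y), (x, y + 2x),
(x, y + 2x + 1)` of `(ℤ/m)²` for `s = 0, 1, 2, 3`, and the identity for `s = 4`. The pair `(x, y)`
with `x, y < m` is encoded by the number `x * m + y < m²`. -/
def ggMap (m s c : ℕ) : ℕ :=
  let x := c / m
  let y := c % m
  match s with
  | 0 => (x + 2 * y) % m * m + y
  | 1 => (x + 2 * y + 1) % m * m + y
  | 2 => x * m + (y + 2 * x) % m
  | 3 => x * m + (y + 2 * x + 1) % m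
  | _ => c

/-- Directed adjacencies of the cluster graph with `m ^ 2` clusters on `n` vertices, where
`5 * m ^ 2 ≤ n ≤ 6 * m ^ 2`. A vertex `v < 5 * m ^ 2` is slot `v % 5` of cluster `v / 5`; a vertex
`5 * m ^ 2 + c` is an additional vertex of cluster `c`.
* Slot `s` of cluster `c` is joined to slot `s + 1` of the cluster `ggMap m s c`.
* Inside a cluster, slot `s` is joined to slot `s + 2`, except that in a cluster with an additional
  vertex the edges from slot `1` to `3` and from `2` to `4` are left out.
* An additional vertex is joined to the slots `1, 2, 3, 4` of its cluster. -/
def clusterRel (n m v w : ℕ) : Prop :=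
  (v < 5 * m ^ 2 ∧ w < 5 * m ^ 2 ∧
    w % 5 = (v % 5 + 1) % 5 ∧ w / 5 = ggMap m (v % 5) (v / 5)) ∨
  (v < 5 * m ^ 2 ∧ w < 5 * m ^ 2 ∧
    w / 5 = v / 5 ∧ w % 5 = (v % 5 + 2) % 5 ∧
    ¬ (5 * m ^ 2 + v / 5 < n ∧ (v % 5 = 1 ∨ v % 5 = 2))) ∨
  (v < 5 * m ^ 2 ∧ v % 5 ≠ 0 ∧ w = 5 * m ^ 2 + v / 5)

instance (n m v w : ℕ) : Decidable (clusterRel n m v w) := by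
  unfold clusterRel; infer_instance

/-- Directed adjacencies of the explicit graph on `n` vertices: the cluster graph with
`m = ⌊√(n / 5)⌋` if `n ≤ 6 * m ^ 2` (which is the case for all large `n`), and otherwise the
circulant graph in which `v` is joined to `v ± 1` and `v ± 2` modulo `n`. -/
def explicitRel (n v w : ℕ) : Prop :=
  if n ≤ 6 * Nat.sqrt (n / 5) ^ 2 then clusterRel n (Nat.sqrt (n / 5)) v w
  else w = (v + 1) % n ∨ w = (v + 2) % n

instance (n v w : ℕ) : Decidable (explicitRel n v w) := by
  unfold explicitRel; infer_instance

/-- The explicit graph on `n` vertices; it is `4`-regular for `n > 4`. -/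
def explicitGraph (n : ℕ) : SimpleGraph (Fin n) :=
  SimpleGraph.fromRel fun v w => explicitRel n v.1 w.1

instance (n : ℕ) : DecidableRel (explicitGraph n).Adj := fun v w =>
  inferInstanceAs (Decidable (v ≠ w ∧ (explicitRel n v.1 w.1 ∨ explicitRel n w.1 v.1)))

end ExplicitGraph

section HardPolynomial

variable {n : ℕ} (G : SimpleGraph (Fin n)) [DecidableRel G.Adj]

/-- The hard polynomial of `G`: the average of `∏_i (1 + x_i 2 ^ {deg_H(i)})` over a uniformly
random subgraph `H` of `G` with the same vertex set (given by its set of edges). -/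
noncomputable def hardPoly : MvPolynomial (Fin n) ℝ :=
  MvPolynomial.C (((2 : ℝ) ^ #G.edgeFinset)⁻¹) *
    ∑ H ∈ G.edgeFinset.powerset,
      ∏ i : Fin n, (1 + MvPolynomial.X i * MvPolynomial.C ((2 : ℝ) ^ #{e ∈ H | i ∈ e}))

/-- `|E(S)|`: the number of edges of `G` with both endpoints in `S`. -/
def edgesInside (S : Finset (Fin n)) : ℕ :=
  #{e ∈ G.edgeFinset | ∀ i ∈ e, i ∈ S}

end HardPolynomial

end MonotoneVNP

open MonotoneVNP

/-! The lower bound is a rectangle argument. A monotone circuit cannot cancel, so every product that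
contributes to its multilinear output is dominated by the output coefficient by coefficient, and the
two factors share no variable. Descending from the output through the gates that depend on more than
two thirds of the variables, and cutting off products where this stops, writes the output as a sum
of at most two products `p * q` per gate, with `p` and `q` in disjoint sets of at most two thirds of
the variables each (`eval_one_le_size_mul`). It remains to see that one such product carries an
exponentially small fraction of the sum of all coefficients.

The coefficient of x^S is a product over the edges, with factor 1, 3/2 or 5/2 for an edge with 0, 1
or 2 endpoints in S. Let Y contain the variables of `p` and avoid those of `q`, and let uv be an
edge leaving Y. With the rest of S fixed, the four choices for u and v give a 2 × 2 matrix whose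
diagonal product is (5/2) / (3/2)² = 10/9 times the antidiagonal one. A rank one matrix below it
therefore misses a constant fraction of its entries (`rankOneGap_of_det`). For an induced matching
of edges leaving Y the coefficients form a tensor product of such matrices, and the losses multiply
(`sum_rankOne_le_of_le_prod`, `hardWeight_fill`). The spectral gap yields linearly many edges
leaving a balanced Y (`SecondEigenvalueLE.card_crossingPairs_ge`), and bounded degree yields an
induced matching of linear size among them (`exists_isCrossingMatching`).

Membership in MVNP comes from writing 2^deg_H(i) as the product of 1 + b_e over the edges e at i,
where b_e is the indicator of e ∈ H.

For the explicit graphs, the sums of (f v - f w)² and of (f v + f w)² over the edges must both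
dominate the squared norm of f (for mean zero f in the first case). The clusters are connected, not
bipartite and of at most six vertices. This settles the plus sign inside each cluster, and reduces
the minus sign to functions on (ℤ/m)², where `gabberGalil` applies. The sizes without cluster graph
are below 605 and are settled by crude bounds. -/

namespace MonotoneVNP

/-! ### Coefficients of the hard polynomial -/

section HardPolynomialExpansion

/-- The exponent vector of the multilinear monomial `x^S`. -/
noncomputable def multilinearExponent {σ : Type} (S : Finset σ) : σ →₀ ℕ :=
  ∑ i ∈ S, Finsupp.single i 1

theorem multilinearExponent_apply {σ : Type} [DecidableEq σ] (S : Finset σ) (i : σ) :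
    multilinearExponent S i = if i ∈ S then 1 else 0 := by
  classical
  simp [multilinearExponent, Finsupp.finsetSum_apply, Finsupp.single_apply]

theorem multilinearExponent_support {σ : Type} (S : Finset σ) :
    (multilinearExponent S).support = S := by
  classical
  ext i
  simp [multilinearExponent_apply]

theorem multilinearExponent_injective {σ : Type} :
    Function.Injective (multilinearExponent (σ := σ)) := fun S T h => by
  rw [← multilinearExponent_support S, h, multilinearExponent_support]

theorem multilinearExponent_union {σ : Type} [DecidableEq σ] {S T : Finset σ}
    (h : Disjoint S T) :
    multilinearExponent (S ∪ T) = multilinearExponent S + multilinearExponent T :=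
  Finset.sum_union h

theorem eq_multilinearExponent_support {σ : Type} {e : σ →₀ ℕ} (h : ∀ i, e i ≤ 1) :
    e = multilinearExponent e.support := by
  classical
  ext i
  rw [multilinearExponent_apply]
  have := h i
  by_cases hi : e i = 0
  · simp [hi]
  · simp [hi]; omega

variable {n : ℕ} (G : SimpleGraph (Fin n)) [DecidableRel G.Adj]

/-- The coefficient of `x^S` in the hard polynomial of `G`. -/
noncomputable def hardWeight (S : Finset (Fin n)) : ℝ :=
  ∏ e ∈ G.edgeFinset, (1 + (2 : ℝ) ^ #{i ∈ S | i ∈ e}) / 2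

theorem hardWeight_pos (S : Finset (Fin n)) : 0 < hardWeight G S :=
  Finset.prod_pos fun _ _ => by positivity

/-- Expanding the product over the vertices selects S. The average over H then factors over the
edges, because each edge is in H or not independently of the others, contributing 2^|S ∩ e| or 1. -/
theorem hardPoly_eq_sum_monomial :
    hardPoly G = ∑ S : Finset (Fin n),
      MvPolynomial.monomial (multilinearExponent S) (hardWeight G S) := by
  have expand : ∀ H : Finset (Sym2 (Fin n)),
      ∏ i : Fin n, (1 + MvPolynomial.X i * MvPolynomial.C ((2 : ℝ) ^ #{e ∈ H | i ∈ e})) =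
        ∑ S : Finset (Fin n), MvPolynomial.monomial (multilinearExponent S)
          (∏ e ∈ H, (2 : ℝ) ^ #{i ∈ S | i ∈ e}) := by
    intro H
    rw [Finset.prod_one_add, Finset.powerset_univ]
    refine Finset.sum_congr rfl fun S _ => ?_
    have monomial_prod : (MvPolynomial.monomial (multilinearExponent S) (1 : ℝ)) =
        ∏ i ∈ S, MvPolynomial.X i := by
      rw [multilinearExponent, MvPolynomial.monomial_sum_one]
      rfl
    rw [Finset.prod_mul_distrib, ← map_prod, ← monomial_prod, mul_comm,
      MvPolynomial.C_mul_monomial, mul_one, Finset.prod_pow_eq_pow_sum,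
      Finset.prod_pow_eq_pow_sum]
    congr 2
    exact Finset.sum_card_bipartiteAbove_eq_sum_card_bipartiteBelow (fun i e => i ∈ e)
  unfold hardPoly
  simp_rw [expand]
  rw [Finset.sum_comm, Finset.mul_sum]
  refine Finset.sum_congr rfl fun S _ => ?_
  rw [← map_sum, MvPolynomial.C_mul_monomial, ← Finset.prod_one_add]
  simp only [hardWeight, Finset.prod_div_distrib, Finset.prod_const]
  rw [div_eq_inv_mul]

theorem coeff_hardPoly (e : Fin n →₀ ℕ) :
    (hardPoly G).coeff e =
      ∑ S : Finset (Fin n), if multilinearExponent S = e then hardWeight G S else 0 := by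
  simp_rw [hardPoly_eq_sum_monomial, MvPolynomial.coeff_sum, MvPolynomial.coeff_monomial]

theorem coeff_hardPoly_multilinearExponent (S : Finset (Fin n)) :
    (hardPoly G).coeff (multilinearExponent S) = hardWeight G S := by
  simp [coeff_hardPoly, multilinearExponent_injective.eq_iff]

theorem coeff_hardPoly_nonneg (e : Fin n →₀ ℕ) : 0 ≤ (hardPoly G).coeff e := by
  rw [coeff_hardPoly]
  exact Finset.sum_nonneg fun S _ => by
    split_ifs
    exacts [(hardWeight_pos G S).le, le_rfl]

theorem apply_le_one_of_coeff_hardPoly_ne_zero {e : Fin n →₀ ℕ} (h : (hardPoly G).coeff e ≠ 0)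
    (i : Fin n) : e i ≤ 1 := by
  rw [coeff_hardPoly] at h
  obtain ⟨S, -, hS⟩ := Finset.exists_ne_zero_of_sum_ne_zero h
  have hS' : multilinearExponent S = e := by
    by_contra hne
    exact hS (if_neg hne)
  rw [← hS', multilinearExponent_apply]
  split_ifs <;> simp

theorem degreeOf_hardPoly_le_one (i : Fin n) : (hardPoly G).degreeOf i ≤ 1 := by
  classical
  rw [MvPolynomial.degreeOf_eq_sup]
  exact Finset.sup_le fun e he =>
    apply_le_one_of_coeff_hardPoly_ne_zero G (MvPolynomial.mem_support_iff.mp he) i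

theorem eval_one_hardPoly :
    MvPolynomial.eval (fun _ => 1) (hardPoly G) = ∑ S, hardWeight G S := by
  rw [hardPoly_eq_sum_monomial, map_sum]
  exact Finset.sum_congr rfl fun S _ => by simp [MvPolynomial.eval_monomial]

theorem card_filter_mem_sym2_mk {u v : Fin n} (huv : u ≠ v) (S : Finset (Fin n)) :
    #{i ∈ S | i ∈ s(u, v)} = (if u ∈ S then 1 else 0) + (if v ∈ S then 1 else 0) := by
  have : {i ∈ S | i ∈ s(u, v)} = {i ∈ S | i = u} ∪ {i ∈ S | i = v} := by
    ext i; simp only [Finset.mem_filter, Finset.mem_union, Sym2.mem_iff]; tauto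
  rw [this, Finset.card_union_of_disjoint, Finset.filter_eq', Finset.filter_eq']
  · split_ifs <;> simp
  · rw [Finset.disjoint_left]
    simp only [Finset.mem_filter]
    rintro i ⟨_, rfl⟩ ⟨_, h⟩
    exact huv h

/-- The edge factors 1, 3/2, 5/2 equal (3/2)^|S ∩ e|, with a correction 10/9 exactly when e lies
inside S; the sum of |S ∩ e| over the edges is d|S| by double counting. -/
theorem hardWeight_eq_of_isRegular {d : ℕ} (hG : G.IsRegularOfDegree d) (S : Finset (Fin n)) :
    hardWeight G S = (((3 : ℝ) / 2) ^ d) ^ #S * ((10 : ℝ) / 9) ^ edgesInside G S := by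
  have factor : ∀ e ∈ G.edgeFinset, (1 + (2 : ℝ) ^ #{i ∈ S | i ∈ e}) / 2 =
      ((3 : ℝ) / 2) ^ #{i ∈ S | i ∈ e} * (if ∀ i ∈ e, i ∈ S then (10 : ℝ) / 9 else 1) := by
    intro e he
    induction e with
    | _ u v =>
      rw [SimpleGraph.mem_edgeFinset, SimpleGraph.mem_edgeSet] at he
      rw [card_filter_mem_sym2_mk he.ne]
      by_cases hu : u ∈ S <;> by_cases hv : v ∈ S <;> simp [hu, hv] <;> norm_num
  have degree_sum : ∑ e ∈ G.edgeFinset, #{i ∈ S | i ∈ e} = d * #S := by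
    have := Finset.sum_card_bipartiteAbove_eq_sum_card_bipartiteBelow
      (s := S) (t := G.edgeFinset) (fun i e => i ∈ e)
    simp only [Finset.bipartiteAbove, Finset.bipartiteBelow] at this
    rw [← this]
    simp_rw [← SimpleGraph.incidenceFinset_eq_filter, SimpleGraph.card_incidenceFinset_eq_degree,
      hG.degree_eq]
    simp [mul_comm]
  rw [hardWeight, Finset.prod_congr rfl factor, Finset.prod_mul_distrib,
    Finset.prod_pow_eq_pow_sum, degree_sum, ← pow_mul, Finset.prod_ite, Finset.prod_const,
    Finset.prod_const_one, mul_one, edgesInside]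

theorem hardPoly_eq_of_isRegular {d : ℕ} (hG : G.IsRegularOfDegree d) :
    hardPoly G = ∑ S : Finset (Fin n), MvPolynomial.C
      ((((3 : ℝ) / 2) ^ d) ^ #S * ((10 : ℝ) / 9) ^ edgesInside G S) *
        ∏ i ∈ S, MvPolynomial.X i := by
  rw [hardPoly_eq_sum_monomial]
  refine Finset.sum_congr rfl fun S _ => ?_
  rw [← hardWeight_eq_of_isRegular G hG, MvPolynomial.monomial_eq, Finsupp.prod,
    multilinearExponent_support]
  congr 1
  refine Finset.prod_congr rfl fun i hi => ?_
  rw [multilinearExponent_apply, if_pos hi, pow_one]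

end HardPolynomialExpansion

/-! ### Straight-line programs as a device for building monotone circuits -/

section StraightLine

variable {σ : Type}

/-- Lists of polynomials each of which is a non-negative constant, a variable, or a sum or product
of two later entries. -/
inductive StraightLine : List (MvPolynomial σ ℝ) → Prop
  | nil : StraightLine []
  | const {l : List (MvPolynomial σ ℝ)} (c : ℝ) (hc : 0 ≤ c) (hl : StraightLine l) :
      StraightLine (MvPolynomial.C c :: l)
  | var {l : List (MvPolynomial σ ℝ)} (i : σ) (hl : StraightLine l) :
      StraightLine (MvPolynomial.X i :: l)
  | add {l : List (MvPolynomial σ ℝ)} {p q : MvPolynomial σ ℝ} (hl : StraightLine l)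
      (hp : p ∈ l) (hq : q ∈ l) : StraightLine ((p + q) :: l)
  | mul {l : List (MvPolynomial σ ℝ)} {p q : MvPolynomial σ ℝ} (hl : StraightLine l)
      (hp : p ∈ l) (hq : q ∈ l) : StraightLine ((p * q) :: l)

/-- Programs can be juxtaposed without renumbering, since entries refer to earlier results as
polynomials rather than by index. This makes costs additive. -/
theorem StraightLine.append {l l' : List (MvPolynomial σ ℝ)} (hl : StraightLine l)
    (hl' : StraightLine l') : StraightLine (l ++ l') := by
  induction hl with
  | nil => exact hl'
  | const c hc _ ih => exact ih.const c hc
  | var i _ ih => exact ih.var i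
  | add _ hp hq ih => exact ih.add (List.mem_append_left _ hp) (List.mem_append_left _ hq)
  | mul _ hp hq ih => exact ih.mul (List.mem_append_left _ hp) (List.mem_append_left _ hq)

/-- The polynomial computed by a gate, given those computed by the preceding gates. -/
noncomputable def Gate.eval {k : ℕ} (R : ℕ → MvPolynomial σ ℝ) : Gate σ k → MvPolynomial σ ℝ
  | .const c => MvPolynomial.C c
  | .var i => MvPolynomial.X i
  | .add a b => R a + R b
  | .mul a b => R a * R b

theorem Circuit.value_eq_eval (C : Circuit σ) (R : ℕ → MvPolynomial σ ℝ)
    (hR : ∀ k : Fin C.size, (C.gate k).eval R = R k) (k : ℕ) (hk : k < C.size) :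
    C.value k hk = R k := by
  induction k using Nat.strong_induction_on with
  | _ k ih =>
    rw [← hR ⟨k, hk⟩, Circuit.value]
    cases C.gate ⟨k, hk⟩ with
    | const c => rfl
    | var i => rfl
    | add a b => simp only [Gate.eval]; rw [ih a a.2, ih b b.2]
    | mul a b => simp only [Gate.eval]; rw [ih a a.2, ih b b.2]

theorem exists_getD_reverse_eq {l : List (MvPolynomial σ ℝ)} {p : MvPolynomial σ ℝ} (hp : p ∈ l) :
    ∃ a : Fin l.length, l.reverse.getD a 0 = p := by
  obtain ⟨a, ha, h⟩ := List.getElem_of_mem (List.mem_reverse.mpr hp)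
  rw [List.length_reverse] at ha
  exact ⟨⟨a, ha⟩, by rw [List.getD_eq_getElem _ _ (by simpa using ha)]; exact h⟩

theorem Gate.eval_congr {k : ℕ} {R R' : ℕ → MvPolynomial σ ℝ} (g : Gate σ k)
    (h : ∀ a < k, R a = R' a) : g.eval R = g.eval R' := by
  cases g with
  | const c => rfl
  | var i => rfl
  | add a b => simp only [Gate.eval]; rw [h a a.2, h b b.2]
  | mul a b => simp only [Gate.eval]; rw [h a a.2, h b b.2]

/-- New entries are put at the head of the list, whereas a circuit lists its gates in order of
computation; hence the reversal. -/
theorem StraightLine.exists_gate {l : List (MvPolynomial σ ℝ)} (hl : StraightLine l) :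
    ∀ k < l.length, ∃ g : Gate σ k, (∀ c, g = Gate.const c → 0 ≤ c) ∧
      g.eval (fun a => l.reverse.getD a 0) = l.reverse.getD k 0 := by
  have step : ∀ (l : List (MvPolynomial σ ℝ)) (p : MvPolynomial σ ℝ),
      (∀ k < l.length, ∃ g : Gate σ k, (∀ c, g = Gate.const c → 0 ≤ c) ∧
        g.eval (fun a => l.reverse.getD a 0) = l.reverse.getD k 0) →
      (∃ g : Gate σ l.length, (∀ c, g = Gate.const c → 0 ≤ c) ∧
        g.eval (fun a => l.reverse.getD a 0) = p) →
      ∀ k < (p :: l).length, ∃ g : Gate σ k, (∀ c, g = Gate.const c → 0 ≤ c) ∧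
        g.eval (fun a => (p :: l).reverse.getD a 0) = (p :: l).reverse.getD k 0 := by
    intro l p ih new k hk
    have old : ∀ a < l.length, (p :: l).reverse.getD a 0 = l.reverse.getD a 0 := fun a ha => by
      rw [List.reverse_cons, List.getD_append _ _ _ _ (by simpa using ha)]
    rcases Nat.lt_succ_iff_lt_or_eq.mp hk with hk | rfl
    · obtain ⟨g, hg, hg'⟩ := ih k hk
      refine ⟨g, hg, ?_⟩
      rw [old k hk, ← hg']
      exact g.eval_congr fun a ha => old a (ha.trans hk)
    · obtain ⟨g, hg, hg'⟩ := new
      refine ⟨g, hg, ?_⟩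
      have : (p :: l).reverse.getD l.length 0 = p := by
        rw [List.reverse_cons, List.getD_append_right _ _ _ _ (by simp)]
        simp
      rw [this]
      exact (g.eval_congr fun a ha => old a ha).trans hg'
  induction hl with
  | nil => intro k hk; simp at hk
  | const c hc _ ih =>
    refine step _ _ ih ⟨Gate.const c, fun c' h => ?_, rfl⟩
    cases h
    exact hc
  | var i _ ih => exact step _ _ ih ⟨Gate.var i, fun _ h => by simp at h, rfl⟩
  | add _ hp hq ih =>
    obtain ⟨a, ha⟩ := exists_getD_reverse_eq hp
    obtain ⟨b, hb⟩ := exists_getD_reverse_eq hq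
    exact step _ _ ih ⟨Gate.add a b, fun _ h => by simp at h, by simp only [Gate.eval]; rw [ha, hb]⟩
  | mul _ hp hq ih =>
    obtain ⟨a, ha⟩ := exists_getD_reverse_eq hp
    obtain ⟨b, hb⟩ := exists_getD_reverse_eq hq
    exact step _ _ ih ⟨Gate.mul a b, fun _ h => by simp at h, by simp only [Gate.eval]; rw [ha, hb]⟩

/-- `p` has a monotone straight-line program of length at most `s`. -/
def HasMonotoneCost (p : MvPolynomial σ ℝ) (s : ℕ) : Prop :=
  ∃ l : List (MvPolynomial σ ℝ), StraightLine l ∧ p ∈ l ∧ l.length ≤ s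

theorem HasMonotoneCost.exists_circuit {p : MvPolynomial σ ℝ} {s : ℕ} (h : HasMonotoneCost p s) :
    ∃ C : Circuit σ, C.IsMonotone ∧ C.Computes p ∧ C.size ≤ s := by
  obtain ⟨l, hl, hp, hs⟩ := h
  obtain ⟨out, hout⟩ := exists_getD_reverse_eq hp
  choose g hg hg' using hl.exists_gate
  refine ⟨⟨l.length, fun k => g k k.2, out⟩, fun k c h => hg k k.2 c h, ?_, hs⟩
  exact (Circuit.value_eq_eval _ (fun a => l.reverse.getD a 0) (fun k => hg' k k.2) _ _).trans hout

theorem HasMonotoneCost.mono {p : MvPolynomial σ ℝ} {s t : ℕ} (h : HasMonotoneCost p s)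
    (hst : s ≤ t) : HasMonotoneCost p t :=
  let ⟨l, hl, hp, hs⟩ := h
  ⟨l, hl, hp, hs.trans hst⟩

theorem hasMonotoneCost_C {c : ℝ} (hc : 0 ≤ c) :
    HasMonotoneCost (MvPolynomial.C c : MvPolynomial σ ℝ) 1 :=
  ⟨_, StraightLine.nil.const c hc, by simp, by simp⟩

theorem hasMonotoneCost_one : HasMonotoneCost (1 : MvPolynomial σ ℝ) 1 := by
  simpa using hasMonotoneCost_C (σ := σ) zero_le_one

theorem hasMonotoneCost_X (i : σ) : HasMonotoneCost (MvPolynomial.X i : MvPolynomial σ ℝ) 1 :=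
  ⟨_, StraightLine.nil.var i, by simp, by simp⟩

theorem HasMonotoneCost.add {p q : MvPolynomial σ ℝ} {s t : ℕ} (hp : HasMonotoneCost p s)
    (hq : HasMonotoneCost q t) : HasMonotoneCost (p + q) (s + t + 1) := by
  obtain ⟨l, hl, hpl, hs⟩ := hp
  obtain ⟨l', hl', hql, ht⟩ := hq
  refine ⟨_, (hl.append hl').add (List.mem_append_left _ hpl) (List.mem_append_right _ hql),
    by simp, ?_⟩
  simp only [List.length_cons, List.length_append]
  omega

theorem HasMonotoneCost.mul {p q : MvPolynomial σ ℝ} {s t : ℕ} (hp : HasMonotoneCost p s)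
    (hq : HasMonotoneCost q t) : HasMonotoneCost (p * q) (s + t + 1) := by
  obtain ⟨l, hl, hpl, hs⟩ := hp
  obtain ⟨l', hl', hql, ht⟩ := hq
  refine ⟨_, (hl.append hl').mul (List.mem_append_left _ hpl) (List.mem_append_right _ hql),
    by simp, ?_⟩
  simp only [List.length_cons, List.length_append]
  omega

theorem HasMonotoneCost.prod {ι : Type*} {S : Finset ι} {f : ι → MvPolynomial σ ℝ} {t : ℕ}
    (h : ∀ i ∈ S, HasMonotoneCost (f i) t) : HasMonotoneCost (∏ i ∈ S, f i) (#S * (t + 1) + 1) := by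
  classical
  induction S using Finset.induction_on with
  | empty => simpa using hasMonotoneCost_one
  | insert i S hi ih =>
    rw [Finset.prod_insert hi, Finset.card_insert_of_notMem hi]
    refine ((h i (by simp)).mul (ih fun j hj => h j (by simp [hj]))).mono ?_
    rw [add_mul]
    omega

end StraightLine

/-! ### The hard polynomials lie in MVNP -/

section MembershipInMVNP

theorem polyBounded_of_le_mul_pow {f : ℕ → ℕ} (K k : ℕ) (h : ∀ r, 1 ≤ r → f r ≤ K * r ^ k) :
    PolyBounded f := by
  refine ⟨k + K, fun r hr => (h r hr).trans ?_⟩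
  rcases hr.eq_or_lt with rfl | hr
  · simp; omega
  · have : K ≤ r ^ K := K.lt_two_pow_self.le.trans (Nat.pow_le_pow_left hr K)
    calc K * r ^ k ≤ r ^ K * r ^ k := Nat.mul_le_mul_right _ this
      _ = r ^ (k + K) := by rw [← pow_add, add_comm]
      _ ≤ _ := Nat.le_add_right _ _

variable {n : ℕ} (G : SimpleGraph (Fin n)) [DecidableRel G.Adj]

/-- The number of the Boolean variable that belongs to an unordered pair. -/
noncomputable def edgeIndex (e : Sym2 (Fin n)) : Fin (n * n) := finProdFinEquiv (Quot.out e)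

/-- The unordered pair to which a Boolean variable belongs. -/
def edgeOfIndex (q : Fin (n * n)) : Sym2 (Fin n) := Quot.mk _ (finProdFinEquiv.symm q)

theorem edgeOfIndex_edgeIndex (e : Sym2 (Fin n)) : edgeOfIndex (edgeIndex e) = e := by
  simp [edgeOfIndex, edgeIndex, Quot.out_eq]

theorem edgeIndex_injective : Function.Injective (edgeIndex (n := n)) :=
  Function.LeftInverse.injective edgeOfIndex_edgeIndex

theorem card_edgeFinset_le : #G.edgeFinset ≤ n * n := by
  calc #G.edgeFinset = #(G.edgeFinset.map ⟨edgeIndex, edgeIndex_injective⟩) := by simp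
    _ ≤ Fintype.card (Fin (n * n)) := Finset.card_le_univ _
    _ = n * n := by simp

/-- A polynomial in the variables `x_i` and one Boolean variable per pair of vertices, whose sum
over the Boolean variables is the hard polynomial of `G`. -/
noncomputable def hardSummand (r : ℕ) (h : n + n * n ≤ r) : MvPolynomial (Fin r) ℝ :=
  MvPolynomial.C ((2 : ℝ) ^ (n * n))⁻¹ * ∏ i : Fin n,
    (1 + MvPolynomial.X (Fin.castLE h (Fin.castAdd (n * n) i)) *
      ∏ e ∈ G.edgeFinset with i ∈ e,
        (1 + MvPolynomial.X (Fin.castLE h (Fin.natAdd n (edgeIndex e)))))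

/-- The average over independent bits factors. The bits that belong to no edge average to 1, so that
n² bits can be used whatever the number of edges. -/
theorem sum_prod_edges (f : Sym2 (Fin n) → Bool → ℝ) :
    ((2 : ℝ) ^ (n * n))⁻¹ * ∑ b : Fin (n * n) → Bool, ∏ e ∈ G.edgeFinset, f e (b (edgeIndex e)) =
      ∏ e ∈ G.edgeFinset, (f e true + f e false) / 2 := by
  set ι : Sym2 (Fin n) ↪ Fin (n * n) := ⟨edgeIndex, edgeIndex_injective⟩
  have on_indices : ∀ b : Fin (n * n) → Bool, ∏ e ∈ G.edgeFinset, f e (b (edgeIndex e)) =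
      ∏ q : Fin (n * n), if q ∈ G.edgeFinset.map ι then f (edgeOfIndex q) (b q) else 1 := by
    intro b
    rw [Finset.prod_ite_mem, Finset.univ_inter, Finset.prod_map]
    exact Finset.prod_congr rfl fun e _ => by simp [ι, edgeOfIndex_edgeIndex]
  have two_pow : ((2 : ℝ) ^ (n * n))⁻¹ = ∏ _q : Fin (n * n), (2 : ℝ)⁻¹ := by simp
  simp_rw [on_indices]
  rw [← Fintype.piFinset_univ, ← Finset.prod_univ_sum (fun _ : Fin (n * n) => (univ : Finset Bool))
    (fun q β => if q ∈ G.edgeFinset.map ι then f (edgeOfIndex q) β else 1), two_pow,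
    ← Finset.prod_mul_distrib]
  have : ∀ q : Fin (n * n), (2 : ℝ)⁻¹ * ∑ β : Bool,
      (if q ∈ G.edgeFinset.map ι then f (edgeOfIndex q) β else 1) =
      if q ∈ G.edgeFinset.map ι then (f (edgeOfIndex q) true + f (edgeOfIndex q) false) / 2
      else 1 := by
    intro q
    split_ifs
    · rw [Fintype.sum_bool]; ring
    · simp
  rw [Finset.prod_congr rfl fun q _ => this q, Finset.prod_ite_mem, Finset.univ_inter,
    Finset.prod_map]
  exact Finset.prod_congr rfl fun e _ => by simp [ι, edgeOfIndex_edgeIndex]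

/-- Under an assignment b the factor `1 + X` of an edge becomes 2 or 1, so the summand is the
product defining the hard polynomial for the subgraph selected by b; both sides are compared
monomial by monomial. -/
theorem booleanSum_hardSummand :
    booleanSum (hardSummand G (n + n * n) le_rfl) = hardPoly G := by
  have expand : ∀ b : Fin (n * n) → Bool,
      MvPolynomial.aeval
        (Fin.append (fun i : Fin n => (MvPolynomial.X i : MvPolynomial (Fin n) ℝ))
          (fun j : Fin (n * n) => if b j then 1 else 0)) (hardSummand G (n + n * n) le_rfl) =
      ∑ S : Finset (Fin n), MvPolynomial.monomial (multilinearExponent S)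
        (((2 : ℝ) ^ (n * n))⁻¹ * ∏ e ∈ G.edgeFinset,
          (if b (edgeIndex e) then (2 : ℝ) else 1) ^ #{i ∈ S | i ∈ e}) := by
    intro b
    have bit : ∀ e : Sym2 (Fin n), (1 + (if b (edgeIndex e) then 1 else 0) :
        MvPolynomial (Fin n) ℝ) = MvPolynomial.C (if b (edgeIndex e) then (2 : ℝ) else 1) := by
      intro e
      split_ifs
      · rw [one_add_one_eq_two]; exact (map_ofNat MvPolynomial.C 2).symm
      · simp
    simp only [hardSummand, map_mul, map_prod, map_add, map_one, Fin.castLE_rfl, id_eq,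
      MvPolynomial.aeval_X, Fin.append_left, Fin.append_right, MvPolynomial.algHom_C,
      MvPolynomial.algebraMap_eq, bit]
    rw [Finset.prod_one_add, Finset.powerset_univ, Finset.mul_sum]
    refine Finset.sum_congr rfl fun S _ => ?_
    have monomial_prod : (MvPolynomial.monomial (multilinearExponent S) (1 : ℝ)) =
        ∏ i ∈ S, MvPolynomial.X i := by
      rw [multilinearExponent, MvPolynomial.monomial_sum_one]
      rfl
    have swap : ∏ i ∈ S, ∏ e ∈ G.edgeFinset with i ∈ e,
        (if b (edgeIndex e) then (2 : ℝ) else 1) =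
        ∏ e ∈ G.edgeFinset, (if b (edgeIndex e) then (2 : ℝ) else 1) ^ #{i ∈ S | i ∈ e} := by
      simp_rw [Finset.prod_filter]
      rw [Finset.prod_comm]
      refine Finset.prod_congr rfl fun e _ => ?_
      rw [← Finset.prod_filter, Finset.prod_const]
    simp_rw [← map_prod]
    rw [Finset.prod_mul_distrib, ← map_prod, swap, ← monomial_prod, mul_left_comm, ← map_mul,
      mul_comm, MvPolynomial.C_mul_monomial, mul_one]
  rw [booleanSum, Finset.sum_congr rfl fun b _ => expand b, Finset.sum_comm,
    hardPoly_eq_sum_monomial]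
  refine Finset.sum_congr rfl fun S _ => ?_
  rw [← map_sum, ← Finset.mul_sum,
    sum_prod_edges G (fun e β => (if β then (2 : ℝ) else 1) ^ #{i ∈ S | i ∈ e})]
  congr 1
  exact Finset.prod_congr rfl fun e _ => by simp [add_comm]

theorem hasMonotoneCost_hardSummand (r : ℕ) (h : n + n * n ≤ r) :
    HasMonotoneCost (hardSummand G r h) (n * (n * n * 4 + 6) + 3) := by
  refine ((hasMonotoneCost_C (by positivity)).mul (HasMonotoneCost.prod (t := n * n * 4 + 5)
    fun i _ => ?_)).mono (by simp; ring_nf; omega)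
  refine (hasMonotoneCost_one.add ((hasMonotoneCost_X _).mul (HasMonotoneCost.prod (t := 3)
    fun e _ => hasMonotoneCost_one.add (hasMonotoneCost_X _)))).mono ?_
  have := (Finset.card_filter_le G.edgeFinset (fun e => i ∈ e)).trans (card_edgeFinset_le G)
  omega

theorem totalDegree_one_add_le {σ : Type} (p : MvPolynomial σ ℝ) :
    (1 + p).totalDegree ≤ p.totalDegree :=
  (MvPolynomial.totalDegree_add _ _).trans (by simp)

theorem totalDegree_hardSummand_le (r : ℕ) (h : n + n * n ≤ r) :
    (hardSummand G r h).totalDegree ≤ n * (1 + n * n) := by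
  refine (MvPolynomial.totalDegree_mul _ _).trans ?_
  rw [MvPolynomial.totalDegree_C, zero_add]
  refine (MvPolynomial.totalDegree_finsetProd _ _).trans ?_
  refine (Finset.sum_le_card_nsmul _ _ (1 + n * n) fun i _ => ?_).trans (by simp)
  refine (totalDegree_one_add_le _).trans ((MvPolynomial.totalDegree_mul _ _).trans ?_)
  rw [MvPolynomial.totalDegree_X]
  refine Nat.add_le_add_left ((MvPolynomial.totalDegree_finsetProd _ _).trans ?_) 1
  refine (Finset.sum_le_card_nsmul _ _ 1 fun e _ => ?_).trans ?_
  · exact (totalDegree_one_add_le _).trans (by simp)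
  · simpa using (Finset.card_filter_le G.edgeFinset (fun e => i ∈ e)).trans (card_edgeFinset_le G)

theorem inMVNP_hardPoly (G : ∀ n : ℕ, SimpleGraph (Fin n)) [∀ n, DecidableRel (G n).Adj] :
    InMVNP (fun n => hardPoly (G n)) := by
  classical
  -- A family in MVP is indexed by its number r of variables alone, so n has to be recovered from r
  -- = n + n²; it is the integer square root, as n² ≤ r < (n + 1)². For r too small to hold the
  -- variables, the value 0 is a harmless default.
  let R : ∀ r : ℕ, MvPolynomial (Fin r) ℝ := fun r =>
    if h : r.sqrt + r.sqrt * r.sqrt ≤ r then hardSummand (G r.sqrt) r h else 0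
  have R_eq : ∀ n, R (n + n * n) = hardSummand (G n) (n + n * n) le_rfl := by
    intro n
    have key : ∀ r s (hs : s = n) (h : s + s * s ≤ r) (h' : n + n * n ≤ r),
        hardSummand (G s) r h = hardSummand (G n) r h' := by
      rintro r s rfl h h'; rfl
    have hs : (n + n * n).sqrt = n := by
      rw [add_comm]; exact Nat.sqrt_add_eq n (by omega)
    have hle : (n + n * n).sqrt + (n + n * n).sqrt * (n + n * n).sqrt ≤ n + n * n := by rw [hs]
    exact (dif_pos hle).trans (key _ _ hs hle le_rfl)
  have aux : ∀ r, 1 ≤ r → r.sqrt * (r.sqrt * r.sqrt) ≤ r ^ 3 ∧ r.sqrt ≤ r ^ 3 ∧ 1 ≤ r ^ 3 := by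
    intro r hr
    have h1 := r.sqrt_le_self
    refine ⟨?_, h1.trans (Nat.le_self_pow (by norm_num) r), Nat.one_le_pow _ _ hr⟩
    calc _ ≤ r * (r * r) := Nat.mul_le_mul h1 (Nat.mul_le_mul h1 h1)
      _ = r ^ 3 := by ring
  refine ⟨fun n => n * n, R, polyBounded_of_le_mul_pow 1 2 fun r _ => by simp [pow_two],
    ⟨polyBounded_of_le_mul_pow 2 3 fun r hr => ?_, fun r => 13 * r ^ 3,
      polyBounded_of_le_mul_pow 13 3 fun r _ => le_rfl, fun r hr => ?_⟩, fun n _ => ?_⟩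
  · obtain ⟨h1, h2, -⟩ := aux r hr
    dsimp only [R]
    split_ifs with h
    · refine (totalDegree_hardSummand_le _ _ _).trans ?_
      rw [mul_add]
      omega
    · simp
  · obtain ⟨h1, h2, h3⟩ := aux r hr
    apply HasMonotoneCost.exists_circuit
    dsimp only [R]
    split_ifs with h
    · refine (hasMonotoneCost_hardSummand _ _ _).mono ?_
      have : r.sqrt * (r.sqrt * r.sqrt * 4 + 6) + 3 =
        4 * (r.sqrt * (r.sqrt * r.sqrt)) + 6 * r.sqrt + 3 := by ring
      omega
    · simpa using (hasMonotoneCost_C (σ := Fin r) le_rfl).mono (show 1 ≤ 13 * r ^ 3 by omega)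
  · change hardPoly (G n) = booleanSum (R (n + n * n))
    rw [R_eq, booleanSum_hardSummand]

end MembershipInMVNP

/-! ### Monotone circuits as short sums of balanced products -/

section CircuitDecomposition

variable {σ : Type}

/-- All coefficients of `p` are non-negative. -/
def NonnegCoeffs (p : MvPolynomial σ ℝ) : Prop := ∀ e, 0 ≤ p.coeff e

theorem NonnegCoeffs.zero : NonnegCoeffs (0 : MvPolynomial σ ℝ) := fun e => by simp

theorem NonnegCoeffs.C {c : ℝ} (hc : 0 ≤ c) :
    NonnegCoeffs (MvPolynomial.C c : MvPolynomial σ ℝ) := fun e => by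
  classical
  rw [MvPolynomial.coeff_C]
  split_ifs
  exacts [hc, le_rfl]

theorem NonnegCoeffs.one : NonnegCoeffs (1 : MvPolynomial σ ℝ) := by
  simpa using NonnegCoeffs.C (σ := σ) zero_le_one

theorem NonnegCoeffs.X (i : σ) : NonnegCoeffs (MvPolynomial.X i : MvPolynomial σ ℝ) := fun e => by
  classical
  rw [MvPolynomial.coeff_X]
  split_ifs
  exacts [zero_le_one, le_rfl]

theorem NonnegCoeffs.add {p q : MvPolynomial σ ℝ} (hp : NonnegCoeffs p) (hq : NonnegCoeffs q) :
    NonnegCoeffs (p + q) := fun e => by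
  rw [MvPolynomial.coeff_add]
  exact add_nonneg (hp e) (hq e)

theorem NonnegCoeffs.mul {p q : MvPolynomial σ ℝ} (hp : NonnegCoeffs p) (hq : NonnegCoeffs q) :
    NonnegCoeffs (p * q) := fun e => by
  classical
  rw [MvPolynomial.coeff_mul]
  exact Finset.sum_nonneg fun x _ => mul_nonneg (hp _) (hq _)

theorem NonnegCoeffs.sum {ι : Type*} {s : Finset ι} {f : ι → MvPolynomial σ ℝ}
    (h : ∀ i ∈ s, NonnegCoeffs (f i)) : NonnegCoeffs (∑ i ∈ s, f i) := fun e => by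
  rw [MvPolynomial.coeff_sum]
  exact Finset.sum_nonneg fun i hi => h i hi e

theorem Circuit.IsMonotone.nonnegCoeffs_value {C : Circuit σ} (hC : C.IsMonotone) (k : ℕ)
    (hk : k < C.size) : NonnegCoeffs (C.value k hk) := by
  induction k using Nat.strong_induction_on with
  | _ k ih =>
    rw [Circuit.value]
    cases h : C.gate ⟨k, hk⟩ with
    | const c => exact NonnegCoeffs.C (hC _ c h)
    | var i => exact NonnegCoeffs.X i
    | add a b => exact (ih a a.2 _).add (ih b b.2 _)
    | mul a b => exact (ih a a.2 _).mul (ih b b.2 _)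

theorem coeff_mul_le_coeff_add {p q : MvPolynomial σ ℝ} (hp : NonnegCoeffs p)
    (hq : NonnegCoeffs q) (e f : σ →₀ ℕ) : p.coeff e * q.coeff f ≤ (p * q).coeff (e + f) := by
  classical
  rw [MvPolynomial.coeff_mul]
  exact Finset.single_le_sum (f := fun x : (σ →₀ ℕ) × (σ →₀ ℕ) => p.coeff x.1 * q.coeff x.2)
    (fun x _ => mul_nonneg (hp _) (hq _)) (a := (e, f)) (by simp)

/-- Every monomial of `P` is multilinear. -/
def IsMultilinearPoly (P : MvPolynomial σ ℝ) : Prop := ∀ e, P.coeff e ≠ 0 → ∀ i, e i ≤ 1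

/-- No cancellation: with non-negative coefficients a product of two occurring monomials occurs in
`p * q`, and hence in every polynomial that dominates it. -/
theorem coeff_add_ne_zero_of_mul_le {P p q : MvPolynomial σ ℝ} (hp : NonnegCoeffs p)
    (hq : NonnegCoeffs q) (hle : NonnegCoeffs (P - p * q)) {e f : σ →₀ ℕ} (he : p.coeff e ≠ 0)
    (hf : q.coeff f ≠ 0) : P.coeff (e + f) ≠ 0 := by
  have h1 := hle (e + f)
  rw [MvPolynomial.coeff_sub] at h1
  have h2 := coeff_mul_le_coeff_add hp hq e f
  have h3 : 0 < p.coeff e * q.coeff f :=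
    mul_pos ((hp e).lt_of_ne' he) ((hq f).lt_of_ne' hf)
  linarith

/-- A common variable would have exponent at least 2 in some monomial of `P`. -/
theorem disjoint_vars_of_mul_le {P p q : MvPolynomial σ ℝ} (hP : IsMultilinearPoly P)
    (hp : NonnegCoeffs p) (hq : NonnegCoeffs q) (hle : NonnegCoeffs (P - p * q)) :
    Disjoint p.vars q.vars := by
  classical
  rw [Finset.disjoint_left]
  intro i hi hi'
  obtain ⟨e, he, hie⟩ := (MvPolynomial.mem_vars_iff_mem_support i).mp hi
  obtain ⟨f, hf, hif⟩ := (MvPolynomial.mem_vars_iff_mem_support i).mp hi'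
  rw [MvPolynomial.mem_support_iff] at he hf
  have := hP _ (coeff_add_ne_zero_of_mul_le hp hq hle he hf) i
  rw [Finsupp.mem_support_iff] at hie hif
  rw [Finsupp.add_apply] at this
  omega

variable [Fintype σ]

/-- If every product `p * q ≤ P` of polynomials in disjoint and not too large sets of variables has
only a `ρ`-fraction of the sum of the coefficients of `P`, then monotone circuits for the
multilinear polynomial `P` have at least `1 / (2 ρ)` gates. -/
theorem eval_one_le_size_mul {P : MvPolynomial σ ℝ} {ρ : ℝ} (hP : IsMultilinearPoly P)
    (hn : 2 ≤ Fintype.card σ) (hρ : 0 ≤ ρ)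
    (hW : 0 ≤ MvPolynomial.eval (fun _ => 1) P)
    (balanced : ∀ p q : MvPolynomial σ ℝ, NonnegCoeffs p → NonnegCoeffs q →
      NonnegCoeffs (P - p * q) → Disjoint p.vars q.vars → 3 * #p.vars ≤ 2 * Fintype.card σ →
      3 * #q.vars ≤ 2 * Fintype.card σ →
      MvPolynomial.eval (fun _ => 1) (p * q) ≤ ρ * MvPolynomial.eval (fun _ => 1) P)
    (C : Circuit σ) (hC : C.IsMonotone) (hCP : C.Computes P) :
    MvPolynomial.eval (fun _ => 1) P ≤ 2 * C.size * (ρ * MvPolynomial.eval (fun _ => 1) P) := by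
  classical
  set W := MvPolynomial.eval (fun _ => 1) P
  set N := Fintype.card σ
  set g : ℕ → MvPolynomial σ ℝ := fun k => if hk : k < C.size then C.value k hk else 0 with hg_def
  have hg : ∀ k, NonnegCoeffs (g k) := fun k => by
    simp only [hg_def]
    split_ifs with hk
    exacts [hC.nonnegCoeffs_value k hk, NonnegCoeffs.zero]
  have hgP : g C.output = P := by
    simp only [hg_def, dif_pos C.output.2]
    exact hCP
  have hgPnn : NonnegCoeffs P := hgP ▸ hg _
  have hρW : 0 ≤ ρ * W := mul_nonneg hρ hW
  have hsize : 1 ≤ C.size := (Nat.zero_le _).trans_lt C.output.2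
  -- If `P` itself has few variables, then `P * 1` is a balanced product and the bound is immediate.
  by_cases root : 3 * #P.vars ≤ 2 * N
  · have := balanced P 1 hgPnn NonnegCoeffs.one (by simpa using NonnegCoeffs.zero) (by simp)
      root (by simp)
    rw [mul_one] at this
    have hs : (1 : ℝ) ≤ C.size := by exact_mod_cast hsize
    nlinarith
  push Not at root
  let big : ℕ → Prop := fun k => 2 * N < 3 * #(g k).vars
  have small : ∀ (p q : MvPolynomial σ ℝ), NonnegCoeffs p → NonnegCoeffs q →
      NonnegCoeffs (P - p * q) → 3 * #p.vars ≤ 2 * N → 3 * #q.vars ≤ 2 * N →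
      MvPolynomial.eval (fun _ => 1) (p * q) ≤ ρ * W := fun p q hp hq hpq h1 h2 =>
    balanced p q hp hq hpq (disjoint_vars_of_mul_le hP hp hq hpq) h1 h2
  have vars_le : ∀ (p q : MvPolynomial σ ℝ), NonnegCoeffs p → NonnegCoeffs q →
      NonnegCoeffs (P - p * q) → #p.vars + #q.vars ≤ N := fun p q hp hq hpq => by
    rw [← Finset.card_union_of_disjoint (disjoint_vars_of_mul_le hP hp hq hpq)]
    exact Finset.card_le_univ _
  -- processing one gate
  have split : ∀ k (hk : k < C.size) (h : MvPolynomial σ ℝ), NonnegCoeffs h →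
      NonnegCoeffs (P - h * g k) → big k → ∃ a < k, ∃ b < k, ∃ u v E : MvPolynomial σ ℝ,
        NonnegCoeffs u ∧ NonnegCoeffs v ∧ NonnegCoeffs E ∧ (u ≠ 0 → big a) ∧ (v ≠ 0 → big b) ∧
        h * g k = u * g a + v * g b + E ∧ MvPolynomial.eval (fun _ => 1) E ≤ 2 * (ρ * W) := by
    intro k hk h hh hle hbig
    have hbig' : 2 * N < 3 * #(g k).vars := hbig
    have hgk : g k = C.value k hk := dif_pos hk
    rw [Circuit.value] at hgk
    cases hgate : C.gate ⟨k, hk⟩ with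
    | const c =>
      rw [hgate] at hgk
      rw [hgk, MvPolynomial.vars_C, Finset.card_empty] at hbig'
      omega
    | var i =>
      rw [hgate] at hgk
      rw [hgk, MvPolynomial.vars_X, Finset.card_singleton] at hbig'
      omega
    | add a b =>
      rw [hgate] at hgk
      have ha : C.value a.1 (a.2.trans hk) = g a.1 := (dif_pos (a.2.trans hk)).symm
      have hb : C.value b.1 (b.2.trans hk) = g b.1 := (dif_pos (b.2.trans hk)).symm
      simp only [ha, hb] at hgk
      have hvars := vars_le h (g k) hh (hg k) hle
      have hlea : NonnegCoeffs (P - h * g a) := by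
        have := hle.add (hh.mul (hg b))
        rwa [hgk, show P - h * (g a + g b) + h * g b = P - h * g a by ring] at this
      have hleb : NonnegCoeffs (P - h * g b) := by
        have := hle.add (hh.mul (hg a))
        rwa [hgk, show P - h * (g a + g b) + h * g a = P - h * g b by ring] at this
      -- Since `g k` has more than two thirds of the variables, the disjoint cofactor `h` has fewer
      -- than one third; its product with a small summand is therefore balanced.
      have emit : ∀ c : ℕ, NonnegCoeffs (P - h * g c) → ¬ big c →
          MvPolynomial.eval (fun _ => 1) (h * g c) ≤ ρ * W := fun c hc hbc =>
        small h (g c) hh (hg c) hc (by omega) (not_lt.mp hbc)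
      refine ⟨a, a.2, b, b.2, if big a then h else 0, if big b then h else 0,
        (if big a then 0 else h * g a) + (if big b then 0 else h * g b), ?_, ?_, ?_, ?_, ?_, ?_, ?_⟩
      · split_ifs; exacts [hh, NonnegCoeffs.zero]
      · split_ifs; exacts [hh, NonnegCoeffs.zero]
      · refine NonnegCoeffs.add ?_ ?_
        · split_ifs; exacts [NonnegCoeffs.zero, hh.mul (hg a)]
        · split_ifs; exacts [NonnegCoeffs.zero, hh.mul (hg b)]
      · intro hne; by_contra hcon; exact hne (if_neg hcon)
      · intro hne; by_contra hcon; exact hne (if_neg hcon)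
      · rw [hgk]; split_ifs <;> ring
      · rw [map_add, show 2 * (ρ * W) = ρ * W + ρ * W by ring]
        refine add_le_add ?_ ?_
        · split_ifs with hba
          · simpa using hρW
          · exact emit a hlea hba
        · split_ifs with hbb
          · simpa using hρW
          · exact emit b hleb hbb
    | mul a b =>
      rw [hgate] at hgk
      have ha : C.value a.1 (a.2.trans hk) = g a.1 := (dif_pos (a.2.trans hk)).symm
      have hb : C.value b.1 (b.2.trans hk) = g b.1 := (dif_pos (b.2.trans hk)).symm
      simp only [ha, hb] at hgk
      by_cases hba : big a
      · exact ⟨a, a.2, b, b.2, h * g b, 0, 0, hh.mul (hg b), NonnegCoeffs.zero, NonnegCoeffs.zero,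
          fun _ => hba, fun h0 => absurd rfl h0, by rw [hgk]; ring, by simpa using hρW⟩
      by_cases hbb : big b
      · exact ⟨a, a.2, b, b.2, 0, h * g a, 0, NonnegCoeffs.zero, hh.mul (hg a), NonnegCoeffs.zero,
          fun h0 => absurd rfl h0, fun _ => hbb, by rw [hgk]; ring, by simpa using hρW⟩
      refine ⟨a, a.2, b, b.2, 0, 0, h * g k, NonnegCoeffs.zero, NonnegCoeffs.zero, hh.mul (hg k),
        fun h0 => absurd rfl h0, fun h0 => absurd rfl h0, by ring, ?_⟩
      have hcard : #(g k).vars ≤ #(g a).vars + #(g b).vars := by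
        rw [hgk]
        exact (Finset.card_le_card (MvPolynomial.vars_mul _ _)).trans (Finset.card_union_le _ _)
      have hsa : 3 * #(g a).vars ≤ 2 * N := not_lt.mp hba
      have hsb : 3 * #(g b).vars ≤ 2 * N := not_lt.mp hbb
      have hab : h * g k = g a * (h * g b) := by rw [hgk]; ring
      have hba' : h * g k = g b * (h * g a) := by rw [hgk]; ring
      -- Both factors of the gate are small, but the larger one has more than one third of the
      -- variables. Grouping `h` with the other one leaves fewer than two thirds on that side.
      have bound : MvPolynomial.eval (fun _ => 1) (h * g k) ≤ ρ * W := by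
        rcases le_total (#(g a).vars) (#(g b).vars) with hc | hc
        · have := vars_le (g b) (h * g a) (hg b) (hh.mul (hg a)) (hba' ▸ hle)
          rw [hba']
          exact small _ _ (hg b) (hh.mul (hg a)) (hba' ▸ hle) hsb (by omega)
        · have := vars_le (g a) (h * g b) (hg a) (hh.mul (hg b)) (hab ▸ hle)
          rw [hab]
          exact small _ _ (hg a) (hh.mul (hg b)) (hab ▸ hle) hsa (by omega)
      linarith
  -- The gates are eliminated from last to first. `h i` is the cofactor accumulated at gate `i`, and
  -- `E` collects the balanced products cut off so far, with weight at most `2 * (ρ * W)` for each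
  -- gate.
  have descent : ∀ j ≤ C.size, ∃ (h : ℕ → MvPolynomial σ ℝ) (E : MvPolynomial σ ℝ),
      (∀ i, NonnegCoeffs (h i)) ∧ NonnegCoeffs E ∧ (∀ i, h i ≠ 0 → big i) ∧
      P = ∑ i ∈ Finset.range (C.size - j), h i * g i + E ∧
      MvPolynomial.eval (fun _ => 1) E ≤ 2 * j * (ρ * W) := by
    intro j
    induction j with
    | zero =>
      intro _
      -- The output gate need not be the last one; gates after it simply carry cofactor 0.
      refine ⟨fun i => if i = C.output then 1 else 0, 0, fun i => ?_, NonnegCoeffs.zero,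
        fun i hi => ?_, ?_, by simp⟩
      · dsimp only; split_ifs; exacts [NonnegCoeffs.one, NonnegCoeffs.zero]
      · have : i = C.output := by by_contra hne; exact hi (if_neg hne)
        simp only [big, this, hgP]
        exact root
      · simp [Finset.sum_ite_eq', hgP]
    | succ j ih =>
      intro hj
      obtain ⟨h, E, hh, hE, hbig, hPE, hEW⟩ := ih (by omega)
      obtain ⟨k, hk⟩ : ∃ k, C.size - j = k + 1 := ⟨C.size - j - 1, by omega⟩
      have hk' : C.size - (j + 1) = k := by omega
      rw [hk, Finset.sum_range_succ] at hPE
      rw [hk']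
      push_cast
      by_cases h0 : h k = 0
      · refine ⟨h, E, hh, hE, hbig, by simpa [h0] using hPE, ?_⟩
        nlinarith
      have hle : NonnegCoeffs (P - h k * g k) := by
        have : P - h k * g k = ∑ i ∈ Finset.range k, h i * g i + E := by
          conv_lhs => rw [hPE]
          ring
        rw [this]
        exact (NonnegCoeffs.sum fun i _ => (hh i).mul (hg i)).add hE
      obtain ⟨a, hak, b, hbk, u, v, E', hu, hv, hE', hua, hvb, heq, hE'W⟩ :=
        split k (by omega) (h k) (hh k) hle (hbig k h0)
      refine ⟨fun i => h i + (if i = a then u else 0) + (if i = b then v else 0), E + E',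
        fun i => ((hh i).add ?_).add ?_, hE.add hE', fun i hi => ?_, ?_, ?_⟩
      · split_ifs; exacts [hu, NonnegCoeffs.zero]
      · split_ifs; exacts [hv, NonnegCoeffs.zero]
      · by_contra hcon
        refine hi ?_
        have e1 : h i = 0 := by_contra fun hne => hcon (hbig i hne)
        have e2 : (if i = a then u else 0) = 0 := by
          split_ifs with hia
          · exact by_contra fun hne => hcon (hia ▸ hua hne)
          · rfl
        have e3 : (if i = b then v else 0) = 0 := by
          split_ifs with hib
          · exact by_contra fun hne => hcon (hib ▸ hvb hne)
          · rfl
        dsimp only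
        rw [e1, e2, e3]; simp
      · rw [heq] at hPE
        conv_lhs => rw [hPE]
        simp only [add_mul, Finset.sum_add_distrib, ite_mul, zero_mul, Finset.sum_ite_eq',
          Finset.mem_range, if_pos hak, if_pos hbk]
        ring
      · rw [map_add]
        linarith
  obtain ⟨h, E, -, -, -, hPE, hEW⟩ := descent C.size le_rfl
  rw [Nat.sub_self, Finset.sum_range_zero, zero_add] at hPE
  rwa [← hPE] at hEW

end CircuitDecomposition

/-! ### Rank one minorants of tensor products of 2 × 2 matrices -/

section RankOneMinorants

/-- Every rank one non-negative matrix below a multiple of the `2 × 2` matrix `M` has at most a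
`θ`-fraction of the sum of the entries. -/
def RankOneGap (θ : ℝ) (M : Bool → Bool → ℝ) : Prop :=
  ∀ L : ℝ, 0 ≤ L → ∀ α β : Bool → ℝ, (∀ s, 0 ≤ α s) → (∀ t, 0 ≤ β t) →
    (∀ s t, α s * β t ≤ L * M s t) → ∑ s, ∑ t, α s * β t ≤ θ * (L * ∑ s, ∑ t, M s t)

/-- A rank one matrix has equal diagonal and antidiagonal products, so it cannot nearly attain both
diagonal entries of `M`. One of them loses a twentieth, and each of them is at least the fraction
`c` of the total. -/
theorem rankOneGap_of_det {M : Bool → Bool → ℝ} {c : ℝ} (hM : ∀ s t, 0 ≤ M s t)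
    (hdet : M true true * M false false = 10 / 9 * (M true false * M false true))
    (h₀ : c * ∑ s, ∑ t, M s t ≤ M false false) (h₁ : c * ∑ s, ∑ t, M s t ≤ M true true) :
    RankOneGap (1 - c / 20) M := by
  intro L hL α β hα hβ hle
  simp only [Fintype.sum_bool] at h₀ h₁ ⊢
  -- The constant 19/20 works because (19/20)² · 10/9 = 361/360 > 1.
  have key : α false * β false ≤ 19 / 20 * (L * M false false) ∨
      α true * β true ≤ 19 / 20 * (L * M true true) := by
    by_contra! hcon
    obtain ⟨c1, c2⟩ := hcon
    have n1 : 0 ≤ L * M false false := mul_nonneg hL (hM _ _)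
    have n2 : 0 ≤ L * M true true := mul_nonneg hL (hM _ _)
    have e1 : (19 / 20 * (L * M false false)) * (19 / 20 * (L * M true true)) <
        (α false * β false) * (α true * β true) := by
      apply mul_lt_mul'' c1 c2 <;> positivity
    have e2 : (α true * β false) * (α false * β true) ≤
        (L * M true false) * (L * M false true) := by
      apply mul_le_mul (hle _ _) (hle _ _) (mul_nonneg (hα _) (hβ _))
        (mul_nonneg hL (hM _ _))
    have e3 : 0 ≤ L ^ 2 * (M true false * M false true) :=
      mul_nonneg (sq_nonneg L) (mul_nonneg (hM _ _) (hM _ _))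
    have e4 : (19 / 20 * (L * M false false)) * (19 / 20 * (L * M true true)) =
      (361 / 400) * (L ^ 2 * (M true true * M false false)) := by ring
    rw [e4, hdet] at e1
    nlinarith
  have a1 := hle true true
  have a2 := hle true false
  have a3 := hle false true
  have a4 := hle false false
  have b0 := mul_le_mul_of_nonneg_left h₀ hL
  have b1 := mul_le_mul_of_nonneg_left h₁ hL
  rcases key with h | h <;> nlinarith

/-- Induction on the number of tensor factors: after summing out all coordinates but the first, what
remains is again a rank one 2 × 2 matrix, below a multiple of `M 0` that has already gained `θ ^ k`.
-/
theorem sum_rankOne_le_of_le_prod {θ : ℝ} {k : ℕ} (M : Fin k → Bool → Bool → ℝ)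
    (hM : ∀ i s t, 0 ≤ M i s t) (gap : ∀ i, RankOneGap θ (M i)) (hθ : 0 ≤ θ) (K : ℝ) (hK : 0 ≤ K)
    (a b : (Fin k → Bool) → ℝ) (ha : ∀ s, 0 ≤ a s) (hb : ∀ t, 0 ≤ b t)
    (hle : ∀ s t, a s * b t ≤ K * ∏ i, M i (s i) (t i)) :
    ∑ s, ∑ t, a s * b t ≤ θ ^ k * ∑ s : Fin k → Bool, ∑ t : Fin k → Bool,
      K * ∏ i, M i (s i) (t i) := by
  have sum_cons : ∀ {k : ℕ} (f : (Fin (k + 1) → Bool) → ℝ),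
      ∑ s, f s = ∑ s₀ : Bool, ∑ s : Fin k → Bool, f (Fin.cons s₀ s) := by
    intro k f
    rw [← (Fin.consEquiv fun _ : Fin (k + 1) => Bool).sum_comp, Fintype.sum_prod_type]
    rfl
  induction k generalizing K with
  | zero =>
    simp only [Fintype.sum_unique, pow_zero, one_mul]
    exact hle _ _
  | succ k ih =>
    set Q : ℝ := ∑ s : Fin k → Bool, ∑ t : Fin k → Bool, K * ∏ i, M i.succ (s i) (t i)
    have hQ : 0 ≤ Q := Finset.sum_nonneg fun s _ => Finset.sum_nonneg fun t _ =>
      mul_nonneg hK (Finset.prod_nonneg fun i _ => hM _ _ _)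
    -- With the first coordinates fixed, the entry `M 0 s₀ t₀` goes into the constant `K` of the
    -- induction hypothesis.
    have inner : ∀ s₀ t₀ : Bool,
        (∑ s : Fin k → Bool, a (Fin.cons s₀ s)) * (∑ t : Fin k → Bool, b (Fin.cons t₀ t)) ≤
          (θ ^ k * Q) * M 0 s₀ t₀ := by
      intro s₀ t₀
      have := ih (fun i => M i.succ) (fun i => hM _) (fun i => gap _) (K * M 0 s₀ t₀)
        (mul_nonneg hK (hM _ _ _)) (fun s => a (Fin.cons s₀ s)) (fun t => b (Fin.cons t₀ t))
        (fun s => ha _) (fun t => hb _) (fun s t => by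
          refine (hle _ _).trans_eq ?_
          rw [Fin.prod_univ_succ]
          simp only [Fin.cons_zero, Fin.cons_succ]
          ring)
      rw [Finset.sum_mul_sum]
      refine this.trans_eq ?_
      rw [mul_assoc, Finset.sum_mul]
      congr 1
      refine Finset.sum_congr rfl fun s _ => ?_
      rw [Finset.sum_mul]
      exact Finset.sum_congr rfl fun t _ => by ring
    have outer := gap 0 (θ ^ k * Q) (by positivity) (fun s₀ => ∑ s, a (Fin.cons s₀ s))
      (fun t₀ => ∑ t, b (Fin.cons t₀ t)) (fun s₀ => Finset.sum_nonneg fun s _ => ha _)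
      (fun t₀ => Finset.sum_nonneg fun t _ => hb _) inner
    have left : ∑ s, ∑ t, a s * b t = ∑ s₀ : Bool, ∑ t₀ : Bool,
        (∑ s : Fin k → Bool, a (Fin.cons s₀ s)) * (∑ t : Fin k → Bool, b (Fin.cons t₀ t)) := by
      rw [← Finset.sum_mul_sum, sum_cons, ← Finset.sum_mul_sum, sum_cons]
    have right : ∑ s : Fin (k + 1) → Bool, ∑ t : Fin (k + 1) → Bool, K * ∏ i, M i (s i) (t i) =
        Q * ∑ s₀, ∑ t₀, M 0 s₀ t₀ := by
      rw [sum_cons]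
      simp_rw [sum_cons, Fin.prod_univ_succ, Fin.cons_zero, Fin.cons_succ]
      rw [Finset.mul_sum]
      refine Finset.sum_congr rfl fun s₀ _ => ?_
      rw [Finset.sum_comm, Finset.mul_sum]
      refine Finset.sum_congr rfl fun t₀ _ => ?_
      rw [Finset.sum_mul]
      refine Finset.sum_congr rfl fun s _ => ?_
      rw [Finset.sum_mul]
      exact Finset.sum_congr rfl fun t _ => by ring
    rw [left, right, pow_succ]
    refine outer.trans_eq ?_
    ring

end RankOneMinorants

/-! ### Induced matchings and the local structure of the coefficients -/

section CrossingMatching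

variable {n : ℕ} (G : SimpleGraph (Fin n)) [DecidableRel G.Adj]

/-- The pairs `(y i, z i)` form an induced matching of `G` between `Y` and its complement. -/
structure IsCrossingMatching (Y : Finset (Fin n)) {k : ℕ} (y z : Fin k → Fin n) : Prop where
  left_mem : ∀ i, y i ∈ Y
  right_notMem : ∀ i, z i ∉ Y
  adj : ∀ i, G.Adj (y i) (z i)
  eq_of_touch : ∀ i j u v, u = y i ∨ u = z i → v = y j ∨ v = z j → u = v ∨ G.Adj u v → i = j

/-- The factor of an edge in the coefficient of `x^S` of the hard polynomial. -/
noncomputable def edgeFactor (e : Sym2 (Fin n)) (S : Finset (Fin n)) : ℝ :=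
  (1 + (2 : ℝ) ^ #{i ∈ S | i ∈ e}) / 2

theorem edgeFactor_pos (e : Sym2 (Fin n)) (S : Finset (Fin n)) : 0 < edgeFactor e S := by
  unfold edgeFactor; positivity

theorem edgeFactor_congr {e : Sym2 (Fin n)} {S T : Finset (Fin n)}
    (h : ∀ i ∈ e, i ∈ S ↔ i ∈ T) : edgeFactor e S = edgeFactor e T := by
  have : {i ∈ S | i ∈ e} = {i ∈ T | i ∈ e} := by
    ext i
    simp only [Finset.mem_filter]
    exact ⟨fun ⟨h1, h2⟩ => ⟨(h i h2).mp h1, h2⟩, fun ⟨h1, h2⟩ => ⟨(h i h2).mpr h1, h2⟩⟩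
  unfold edgeFactor
  rw [this]

theorem edgeFactor_mono {e : Sym2 (Fin n)} {S T : Finset (Fin n)} (h : S ⊆ T) :
    edgeFactor e S ≤ edgeFactor e T := by
  unfold edgeFactor
  have : #{i ∈ S | i ∈ e} ≤ #{i ∈ T | i ∈ e} :=
    Finset.card_le_card (Finset.filter_subset_filter _ h)
  gcongr
  norm_num

theorem edgeFactor_union_pair_le (e : Sym2 (Fin n)) (S : Finset (Fin n)) (u v : Fin n) :
    edgeFactor e (S ∪ {u, v}) ≤ 4 * edgeFactor e S := by
  have : #{i ∈ S ∪ {u, v} | i ∈ e} ≤ #{i ∈ S | i ∈ e} + 2 := by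
    rw [Finset.filter_union]
    refine (Finset.card_union_le _ _).trans (Nat.add_le_add_left ?_ _)
    exact (Finset.card_filter_le _ _).trans Finset.card_le_two
  have h2 : (2 : ℝ) ^ #{i ∈ S ∪ {u, v} | i ∈ e} ≤ 2 ^ (#{i ∈ S | i ∈ e} + 2) :=
    pow_le_pow_right₀ (by norm_num) this
  unfold edgeFactor
  rw [pow_add] at h2
  linarith

/-- The vertices `u` if `s` holds and `v` if `t` holds. -/
def pick (u v : Fin n) (s t : Bool) : Finset (Fin n) :=
  {w ∈ ({u, v} : Finset (Fin n)) | (s = true ∧ w = u) ∨ (t = true ∧ w = v)}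

theorem mem_pick {u v w : Fin n} {s t : Bool} :
    w ∈ pick u v s t ↔ (s = true ∧ w = u) ∨ (t = true ∧ w = v) := by
  simp only [pick, Finset.mem_filter, Finset.mem_insert, Finset.mem_singleton]
  tauto

/-- The `2 × 2` matrix of the contributions of the edges at `u` or `v` to the coefficients
of `S`, `S ∪ {u}`, `S ∪ {v}` and `S ∪ {u, v}`. -/
noncomputable def localMatrix (S : Finset (Fin n)) (u v : Fin n) (s t : Bool) : ℝ :=
  ∏ e ∈ G.edgeFinset with u ∈ e ∨ v ∈ e, edgeFactor e (S ∪ pick u v s t)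

theorem localMatrix_pos (S : Finset (Fin n)) (u v : Fin n) (s t : Bool) :
    0 < localMatrix G S u v s t :=
  Finset.prod_pos fun _ _ => edgeFactor_pos _ _

/-- An edge that contains only one of u and v sees only one of the two bits, so its factors cancel.
Only the edge uv remains, with (5/2) · 1 against (3/2)². -/
theorem localMatrix_det {S : Finset (Fin n)} {u v : Fin n} (huv : G.Adj u v) (hu : u ∉ S)
    (hv : v ∉ S) : localMatrix G S u v true true * localMatrix G S u v false false =
      10 / 9 * (localMatrix G S u v true false * localMatrix G S u v false true) := by
  have hne := huv.ne
  have hmem : s(u, v) ∈ {e ∈ G.edgeFinset | u ∈ e ∨ v ∈ e} := by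
    simp [huv]
  have factor : ∀ e ∈ {e ∈ G.edgeFinset | u ∈ e ∨ v ∈ e},
      edgeFactor e (S ∪ pick u v true true) * edgeFactor e (S ∪ pick u v false false) =
      (if e = s(u, v) then 10 / 9 else 1) *
        (edgeFactor e (S ∪ pick u v true false) * edgeFactor e (S ∪ pick u v false true)) := by
    intro e he
    split_ifs with hd
    · subst hd
      unfold edgeFactor
      simp only [card_filter_mem_sym2_mk hne]
      simp [mem_pick, hu, hv, hne, hne.symm]
      norm_num
    · by_cases hue : u ∈ e
      · have hve : v ∉ e := fun hve => hd ((Sym2.mem_and_mem_iff hne).mp ⟨hue, hve⟩)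
        rw [edgeFactor_congr (T := S ∪ pick u v true false) (S := S ∪ pick u v true true),
          edgeFactor_congr (T := S ∪ pick u v false true) (S := S ∪ pick u v false false), one_mul]
        all_goals
          intro i hi
          have : i ≠ v := fun h => hve (h ▸ hi)
          simp [mem_pick, this]
      · have hve : v ∈ e := ((Finset.mem_filter.mp he).2).resolve_left hue
        rw [edgeFactor_congr (T := S ∪ pick u v false true) (S := S ∪ pick u v true true),
          edgeFactor_congr (T := S ∪ pick u v true false) (S := S ∪ pick u v false false), one_mul,
          mul_comm]
        all_goals
          intro i hi
          have : i ≠ u := fun h => hue (h ▸ hi)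
          simp [mem_pick, this]
  unfold localMatrix
  rw [← Finset.prod_mul_distrib, Finset.prod_congr rfl factor, Finset.prod_mul_distrib,
    Finset.prod_mul_distrib, Finset.prod_ite_eq', if_pos hmem]

/-- At most 2d edges touch u or v, and adding both vertices multiplies each edge factor by at most
4. So the entries differ by a factor of at most 16^d, and the smallest one is at least 1 / (4 ·
16^d) of the sum of the four. -/
theorem rankOneGap_localMatrix {d : ℕ} (hG : G.IsRegularOfDegree d) {S : Finset (Fin n)}
    {u v : Fin n} (huv : G.Adj u v) (hu : u ∉ S) (hv : v ∉ S) :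
    RankOneGap (1 - 1 / (4 * 16 ^ d) / 20) (localMatrix G S u v) := by
  have mono : ∀ s t, localMatrix G S u v false false ≤ localMatrix G S u v s t ∧
      localMatrix G S u v s t ≤ localMatrix G S u v true true := by
    intro s t
    constructor <;>
    · refine Finset.prod_le_prod (fun e _ => (edgeFactor_pos _ _).le) fun e _ =>
        edgeFactor_mono (Finset.union_subset_union_right fun w hw => ?_)
      rw [mem_pick] at hw ⊢
      simp at hw ⊢
      try tauto
  have hcard : #{e ∈ G.edgeFinset | u ∈ e ∨ v ∈ e} ≤ 2 * d := by
    rw [Finset.filter_or, ← SimpleGraph.incidenceFinset_eq_filter,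
      ← SimpleGraph.incidenceFinset_eq_filter]
    refine (Finset.card_union_le _ _).trans ?_
    rw [SimpleGraph.card_incidenceFinset_eq_degree, SimpleGraph.card_incidenceFinset_eq_degree,
      hG.degree_eq, hG.degree_eq, two_mul]
  have ratio : localMatrix G S u v true true ≤ 16 ^ d * localMatrix G S u v false false := by
    calc localMatrix G S u v true true
        ≤ ∏ e ∈ G.edgeFinset with u ∈ e ∨ v ∈ e, 4 * edgeFactor e (S ∪ pick u v false false) := by
          refine Finset.prod_le_prod (fun e _ => (edgeFactor_pos _ _).le) fun e _ => ?_
          have h1 : pick u v true true = {u, v} := by ext; simp [mem_pick]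
          have h2 : pick u v false false = ∅ := by ext; simp [mem_pick]
          rw [h1, h2, Finset.union_empty]
          exact edgeFactor_union_pair_le _ _ _ _
      _ = 4 ^ #{e ∈ G.edgeFinset | u ∈ e ∨ v ∈ e} * localMatrix G S u v false false := by
          rw [Finset.prod_mul_distrib, Finset.prod_const, localMatrix]
      _ ≤ 4 ^ (2 * d) * localMatrix G S u v false false := by
          refine mul_le_mul_of_nonneg_right ?_ (localMatrix_pos _ _ _ _ _ _).le
          exact pow_le_pow_right₀ (by norm_num) hcard
      _ = 16 ^ d * localMatrix G S u v false false := by rw [pow_mul]; norm_num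
  have sum_le : ∑ s, ∑ t, localMatrix G S u v s t ≤
      4 * 16 ^ d * localMatrix G S u v false false := by
    simp only [Fintype.sum_bool]
    have h1 := (mono true false).2
    have h2 := (mono false true).2
    have h3 := (mono false false).2
    linarith
  have h₀ : 1 / (4 * 16 ^ d) * ∑ s, ∑ t, localMatrix G S u v s t ≤
      localMatrix G S u v false false := by
    rw [div_mul_eq_mul_div, one_mul, div_le_iff₀ (by positivity), mul_comm]
    exact sum_le
  exact rankOneGap_of_det (fun s t => (localMatrix_pos _ _ _ _ _ _).le)
    (localMatrix_det G huv hu hv) h₀ (h₀.trans (mono true true).1)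

variable {G} {Y : Finset (Fin n)} {k : ℕ} {y z : Fin k → Fin n}

/-- The set `S` together with the `y i` with `s i` and the `z i` with `t i`. -/
def fill (y z : Fin k → Fin n) (S : Finset (Fin n)) (s t : Fin k → Bool) : Finset (Fin n) :=
  S ∪ univ.biUnion fun i => pick (y i) (z i) (s i) (t i)

theorem mem_fill {S : Finset (Fin n)} {s t : Fin k → Bool} {w : Fin n} :
    w ∈ fill y z S s t ↔ w ∈ S ∨ (∃ i, s i = true ∧ w = y i) ∨ ∃ i, t i = true ∧ w = z i := by
  simp only [fill, Finset.mem_union, Finset.mem_biUnion, Finset.mem_univ, true_and, mem_pick,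
    exists_or]

/-- The matching being induced, no edge touches two of its pairs. Hence the edges split into those
that touch no pair and one group for each pair. -/
theorem hardWeight_fill (h : IsCrossingMatching G Y y z) (S : Finset (Fin n))
    (s t : Fin k → Bool) : hardWeight G (fill y z S s t) =
      (∏ e ∈ G.edgeFinset with ¬ ∃ i, y i ∈ e ∨ z i ∈ e, edgeFactor e S) *
        ∏ i, localMatrix G S (y i) (z i) (s i) (t i) := by
  classical
  have touch_unique : ∀ e ∈ G.edgeFinset, ∀ i j, (y i ∈ e ∨ z i ∈ e) → (y j ∈ e ∨ z j ∈ e) →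
      i = j := by
    intro e he i j hi hj
    obtain ⟨u, hu, hue⟩ : ∃ u, (u = y i ∨ u = z i) ∧ u ∈ e := by
      rcases hi with hi | hi
      exacts [⟨_, Or.inl rfl, hi⟩, ⟨_, Or.inr rfl, hi⟩]
    obtain ⟨v, hv, hve⟩ : ∃ v, (v = y j ∨ v = z j) ∧ v ∈ e := by
      rcases hj with hj | hj
      exacts [⟨_, Or.inl rfl, hj⟩, ⟨_, Or.inr rfl, hj⟩]
    refine h.eq_of_touch i j u v hu hv ?_
    by_cases huv : u = v
    · exact Or.inl huv
    · right
      rw [(Sym2.mem_and_mem_iff huv).mp ⟨hue, hve⟩] at he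
      simpa using he
  have split : {e ∈ G.edgeFinset | ∃ i, y i ∈ e ∨ z i ∈ e} =
      univ.biUnion fun i => {e ∈ G.edgeFinset | y i ∈ e ∨ z i ∈ e} := by
    ext e
    simp only [Finset.mem_filter, Finset.mem_biUnion, Finset.mem_univ, true_and]
    exact ⟨fun ⟨h1, i, h2⟩ => ⟨i, h1, h2⟩, fun ⟨i, h1, h2⟩ => ⟨h1, i, h2⟩⟩
  change ∏ e ∈ G.edgeFinset, edgeFactor e (fill y z S s t) = _
  rw [← Finset.prod_filter_mul_prod_filter_not G.edgeFinset (fun e => ∃ i, y i ∈ e ∨ z i ∈ e),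
    mul_comm, split, Finset.prod_biUnion]
  · congr 1
    · refine Finset.prod_congr rfl fun e he => edgeFactor_congr fun w hw => ?_
      have := (Finset.mem_filter.mp he).2
      push Not at this
      rw [mem_fill]
      refine ⟨?_, Or.inl⟩
      rintro (h1 | ⟨i, -, rfl⟩ | ⟨i, -, rfl⟩)
      exacts [h1, absurd hw (this i).1, absurd hw (this i).2]
    · refine Finset.prod_congr rfl fun i _ => Finset.prod_congr rfl fun e he =>
        edgeFactor_congr fun w hw => ?_
      obtain ⟨he, hi⟩ := Finset.mem_filter.mp he
      rw [mem_fill, Finset.mem_union, mem_pick]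
      constructor
      · rintro (h1 | ⟨j, hj, rfl⟩ | ⟨j, hj, rfl⟩)
        · exact Or.inl h1
        · obtain rfl := touch_unique e he i j hi (Or.inl hw)
          exact Or.inr (Or.inl ⟨hj, rfl⟩)
        · obtain rfl := touch_unique e he i j hi (Or.inr hw)
          exact Or.inr (Or.inr ⟨hj, rfl⟩)
      · rintro (h1 | ⟨hj, rfl⟩ | ⟨hj, rfl⟩)
        exacts [Or.inl h1, Or.inr (Or.inl ⟨i, hj, rfl⟩), Or.inr (Or.inr ⟨i, hj, rfl⟩)]
  · intro i _ j _ hij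
    rw [Function.onFun, Finset.disjoint_left]
    intro e hi hj
    rw [Finset.mem_filter] at hi hj
    exact hij (touch_unique e hi.1 i j hi.2 hj.2)

theorem IsCrossingMatching.left_injective {G : SimpleGraph (Fin n)}
    (h : IsCrossingMatching G Y y z) :
    Function.Injective y := fun i j hij =>
  h.eq_of_touch i j (y i) (y j) (Or.inl rfl) (Or.inl rfl) (Or.inl hij)

theorem IsCrossingMatching.right_injective {G : SimpleGraph (Fin n)}
    (h : IsCrossingMatching G Y y z) :
    Function.Injective z := fun i j hij =>
  h.eq_of_touch i j (z i) (z j) (Or.inr rfl) (Or.inr rfl) (Or.inl hij)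

theorem IsCrossingMatching.left_ne_right {G : SimpleGraph (Fin n)}
    (h : IsCrossingMatching G Y y z) (i j : Fin k) :
    y i ≠ z j := fun hij => h.right_notMem j (hij ▸ h.left_mem i)

/-- Every vertex set is determined by its trace outside the matching together with one bit for each
matched vertex. -/
theorem sum_eq_sum_fill {G : SimpleGraph (Fin n)} (h : IsCrossingMatching G Y y z)
    (f : Finset (Fin n) → ℝ) :
    ∑ S, f S = ∑ S ∈ (univ.filter fun v => ∀ i, v ≠ y i ∧ v ≠ z i).powerset,
      ∑ s : Fin k → Bool, ∑ t : Fin k → Bool, f (fill y z S s t) := by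
  classical
  set W : Finset (Fin n) := univ.filter fun v => ∀ i, v ≠ y i ∧ v ≠ z i
  simp_rw [← Fintype.sum_prod_type' (fun s t => f (fill y z _ s t))]
  rw [← Finset.sum_product']
  refine Finset.sum_nbij' (fun S => (S ∩ W, (fun i => decide (y i ∈ S), fun i => decide (z i ∈ S))))
    (fun p => fill y z p.1 p.2.1 p.2.2) ?_ ?_ ?_ ?_ ?_
  · intro S _
    simp
  · intro p _
    simp
  · intro S _
    ext w
    simp only [mem_fill, Finset.mem_inter, decide_eq_true_eq, W, Finset.mem_filter,
      Finset.mem_univ, true_and]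
    constructor
    · rintro (⟨h1, -⟩ | ⟨i, h1, rfl⟩ | ⟨i, h1, rfl⟩) <;> exact h1
    · intro hw
      by_cases hex : ∃ i, w = y i ∨ w = z i
      · obtain ⟨i, rfl | rfl⟩ := hex
        exacts [Or.inr (Or.inl ⟨i, hw, rfl⟩), Or.inr (Or.inr ⟨i, hw, rfl⟩)]
      · push Not at hex
        exact Or.inl ⟨hw, hex⟩
  · rintro ⟨S, s, t⟩ hp
    have hS : S ⊆ W := by simpa using hp
    have hSW : ∀ v ∈ S, ∀ i, v ≠ y i ∧ v ≠ z i := fun v hv => (Finset.mem_filter.mp (hS hv)).2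
    refine Prod.ext ?_ (Prod.ext ?_ ?_)
    · ext w
      simp only [Finset.mem_inter, mem_fill]
      constructor
      · rintro ⟨h1 | ⟨i, -, rfl⟩ | ⟨i, -, rfl⟩, h2⟩
        · exact h1
        · exact absurd rfl ((Finset.mem_filter.mp h2).2 i).1
        · exact absurd rfl ((Finset.mem_filter.mp h2).2 i).2
      · exact fun hw => ⟨Or.inl hw, hS hw⟩
    · ext i
      have : y i ∈ fill y z S s t ↔ s i = true := by
        rw [mem_fill]
        constructor
        · rintro (h1 | ⟨j, hj, h1⟩ | ⟨j, -, h1⟩)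
          · exact absurd rfl (hSW _ h1 i).1
          · rwa [h.left_injective h1]
          · exact absurd h1 (h.left_ne_right i j)
        · exact fun hi => Or.inr (Or.inl ⟨i, hi, rfl⟩)
      simp [this]
    · ext i
      have : z i ∈ fill y z S s t ↔ t i = true := by
        rw [mem_fill]
        constructor
        · rintro (h1 | ⟨j, -, h1⟩ | ⟨j, hj, h1⟩)
          · exact absurd rfl (hSW _ h1 i).2
          · exact absurd h1.symm (h.left_ne_right j i)
          · rwa [h.right_injective h1]
        · exact fun hi => Or.inr (Or.inr ⟨i, hi, rfl⟩)
      simp [this]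
  · intro S _
    congr 1
    ext w
    simp only [mem_fill, Finset.mem_inter, decide_eq_true_eq, W, Finset.mem_filter,
      Finset.mem_univ, true_and]
    constructor
    · intro hw
      by_cases hex : ∃ i, w = y i ∨ w = z i
      · obtain ⟨i, rfl | rfl⟩ := hex
        exacts [Or.inr (Or.inl ⟨i, hw, rfl⟩), Or.inr (Or.inr ⟨i, hw, rfl⟩)]
      · push Not at hex
        exact Or.inl ⟨hw, hex⟩
    · rintro (⟨h1, -⟩ | ⟨i, h1, rfl⟩ | ⟨i, h1, rfl⟩) <;> exact h1

/-- A product of a function of `S ∩ Y` and a function of `S \ Y` below the coefficients of the hard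
polynomial has an exponentially small fraction of their sum if there is a large induced matching
between `Y` and its complement. -/
theorem sum_mul_le_of_crossingMatching {d : ℕ} (hG : G.IsRegularOfDegree d)
    (h : IsCrossingMatching G Y y z) (a b : Finset (Fin n) → ℝ) (ha : ∀ S, 0 ≤ a S)
    (hb : ∀ S, 0 ≤ b S) (hle : ∀ S, a (S ∩ Y) * b (S \ Y) ≤ hardWeight G S) :
    ∑ S, a (S ∩ Y) * b (S \ Y) ≤
      (1 - 1 / (4 * 16 ^ d) / 20 : ℝ) ^ k * ∑ S, hardWeight G S := by
  rw [sum_eq_sum_fill h, sum_eq_sum_fill h, Finset.mul_sum]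
  refine Finset.sum_le_sum fun S hS => ?_
  have hSW : ∀ v ∈ S, ∀ i, v ≠ y i ∧ v ≠ z i := fun v hv =>
    (Finset.mem_filter.mp (Finset.mem_powerset.mp hS hv)).2
  -- The `z i` lie outside `Y` and the `y i` inside, so the two factors depend on `s` alone and on
  -- `t` alone: for fixed `S` the product is a rank one matrix.
  have left : ∀ s t : Fin k → Bool,
      fill y z S s t ∩ Y = fill y z S s (fun _ => false) ∩ Y := by
    intro s t
    ext w
    simp only [Finset.mem_inter, mem_fill]
    constructor
    · rintro ⟨h1 | h1 | ⟨i, -, rfl⟩, h2⟩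
      exacts [⟨Or.inl h1, h2⟩, ⟨Or.inr (Or.inl h1), h2⟩, absurd h2 (h.right_notMem i)]
    · rintro ⟨h1 | h1 | ⟨i, h1, -⟩, h2⟩
      exacts [⟨Or.inl h1, h2⟩, ⟨Or.inr (Or.inl h1), h2⟩, by simp at h1]
  have right : ∀ s t : Fin k → Bool,
      fill y z S s t \ Y = fill y z S (fun _ => false) t \ Y := by
    intro s t
    ext w
    simp only [Finset.mem_sdiff, mem_fill]
    constructor
    · rintro ⟨h1 | ⟨i, -, rfl⟩ | h1, h2⟩
      exacts [⟨Or.inl h1, h2⟩, absurd (h.left_mem i) h2, ⟨Or.inr (Or.inr h1), h2⟩]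
    · rintro ⟨h1 | ⟨i, h1, -⟩ | h1, h2⟩
      exacts [⟨Or.inl h1, h2⟩, by simp at h1, ⟨Or.inr (Or.inr h1), h2⟩]
  simp_rw [hardWeight_fill h]
  have hθ : (0 : ℝ) ≤ 1 - 1 / (4 * 16 ^ d) / 20 := by
    have h1 : (1 : ℝ) ≤ 16 ^ d := one_le_pow₀ (by norm_num)
    have h2 : (1 : ℝ) / (4 * 16 ^ d) ≤ 1 := by
      rw [div_le_one (by positivity)]; linarith
    linarith
  have := sum_rankOne_le_of_le_prod (fun i => localMatrix G S (y i) (z i))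
    (fun i s t => (localMatrix_pos G _ _ _ _ _).le)
    (fun i => rankOneGap_localMatrix G hG (h.adj i) (fun hi => (hSW _ hi i).1 rfl)
      (fun hi => (hSW _ hi i).2 rfl)) hθ
    (∏ e ∈ G.edgeFinset with ¬ ∃ i, y i ∈ e ∨ z i ∈ e, edgeFactor e S)
    (Finset.prod_nonneg fun e _ => (edgeFactor_pos _ _).le)
    (fun s => a (fill y z S s (fun _ => false) ∩ Y))
    (fun t => b (fill y z S (fun _ => false) t \ Y)) (fun s => ha _) (fun t => hb _)
    (fun s t => by
      rw [← left s t, ← right s t, ← hardWeight_fill h]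
      exact hle _)
  refine le_trans (Finset.sum_le_sum fun s _ => Finset.sum_le_sum fun t _ => ?_) this
  rw [left s t, right s t]

end CrossingMatching

/-! ### Spectral gap, quadratic forms and edge expansion -/

section Spectral

open Matrix

variable {n : ℕ} (G : SimpleGraph (Fin n)) [DecidableRel G.Adj]

/-- An orthonormal eigenbasis of the adjacency matrix, as plain vectors. -/
noncomputable def adjEigenvector (j : Fin n) : Fin n → ℝ :=
  ⇑((adjMatrix_isHermitian G).eigenvectorBasis j)

theorem adjMatrix_mulVec_adjEigenvector (j : Fin n) :
    G.adjMatrix ℝ *ᵥ adjEigenvector G j =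
      (adjMatrix_isHermitian G).eigenvalues j • adjEigenvector G j :=
  (adjMatrix_isHermitian G).mulVec_eigenvectorBasis j

theorem dotProduct_adjEigenvector (i j : Fin n) :
    adjEigenvector G i ⬝ᵥ adjEigenvector G j = if i = j then 1 else 0 := by
  have := orthonormal_iff_ite.mp (adjMatrix_isHermitian G).eigenvectorBasis.orthonormal j i
  rw [EuclideanSpace.inner_eq_star_dotProduct] at this
  simpa [adjEigenvector, eq_comm] using this

theorem dotProduct_eq_sum_adjEigenvector (f g : Fin n → ℝ) :
    f ⬝ᵥ g = ∑ j, (adjEigenvector G j ⬝ᵥ f) * (adjEigenvector G j ⬝ᵥ g) := by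
  have := (adjMatrix_isHermitian G).eigenvectorBasis.sum_inner_mul_inner
    (WithLp.toLp 2 f) (WithLp.toLp 2 g)
  simp only [EuclideanSpace.inner_eq_star_dotProduct, star_trivial] at this
  rw [dotProduct_comm f g, ← this]
  refine Finset.sum_congr rfl fun j _ => ?_
  rw [dotProduct_comm g]
  rfl

theorem adjMatrix_dotProduct_comm (f g : Fin n → ℝ) :
    f ⬝ᵥ (G.adjMatrix ℝ *ᵥ g) = (G.adjMatrix ℝ *ᵥ f) ⬝ᵥ g := by
  rw [dotProduct_mulVec, ← mulVec_transpose, (G.isSymm_adjMatrix).eq]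

theorem adjEigenvector_dotProduct_mulVec (j : Fin n) (f : Fin n → ℝ) :
    adjEigenvector G j ⬝ᵥ (G.adjMatrix ℝ *ᵥ f) =
      (adjMatrix_isHermitian G).eigenvalues j * (adjEigenvector G j ⬝ᵥ f) := by
  rw [adjMatrix_dotProduct_comm, adjMatrix_mulVec_adjEigenvector, smul_dotProduct, smul_eq_mul]

theorem adjMatrix_mulVec_one {d : ℕ} (hG : G.IsRegularOfDegree d) :
    G.adjMatrix ℝ *ᵥ (1 : Fin n → ℝ) = (d : ℝ) • (1 : Fin n → ℝ) := by
  ext v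
  rw [← hG.degree_eq v, ← SimpleGraph.card_neighborFinset_eq_degree,
    SimpleGraph.neighborFinset_eq_filter]
  simp [mulVec, dotProduct, SimpleGraph.adjMatrix_apply]

theorem adjEigenvector_dotProduct_one {d : ℕ} (hG : G.IsRegularOfDegree d) {j : Fin n}
    (hj : (adjMatrix_isHermitian G).eigenvalues j ≠ d) : adjEigenvector G j ⬝ᵥ 1 = 0 := by
  have := adjEigenvector_dotProduct_mulVec G j 1
  rw [adjMatrix_mulVec_one G hG, dotProduct_smul, smul_eq_mul] at this
  by_contra hne
  exact hj (mul_right_cancel₀ hne this).symm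

/-- As b < d, all eigenvectors but the exceptional one are orthogonal to the constants. The
exceptional one is thus parallel to the constants, and f has no component along it. -/
theorem SecondEigenvalueLE.dotProduct_mulVec_le {d : ℕ} (hG : G.IsRegularOfDegree d) {b : ℝ}
    (hb : b < d) (h : SecondEigenvalueLE G b) (f : Fin n → ℝ) (hf : f ⬝ᵥ 1 = 0) :
    f ⬝ᵥ (G.adjMatrix ℝ *ᵥ f) ≤ b * (f ⬝ᵥ f) := by
  obtain ⟨i, hi⟩ := h
  have ortho : ∀ j ≠ i, adjEigenvector G j ⬝ᵥ 1 = 0 := fun j hj =>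
    adjEigenvector_dotProduct_one G hG fun heq => by
      have := (le_abs_self _).trans (hi j hj)
      rw [heq] at this
      linarith
  have one_one := dotProduct_eq_sum_adjEigenvector G 1 1
  rw [Finset.sum_eq_single i (fun j _ hj => by rw [ortho j hj, zero_mul]) (by simp)] at one_one
  -- A vanishing product of the exceptional eigenvector with the constant vector would make the norm
  -- of the latter zero.
  have hci : adjEigenvector G i ⬝ᵥ f = 0 := by
    have f_one := dotProduct_eq_sum_adjEigenvector G f 1
    rw [Finset.sum_eq_single i (fun j _ hj => by rw [ortho j hj, mul_zero]) (by simp), hf] at f_one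
    refine (mul_eq_zero.mp f_one.symm).resolve_right fun h0 => ?_
    rw [h0, mul_zero] at one_one
    have : (n : ℝ) = 0 := by simpa [dotProduct] using one_one
    exact (Nat.cast_ne_zero.mpr (Fin.pos i).ne') this
  rw [dotProduct_eq_sum_adjEigenvector G, dotProduct_eq_sum_adjEigenvector G f f, Finset.mul_sum]
  refine Finset.sum_le_sum fun j _ => ?_
  rw [adjEigenvector_dotProduct_mulVec]
  by_cases hj : j = i
  · rw [hj, hci]; simp
  · have := (le_abs_self _).trans (hi j hj)
    nlinarith [mul_self_nonneg (adjEigenvector G j ⬝ᵥ f)]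

/-- An eigenvector with eigenvalue outside [-b, b] is not orthogonal to the constants, which forces
the eigenvalue d. Two of them would span a plane of eigenvectors for d, and this plane contains a
nonzero vector orthogonal to the constants. -/
theorem secondEigenvalueLE_of_abs_dotProduct_mulVec_le {d : ℕ} (hG : G.IsRegularOfDegree d)
    {b : ℝ} (hb : b < d) (hn : 0 < n)
    (h : ∀ f : Fin n → ℝ, f ⬝ᵥ 1 = 0 → |f ⬝ᵥ (G.adjMatrix ℝ *ᵥ f)| ≤ b * (f ⬝ᵥ f)) :
    SecondEigenvalueLE G b := by
  have large : ∀ j, b < |(adjMatrix_isHermitian G).eigenvalues j| →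
      (adjMatrix_isHermitian G).eigenvalues j = d := by
    intro j hj
    by_contra hne
    have := h _ (adjEigenvector_dotProduct_one G hG hne)
    rw [adjEigenvector_dotProduct_mulVec, dotProduct_adjEigenvector, if_pos rfl, mul_one,
      mul_one] at this
    linarith
  by_cases hex : ∃ i, b < |(adjMatrix_isHermitian G).eigenvalues i|
  swap
  · push Not at hex
    exact ⟨⟨0, hn⟩, fun j _ => hex j⟩
  obtain ⟨i, hi⟩ := hex
  refine ⟨i, fun j hj => ?_⟩
  by_contra! hcon
  set p := adjEigenvector G i ⬝ᵥ 1
  set q := adjEigenvector G j ⬝ᵥ 1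
  have eigen : ∀ x y : ℝ,
      G.adjMatrix ℝ *ᵥ (x • adjEigenvector G i + y • adjEigenvector G j) =
      (d : ℝ) • (x • adjEigenvector G i + y • adjEigenvector G j) := by
    intro x y
    rw [mulVec_add, mulVec_smul, mulVec_smul, adjMatrix_mulVec_adjEigenvector,
      adjMatrix_mulVec_adjEigenvector, large i hi, large j hcon, smul_add, smul_comm x,
      smul_comm y]
  have norm : ∀ x y : ℝ, (x • adjEigenvector G i + y • adjEigenvector G j) ⬝ᵥ
      (x • adjEigenvector G i + y • adjEigenvector G j) = x ^ 2 + y ^ 2 := by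
    intro x y
    simp only [add_dotProduct, dotProduct_add, smul_dotProduct, dotProduct_smul,
      dotProduct_adjEigenvector, smul_eq_mul, hj, hj.symm, if_false, if_true]
    ring
  have contra : ∀ x y : ℝ, x * p + y * q = 0 → x ^ 2 + y ^ 2 = 0 := by
    intro x y hxy
    have := (le_abs_self _).trans (h (x • adjEigenvector G i + y • adjEigenvector G j) (by
      simpa only [add_dotProduct, smul_dotProduct, smul_eq_mul] using hxy))
    rw [eigen, dotProduct_smul, norm, smul_eq_mul] at this
    nlinarith [sq_nonneg x, sq_nonneg y]
  -- This combination is orthogonal to the constants, so p = q = 0; but then the first eigenvector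
  -- is itself orthogonal to them.
  have h1 := contra q (-p) (by ring)
  have hp : p = 0 := by nlinarith [sq_nonneg p, sq_nonneg q]
  have h2 := contra 1 0 (by rw [hp]; ring)
  norm_num at h2

/-- With c = -1 and c = 1 this is the quadratic form of d - A and of d + A. The sum runs over
ordered pairs, hence the factor 2. -/
theorem sum_sum_sq_sub_eq {d : ℕ} (hG : G.IsRegularOfDegree d) (f : Fin n → ℝ) (c : ℝ)
    (hc : c ^ 2 = 1) :
    ∑ v, ∑ w, (if G.Adj v w then (f v + c * f w) ^ 2 else 0) =
      2 * (d * (f ⬝ᵥ f) + c * (f ⬝ᵥ (G.adjMatrix ℝ *ᵥ f))) := by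
  have row : ∀ v, ∑ w, (if G.Adj v w then (1 : ℝ) else 0) = d := fun v => by
    rw [← hG.degree_eq v, Finset.sum_boole, ← SimpleGraph.card_neighborFinset_eq_degree,
      SimpleGraph.neighborFinset_eq_filter]
  have col : ∀ w, ∑ v, (if G.Adj v w then (1 : ℝ) else 0) = d := fun w => by
    rw [← row w]
    exact Finset.sum_congr rfl fun v _ => by simp only [G.adj_comm]
  have expand : ∀ v w, (if G.Adj v w then (f v + c * f w) ^ 2 else 0) =
      (if G.Adj v w then (1 : ℝ) else 0) * (f v * f v) +
        (if G.Adj v w then (1 : ℝ) else 0) * (f w * f w) +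
        2 * c * (f v * ((if G.Adj v w then (1 : ℝ) else 0) * f w)) := by
    intro v w
    split_ifs
    · linear_combination f w ^ 2 * hc
    · ring
  have term1 : ∑ v, ∑ w, (if G.Adj v w then (1 : ℝ) else 0) * (f v * f v) = d * (f ⬝ᵥ f) := by
    simp_rw [← Finset.sum_mul, row, ← Finset.mul_sum]
    rfl
  have term2 : ∑ v, ∑ w, (if G.Adj v w then (1 : ℝ) else 0) * (f w * f w) = d * (f ⬝ᵥ f) := by
    rw [Finset.sum_comm]
    simp_rw [← Finset.sum_mul, col, ← Finset.mul_sum]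
    rfl
  have term3 : ∑ v, ∑ w, 2 * c * (f v * ((if G.Adj v w then (1 : ℝ) else 0) * f w)) =
      2 * c * (f ⬝ᵥ (G.adjMatrix ℝ *ᵥ f)) := by
    simp_rw [← Finset.mul_sum]
    rfl
  simp_rw [expand, Finset.sum_add_distrib]
  rw [term1, term2, term3]
  ring

/-- The pairs of adjacent vertices that leave `Y`. -/
def crossingPairs (Y : Finset (Fin n)) : Finset (Fin n × Fin n) :=
  {p | p.1 ∈ Y ∧ p.2 ∉ Y ∧ G.Adj p.1 p.2}

/-- The easy direction of Cheeger's inequality: the quadratic form of d - A is evaluated at the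
indicator of Y minus its mean. Each edge that leaves Y contributes 1, and the others contribute 0.
-/
theorem SecondEigenvalueLE.card_crossingPairs_ge {d : ℕ} (hG : G.IsRegularOfDegree d) {b : ℝ}
    (hb : b < d) (h : SecondEigenvalueLE G b) (Y : Finset (Fin n)) :
    (d - b) * (#Y * (n - #Y)) ≤ n * #(crossingPairs G Y) := by
  rcases Nat.eq_zero_or_pos n with hn | hn
  · subst hn
    have hY : Y = ∅ := Finset.eq_empty_of_isEmpty Y
    simp [hY]
  set μ : ℝ := #Y / n with hμ
  have hn' : (0 : ℝ) < n := by exact_mod_cast hn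
  set f : Fin n → ℝ := fun v => (if v ∈ Y then 1 else 0) - μ with hf
  have sum_ind : ∑ v : Fin n, (if v ∈ Y then (1 : ℝ) else 0) = #Y := by simp
  have f_one : f ⬝ᵥ 1 = 0 := by
    simp only [dotProduct, hf, Pi.one_apply, mul_one, Finset.sum_sub_distrib, sum_ind]
    simp only [Finset.sum_const, Finset.card_univ, Fintype.card_fin, nsmul_eq_mul, hμ]
    field_simp
    ring
  have f_f : f ⬝ᵥ f = #Y * (n - #Y) / n := by
    have : ∀ v, f v * f v = (1 - 2 * μ) * (if v ∈ Y then (1 : ℝ) else 0) + μ ^ 2 := by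
      intro v
      simp only [hf]
      split_ifs <;> ring
    simp only [dotProduct, this, Finset.sum_add_distrib, ← Finset.mul_sum, sum_ind]
    simp only [Finset.sum_const, Finset.card_univ, Fintype.card_fin, nsmul_eq_mul, hμ]
    field_simp
    ring
  have cross : ∑ v, ∑ w, (if G.Adj v w then (f v + (-1) * f w) ^ 2 else 0) =
      (2 : ℝ) * #(crossingPairs G Y) := by
    have split : ∀ v w, (if G.Adj v w then (f v + (-1) * f w) ^ 2 else 0) =
        (if v ∈ Y ∧ w ∉ Y ∧ G.Adj v w then (1 : ℝ) else 0) +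
        (if w ∈ Y ∧ v ∉ Y ∧ G.Adj w v then (1 : ℝ) else 0) := by
      intro v w
      simp only [hf, G.adj_comm w v]
      by_cases h1 : v ∈ Y <;> by_cases h2 : w ∈ Y <;> by_cases h3 : G.Adj v w <;>
        simp only [h1, h2, h3, if_true, if_false, not_true, not_false_eq_true, and_true,
          and_false] <;> ring
    have count : ∑ v, ∑ w, (if v ∈ Y ∧ w ∉ Y ∧ G.Adj v w then (1 : ℝ) else 0) =
        #(crossingPairs G Y) := by
      rw [← Fintype.sum_prod_type' (fun v w => if v ∈ Y ∧ w ∉ Y ∧ G.Adj v w then (1 : ℝ) else 0),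
        Finset.sum_boole]
      rfl
    simp_rw [split, Finset.sum_add_distrib]
    rw [Finset.sum_comm (f := fun v w => if w ∈ Y ∧ v ∉ Y ∧ G.Adj w v then (1 : ℝ) else 0), count]
    ring
  rw [sum_sum_sq_sub_eq G hG f (-1) (by norm_num)] at cross
  have quad := SecondEigenvalueLE.dotProduct_mulVec_le G hG hb h f f_one
  have main : (d - b) * (#Y * (n - #Y) / n) ≤ (#(crossingPairs G Y) : ℝ) := by
    rw [← f_f]
    linarith
  calc (d - b) * (#Y * (n - #Y)) = n * ((d - b) * (#Y * (n - #Y) / n)) := by field_simp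
    _ ≤ n * #(crossingPairs G Y) := mul_le_mul_of_nonneg_left main hn'.le

end Spectral

/-! ### Large induced matchings among the crossing edges -/

section MatchingExistence

/-- In a conflict-free subset of maximal size every element of `X` conflicts with a chosen one, and
each chosen element accounts for at most `K` elements. -/
theorem exists_independent_subset {α : Type*} [DecidableEq α] (X : Finset α) (r : α → α → Prop)
    [DecidableRel r] (hrefl : ∀ p ∈ X, r p p) (hsymm : ∀ p q, r p q → r q p) {K : ℕ}
    (hK : ∀ p ∈ X, #{q ∈ X | r p q} ≤ K) :
    ∃ M ⊆ X, (∀ p ∈ M, ∀ q ∈ M, r p q → p = q) ∧ #X ≤ #M * K := by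
  obtain ⟨M, hM, hmax⟩ := Finset.exists_max_image
    {M ∈ X.powerset | ∀ p ∈ M, ∀ q ∈ M, r p q → p = q} Finset.card ⟨∅, by simp⟩
  simp only [Finset.mem_filter, Finset.mem_powerset] at hM hmax
  refine ⟨M, hM.1, hM.2, ?_⟩
  have cover : X ⊆ M.biUnion fun p => {q ∈ X | r p q} := by
    intro q hq
    simp only [Finset.mem_biUnion, Finset.mem_filter]
    by_contra! hcon
    have hqM : q ∉ M := fun h => hcon q h hq (hrefl q hq)
    have := hmax (insert q M) ⟨Finset.insert_subset hq hM.1, fun p hp p' hp' hr => by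
      rw [Finset.mem_insert] at hp hp'
      rcases hp with rfl | hp <;> rcases hp' with rfl | hp'
      · rfl
      · exact absurd (hsymm _ _ hr) (hcon _ hp' hq)
      · exact absurd hr (hcon _ hp hq)
      · exact hM.2 _ hp _ hp' hr⟩
    rw [Finset.card_insert_of_notMem hqM] at this
    omega
  exact (Finset.card_le_card cover).trans
    (Finset.card_biUnion_le_card_mul _ _ _ fun p hp => hK p (hM.1 hp))

variable {n : ℕ} (G : SimpleGraph (Fin n)) [DecidableRel G.Adj]

theorem exists_isCrossingMatching {d : ℕ} (hG : G.IsRegularOfDegree d) (Y : Finset (Fin n)) :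
    ∃ (k : ℕ) (y z : Fin k → Fin n), IsCrossingMatching G Y y z ∧
      #(crossingPairs G Y) ≤ k * (4 * (d + 1) * d) := by
  classical
  let r : Fin n × Fin n → Fin n × Fin n → Prop := fun p q =>
    ∃ u v, (u = p.1 ∨ u = p.2) ∧ (v = q.1 ∨ v = q.2) ∧ (u = v ∨ G.Adj u v)
  obtain ⟨M, hMX, hM, hcard⟩ := exists_independent_subset (crossingPairs G Y) r
    (fun p _ => ⟨p.1, p.1, Or.inl rfl, Or.inl rfl, Or.inl rfl⟩)
    (fun p q ⟨u, v, hu, hv, huv⟩ => ⟨v, u, hv, hu, huv.imp Eq.symm SimpleGraph.Adj.symm⟩)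
    -- A conflicting pair has an endpoint in one of two closed neighbourhoods, 2 (d + 1) vertices in
    -- all; there are d choices for its other endpoint and two orientations.
    (K := 4 * (d + 1) * d) (fun p _ => by
      have ball : ∀ u, #(insert u (G.neighborFinset u)) ≤ d + 1 := fun u => by
        refine (Finset.card_insert_le _ _).trans ?_
        rw [SimpleGraph.card_neighborFinset_eq_degree, hG.degree_eq]
      set N : Finset (Fin n) := insert p.1 (G.neighborFinset p.1) ∪
        insert p.2 (G.neighborFinset p.2)
      have hN : #N ≤ 2 * (d + 1) := by
        refine (Finset.card_union_le _ _).trans ?_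
        have h1 := ball p.1
        have h2 := ball p.2
        omega
      have sub : {q ∈ crossingPairs G Y | r p q} ⊆
          N.biUnion (fun v => (G.neighborFinset v).image fun w => (v, w)) ∪
            N.biUnion (fun v => (G.neighborFinset v).image fun w => (w, v)) := by
        rintro ⟨q₁, q₂⟩ hq
        simp only [crossingPairs, Finset.mem_filter, Finset.mem_univ, true_and] at hq
        obtain ⟨⟨-, -, hadj⟩, u, v, hu, hv, huv⟩ := hq
        have hvN : v ∈ N := by
          simp only [N, Finset.mem_union, Finset.mem_insert, SimpleGraph.mem_neighborFinset]
          rcases hu with rfl | rfl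
          · exact Or.inl (huv.imp Eq.symm id)
          · exact Or.inr (huv.imp Eq.symm id)
        rw [Finset.mem_union, Finset.mem_biUnion, Finset.mem_biUnion]
        rcases hv with rfl | rfl
        · exact Or.inl ⟨_, hvN, by simpa using hadj⟩
        · exact Or.inr ⟨_, hvN, by simpa using hadj.symm⟩
      have one : ∀ f : Fin n → Fin n → Fin n × Fin n,
          #(N.biUnion fun v => (G.neighborFinset v).image (f v)) ≤ 2 * (d + 1) * d := fun f => by
        refine (Finset.card_biUnion_le_card_mul _ _ d fun v _ => ?_).trans
          (Nat.mul_le_mul_right _ hN)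
        refine Finset.card_image_le.trans ?_
        rw [SimpleGraph.card_neighborFinset_eq_degree, hG.degree_eq]
      refine (Finset.card_le_card sub).trans ((Finset.card_union_le _ _).trans ?_)
      have h1 := one fun v w => (v, w)
      have h2 := one fun v w => (w, v)
      calc _ ≤ 2 * (d + 1) * d + 2 * (d + 1) * d := Nat.add_le_add h1 h2
        _ = _ := by ring)
  have mem : ∀ i : Fin #M, (M.equivFin.symm i).1 ∈ crossingPairs G Y := fun i =>
    hMX (M.equivFin.symm i).2
  simp only [crossingPairs, Finset.mem_filter, Finset.mem_univ, true_and] at mem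
  refine ⟨#M, fun i => (M.equivFin.symm i).1.1, fun i => (M.equivFin.symm i).1.2,
    ⟨fun i => (mem i).1, fun i => (mem i).2.1, fun i => (mem i).2.2,
      fun i j u v hu hv huv => ?_⟩, hcard⟩
  exact M.equivFin.symm.injective (Subtype.ext
    (hM _ (M.equivFin.symm i).2 _ (M.equivFin.symm j).2 ⟨u, v, hu, hv, huv⟩))

end MatchingExistence

/-! ### The exponential lower bound -/

section LowerBound

theorem eval_one_eq_sum_of_isMultilinearPoly {σ : Type} [Fintype σ] {r : MvPolynomial σ ℝ}
    (hr : IsMultilinearPoly r) :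
    MvPolynomial.eval (fun _ => 1) r = ∑ S : Finset σ, r.coeff (multilinearExponent S) := by
  classical
  rw [MvPolynomial.eval_eq,
    ← Finset.sum_image (f := fun e => r.coeff e) (g := multilinearExponent)
      multilinearExponent_injective.injOn]
  simp only [one_pow, Finset.prod_const_one, mul_one]
  refine Finset.sum_subset (fun e he => ?_) fun e _ he => by simpa using he
  rw [Finset.mem_image]
  exact ⟨e.support, Finset.mem_univ _,
    (eq_multilinearExponent_support (hr e (MvPolynomial.mem_support_iff.mp he))).symm⟩

/-- With variables separated by `Y`, an exponent vector splits in only one way, so the coefficient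
matrix of `p * q` has rank one. -/
theorem coeff_mul_of_vars_subset {σ : Type} [DecidableEq σ] {p q : MvPolynomial σ ℝ}
    {Y : Finset σ} (hp : p.vars ⊆ Y) (hq : Disjoint q.vars Y) (S : Finset σ) :
    (p * q).coeff (multilinearExponent S) =
      p.coeff (multilinearExponent (S ∩ Y)) * q.coeff (multilinearExponent (S \ Y)) := by
  rw [MvPolynomial.coeff_mul,
    Finset.sum_eq_single (multilinearExponent (S ∩ Y), multilinearExponent (S \ Y))]
  · rintro ⟨e, f⟩ hef hne
    by_contra hprod
    rw [Finset.HasAntidiagonal.mem_antidiagonal] at hef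
    obtain ⟨he, hf⟩ := mul_ne_zero_iff.mp hprod
    have he0 : ∀ i ∉ Y, e i = 0 := fun i hi => by
      by_contra h
      exact hi (hp ((MvPolynomial.mem_vars_iff_mem_support i).mpr
        ⟨e, MvPolynomial.mem_support_iff.mpr he, Finsupp.mem_support_iff.mpr h⟩))
    have hf0 : ∀ i ∈ Y, f i = 0 := fun i hi => by
      by_contra h
      exact (Finset.disjoint_left.mp hq) ((MvPolynomial.mem_vars_iff_mem_support i).mpr
        ⟨f, MvPolynomial.mem_support_iff.mpr hf, Finsupp.mem_support_iff.mpr h⟩) hi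
    refine hne (Prod.ext ?_ ?_) <;>
    · ext i
      have := DFunLike.congr_fun hef i
      simp only [Finsupp.add_apply, multilinearExponent_apply, Finset.mem_inter,
        Finset.mem_sdiff] at this ⊢
      by_cases hi : i ∈ Y
      · have := hf0 i hi
        simp_all
      · have := he0 i hi
        simp_all
  · intro h
    refine absurd (Finset.HasAntidiagonal.mem_antidiagonal.mpr ?_) h
    rw [← multilinearExponent_union, Finset.union_comm, Finset.sdiff_union_inter]
    exact (Finset.disjoint_sdiff_inter S Y).symm

theorem exists_balanced_superset {σ : Type} [Fintype σ] [DecidableEq σ] {A B : Finset σ}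
    (hAB : Disjoint A B) (hσ : 2 ≤ Fintype.card σ) (hA : 3 * #A ≤ 2 * Fintype.card σ)
    (hB : 3 * #B ≤ 2 * Fintype.card σ) :
    ∃ Y, A ⊆ Y ∧ Disjoint B Y ∧ Fintype.card σ ≤ 3 * #Y ∧ 3 * #Y ≤ 2 * Fintype.card σ := by
  have hABc : A ⊆ Bᶜ := fun i hi => by
    rw [Finset.mem_compl]
    exact Finset.disjoint_left.mp hAB hi
  have hcard := Finset.card_le_card hABc
  rw [Finset.card_compl] at hcard
  -- The size aimed at is half of the variables, lowered to fit into the complement of `B` and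
  -- raised to contain `A`. At least two variables are needed for the rounded half to be at least a
  -- third.
  obtain ⟨Y, hAY, hYB, hY⟩ := Finset.exists_subsuperset_card_eq hABc
    (n := max #A (min (Fintype.card σ / 2) (Fintype.card σ - #B))) (le_max_left _ _)
    (by rw [Finset.card_compl]; omega)
  refine ⟨Y, hAY, ?_, ?_, ?_⟩
  · rw [Finset.disjoint_left]
    exact fun i hi hiY => Finset.mem_compl.mp (hYB hiY) hi
  · have := Finset.card_le_univ B
    omega
  · omega

variable {n : ℕ} (G : SimpleGraph (Fin n)) [DecidableRel G.Adj]

theorem isMultilinearPoly_hardPoly : IsMultilinearPoly (hardPoly G) := fun _ he =>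
  apply_le_one_of_coeff_hardPoly_ne_zero G he

theorem eval_one_hardPoly_pos : 0 < MvPolynomial.eval (fun _ => 1) (hardPoly G) := by
  rw [eval_one_hardPoly]
  exact Finset.sum_pos (fun S _ => hardWeight_pos G S) ⟨∅, Finset.mem_univ _⟩

/-- The fraction of a `2 × 2` matrix of coefficients that a rank one minorant can attain. -/
noncomputable def gapRatio (d : ℕ) : ℝ := 1 - 1 / (4 * 16 ^ d) / 20

theorem gapRatio_pos (d : ℕ) : 0 < gapRatio d := by
  have h1 : (1 : ℝ) ≤ 16 ^ d := one_le_pow₀ (by norm_num)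
  have h2 : (1 : ℝ) / (4 * 16 ^ d) ≤ 1 := by
    rw [div_le_one (by positivity)]; linarith
  unfold gapRatio
  linarith

theorem gapRatio_lt_one (d : ℕ) : gapRatio d < 1 := by
  have : (0 : ℝ) < 1 / (4 * 16 ^ d) / 20 := by positivity
  unfold gapRatio
  linarith

/-- The three ingredients meet here: a balanced `Y` separating the variables of `p` and `q`, a
linear number of edges leaving it, and the loss on an induced matching of these edges. -/
theorem eval_one_mul_le {d : ℕ} (hd : 0 < d) (hn : 2 ≤ n) (hG : G.IsRegularOfDegree d) {b : ℝ}
    (hb : b < d) (h : SecondEigenvalueLE G b) (p q : MvPolynomial (Fin n) ℝ)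
    (hp : NonnegCoeffs p) (hq : NonnegCoeffs q) (hle : NonnegCoeffs (hardPoly G - p * q))
    (hpq : Disjoint p.vars q.vars) (hcp : 3 * #p.vars ≤ 2 * Fintype.card (Fin n))
    (hcq : 3 * #q.vars ≤ 2 * Fintype.card (Fin n)) :
    MvPolynomial.eval (fun _ => 1) (p * q) ≤
      gapRatio d ^ ((d - b) / (36 * (d + 1) * d) * n) *
        MvPolynomial.eval (fun _ => 1) (hardPoly G) := by
  obtain ⟨Y, hpY, hqY, hY1, hY2⟩ := exists_balanced_superset hpq (by simpa using hn) hcp hcq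
  rw [Fintype.card_fin] at hY1 hY2
  obtain ⟨k, y, z, hyz, hk⟩ := exists_isCrossingMatching G hG Y
  have coeff_le : ∀ e, (p * q).coeff e ≤ (hardPoly G).coeff e := fun e => by
    have := hle e
    rw [MvPolynomial.coeff_sub] at this
    linarith
  have hmult : IsMultilinearPoly (p * q) := fun e he =>
    isMultilinearPoly_hardPoly G e
      ((((hp.mul hq) e).lt_of_ne' he).trans_le (coeff_le e)).ne'
  have main := sum_mul_le_of_crossingMatching hG hyz (fun S => p.coeff (multilinearExponent S))
    (fun S => q.coeff (multilinearExponent S)) (fun S => hp _) (fun S => hq _) (fun S => by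
      rw [← coeff_mul_of_vars_subset hpY hqY, ← coeff_hardPoly_multilinearExponent]
      exact coeff_le _)
  simp_rw [← coeff_mul_of_vars_subset hpY hqY] at main
  rw [← eval_one_eq_sum_of_isMultilinearPoly hmult, ← eval_one_hardPoly] at main
  refine main.trans (mul_le_mul_of_nonneg_right ?_ (eval_one_hardPoly_pos G).le)
  change gapRatio d ^ k ≤ _
  rw [← Real.rpow_natCast]
  refine Real.rpow_le_rpow_of_exponent_ge (gapRatio_pos d) (gapRatio_lt_one d).le ?_
  have hcross := SecondEigenvalueLE.card_crossingPairs_ge G hG hb h Y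
  have hY1' : (n : ℝ) ≤ 3 * #Y := by exact_mod_cast hY1
  have hY2' : (3 : ℝ) * #Y ≤ 2 * n := by exact_mod_cast hY2
  have hk' : (#(crossingPairs G Y) : ℝ) ≤ k * (4 * (d + 1) * d) := by exact_mod_cast hk
  have hn' : (0 : ℝ) < n := by exact_mod_cast (by omega : 0 < n)
  have hd' : (0 : ℝ) < d := by exact_mod_cast hd
  -- Both parts have at least n/3 vertices. The 36 in the exponent is this 9 times the 4 of the
  -- conflict count.
  have prod_ge : (n : ℝ) * n / 9 ≤ #Y * (n - #Y) := by nlinarith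
  have h1 : (d - b) * ((n : ℝ) * n / 9) ≤ n * (k * (4 * (d + 1) * d)) :=
    (mul_le_mul_of_nonneg_left prod_ge (by linarith)).trans
      (hcross.trans (mul_le_mul_of_nonneg_left hk' hn'.le))
  have h2 : (d - b) * ((n : ℝ) / 9) ≤ k * (4 * (d + 1) * d) := by
    refine le_of_mul_le_mul_left ?_ hn'
    linarith
  rw [div_mul_eq_mul_div, div_le_iff₀ (by positivity)]
  linarith

theorem one_le_two_mul_size_mul {d : ℕ} (hd : 0 < d) (hn : 2 ≤ n) (hG : G.IsRegularOfDegree d)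
    {b : ℝ} (hb : b < d) (h : SecondEigenvalueLE G b) (C : Circuit (Fin n)) (hC : C.IsMonotone)
    (hCP : C.Computes (hardPoly G)) :
    1 ≤ 2 * C.size * gapRatio d ^ ((d - b) / (36 * (d + 1) * d) * n) := by
  have hpos := eval_one_hardPoly_pos G
  have := eval_one_le_size_mul (isMultilinearPoly_hardPoly G) (by simpa using hn)
    (Real.rpow_nonneg (gapRatio_pos d).le _) hpos.le (eval_one_mul_le G hd hn hG hb h) C hC hCP
  rw [← mul_assoc] at this
  exact le_of_mul_le_mul_right (by rwa [one_mul]) hpos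

theorem IsExpanderSeq.exists_exponential_lower_bound {d : ℕ} {G : ∀ n : ℕ, SimpleGraph (Fin n)}
    [∀ n, DecidableRel (G n).Adj] (hG : IsExpanderSeq d G) :
    ∃ c : ℝ, 0 < c ∧ ∃ n₀ : ℕ, ∀ n, n₀ ≤ n → ∀ C : Circuit (Fin n), C.IsMonotone →
      C.Computes (hardPoly (G n)) → (2 : ℝ) ^ (c * n) ≤ C.size := by
  obtain ⟨hd, ε, hε, hexp⟩ := hG
  have hd' : (0 : ℝ) < d := by exact_mod_cast hd
  have hb : (1 - ε) * d < d := by nlinarith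
  set γ : ℝ := (d - (1 - ε) * d) / (36 * (d + 1) * d)
  have hγ : 0 < γ := div_pos (by linarith) (by positivity)
  -- Halving the exponent turns the power of `gapRatio` into 2^(-2cn). One of the two factors 2^(cn)
  -- absorbs the constant 2 in front of the size as soon as cn ≥ 1.
  set c : ℝ := γ * -Real.logb 2 (gapRatio d) / 2 with hc_def
  have hlog : Real.logb 2 (gapRatio d) < 0 :=
    Real.logb_neg (by norm_num) (gapRatio_pos d) (gapRatio_lt_one d)
  have hc : 0 < c := by
    have := mul_pos hγ (neg_pos.mpr hlog)
    rw [hc_def]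
    linarith
  refine ⟨c, hc, max (max 2 (d + 1)) ⌈1 / c⌉₊, fun n hn C hC hCP => ?_⟩
  have hn2 : 2 ≤ n := (le_max_left _ _).trans ((le_max_left _ _).trans hn)
  have hnd : d < n := (le_max_right 2 (d + 1)).trans ((le_max_left _ _).trans hn)
  have hcn : 1 ≤ c * n := by
    have h1 : 1 / c ≤ n := (Nat.le_ceil _).trans (by exact_mod_cast (le_max_right _ _).trans hn)
    rw [div_le_iff₀ hc] at h1
    linarith
  obtain ⟨hreg, heig⟩ := hexp n hnd
  have key := one_le_two_mul_size_mul (G n) hd hn2 hreg hb heig C hC hCP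
  have hpow : gapRatio d ^ (γ * n) = (2 : ℝ) ^ (-(c * n) + -(c * n)) := by
    conv_lhs => rw [← Real.rpow_logb (b := 2) (by norm_num) (by norm_num) (gapRatio_pos d)]
    rw [← Real.rpow_mul (by norm_num)]
    congr 1
    rw [hc_def]
    ring
  rw [hpow, Real.rpow_add (by norm_num), Real.rpow_neg (by norm_num)] at key
  have h2 : (2 : ℝ) ≤ 2 ^ (c * n) := by
    calc (2 : ℝ) = 2 ^ (1 : ℝ) := (Real.rpow_one 2).symm
      _ ≤ 2 ^ (c * n) := Real.rpow_le_rpow_of_exponent_le (by norm_num) hcn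
  set x : ℝ := 2 ^ (c * n)
  have hx : 0 < x := by linarith
  have h3 : x * x ≤ 2 * C.size := by
    have := mul_le_mul_of_nonneg_right key (mul_pos hx hx).le
    calc x * x = 1 * (x * x) := (one_mul _).symm
      _ ≤ _ := this
      _ = 2 * C.size := by field_simp
  nlinarith

theorem not_inMVP_of_exponential_lower_bound {P : ∀ n : ℕ, MvPolynomial (Fin n) ℝ} {c : ℝ}
    (hc : 0 < c) {n₀ : ℕ} (h : ∀ n, n₀ ≤ n → ∀ C : Circuit (Fin n), C.IsMonotone →
      C.Computes (P n) → (2 : ℝ) ^ (c * n) ≤ C.size) : ¬ InMVP P := by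
  rintro ⟨-, s, ⟨k, hk⟩, hs⟩
  have hbase : (1 : ℝ) < 2 ^ c := Real.one_lt_rpow (by norm_num) hc
  have hlim := tendsto_pow_const_div_const_pow_of_one_lt k hbase
  have hev := hlim.eventually (gt_mem_nhds (show (0 : ℝ) < 1 / (k + 1) by positivity))
  obtain ⟨n, hn, hn0, hn1⟩ := (hev.and ((Filter.eventually_ge_atTop n₀).and
    (Filter.eventually_ge_atTop 1))).exists
  obtain ⟨C, hC, hCP, hCs⟩ := hs n hn1
  have h1 := h n hn0 C hC hCP
  rw [Real.rpow_mul (by norm_num), Real.rpow_natCast] at h1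
  have h2 : (C.size : ℝ) ≤ n ^ k + k := by exact_mod_cast hCs.trans (hk n hn1)
  have h3 : (1 : ℝ) ≤ (n : ℝ) ^ k := one_le_pow₀ (by exact_mod_cast hn1)
  rw [div_lt_div_iff₀ (by positivity) (by positivity)] at hn
  have hk0 : (0 : ℝ) ≤ k := Nat.cast_nonneg k
  nlinarith

end LowerBound

/-! ### The Gabber–Galil inequality by Fourier analysis -/

section GabberGalil

variable {m : ℕ} [NeZero m]

/-- The distance of a residue from `0`. -/
def zmodAbs (t : ZMod m) : ℕ := t.valMinAbs.natAbs

theorem two_mul_zmodAbs_le (t : ZMod m) : 2 * zmodAbs t ≤ m := by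
  have := ZMod.natAbs_valMinAbs_le t
  unfold zmodAbs
  omega

theorem zmodAbs_intCast {x : ℤ} (hx : |x| < m) :
    (zmodAbs (x : ZMod m) : ℤ) = min |x| (m - |x|) := by
  set v := (x : ZMod m).valMinAbs with hv
  have hmem := ZMod.valMinAbs_mem_Ioc (x : ZMod m)
  rw [← hv, Set.mem_Ioc] at hmem
  obtain ⟨t, ht⟩ : (m : ℤ) ∣ v - x := by
    rw [← ZMod.intCast_eq_intCast_iff_dvd_sub, hv, ZMod.coe_valMinAbs]
  rw [abs_lt] at hx
  -- Reduction modulo m moves x by at most one period, so only t = -1, 0, 1 are left.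
  have ht2 : t < 2 := by by_contra! h; nlinarith
  have ht2' : -2 < t := by by_contra! h; nlinarith
  have habs : (zmodAbs (x : ZMod m) : ℤ) = |v| := by
    unfold zmodAbs
    rw [Int.natCast_natAbs]
  rw [habs]
  interval_cases t <;> simp only [mul_zero, mul_one, mul_neg] at ht <;>
    rcases abs_cases x with ⟨h1, _⟩ | ⟨h1, _⟩ <;> rcases abs_cases v with ⟨h2, _⟩ | ⟨h2, _⟩ <;>
    rw [h1, h2] <;> omega

/-- The weights of Jimbo and Maruoka. -/
noncomputable def ggWeight (a b : ℕ) : ℝ := if b < a then 5 / 4 else if a < b then 4 / 5 else 1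

theorem ggWeight_pos (a b : ℕ) : 0 < ggWeight a b := by
  unfold ggWeight; split_ifs <;> norm_num

theorem ggWeight_le (a b : ℕ) : ggWeight a b ≤ 5 / 4 := by
  unfold ggWeight; split_ifs <;> norm_num

theorem ggWeight_of_lt {a b : ℕ} (h : a < b) : ggWeight a b = 4 / 5 := by
  unfold ggWeight; rw [if_neg (by omega), if_pos h]

theorem ggWeight_self (a : ℕ) : ggWeight a a = 1 := by simp [ggWeight]

theorem ggWeight_mul_swap (a b : ℕ) : ggWeight a b * ggWeight b a = 1 := by
  unfold ggWeight; split_ifs <;> first | omega | norm_num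

theorem two_mul_le_ggWeight (a b : ℕ) (x y : ℝ) :
    2 * (x * y) ≤ ggWeight a b * x ^ 2 + ggWeight b a * y ^ 2 := by
  have h := ggWeight_mul_swap a b
  have hp := ggWeight_pos a b
  refine le_of_mul_le_mul_left ?_ hp
  have : ggWeight a b * (ggWeight a b * x ^ 2 + ggWeight b a * y ^ 2) =
      (ggWeight a b * x) ^ 2 + y ^ 2 := by linear_combination y ^ 2 * h
  rw [this]
  nlinarith [sq_nonneg (ggWeight a b * x - y)]

theorem ggWeight_sum_le {A B M c₁ c₂ c₃ c₄ : ℕ} (hAB : A ≠ 0 ∨ B ≠ 0) (hM : 2 * (A + B) < M)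
    (h₁ : (c₁ : ℤ) = min ((B : ℤ) + 2 * A) (M - (B + 2 * A)))
    (h₂ : (c₂ : ℤ) = min |(B : ℤ) - 2 * A| (M - |(B : ℤ) - 2 * A|))
    (h₃ : (c₃ : ℤ) = min ((A : ℤ) + 2 * B) (M - (A + 2 * B)))
    (h₄ : (c₄ : ℤ) = min |(A : ℤ) - 2 * B| (M - |(A : ℤ) - 2 * B|)) :
    ggWeight B c₁ + ggWeight B c₂ + ggWeight A c₃ + ggWeight A c₄ ≤ 73 / 20 := by
  rcases Nat.eq_zero_or_pos A with hA | hA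
  · have e1 : c₁ = B := by omega
    have e2 : c₂ = B := by subst hA; simp at h₂; omega
    rw [e1, e2, ggWeight_self, ggWeight_of_lt (show A < c₃ by omega),
      ggWeight_of_lt (show A < c₄ by
        rcases abs_cases ((A : ℤ) - 2 * B) with ⟨h, _⟩ | ⟨h, _⟩ <;> rw [h] at h₄ <;> omega)]
    norm_num
  rcases Nat.eq_zero_or_pos B with hB | hB
  · have e1 : c₃ = A := by omega
    have e2 : c₄ = A := by subst hB; simp at h₄; omega
    rw [e1, e2, ggWeight_self, ggWeight_of_lt (show B < c₁ by omega),
      ggWeight_of_lt (show B < c₂ by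
        rcases abs_cases ((B : ℤ) - 2 * A) with ⟨h, _⟩ | ⟨h, _⟩ <;> rw [h] at h₂ <;> omega)]
    norm_num
  have l1 : B < c₁ := by omega
  have l3 : A < c₃ := by omega
  rw [ggWeight_of_lt l1, ggWeight_of_lt l3]
  rcases lt_trichotomy A B with hlt | heq | hlt
  · have l4 : A < c₄ := by
      rcases abs_cases ((A : ℤ) - 2 * B) with ⟨h, _⟩ | ⟨h, _⟩ <;> rw [h] at h₄ <;> omega
    rw [ggWeight_of_lt l4]
    linarith [ggWeight_le B c₂]
  · have e2 : c₂ = B := by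
      rcases abs_cases ((B : ℤ) - 2 * A) with ⟨h, _⟩ | ⟨h, _⟩ <;> rw [h] at h₂ <;> omega
    have e4 : c₄ = A := by
      rcases abs_cases ((A : ℤ) - 2 * B) with ⟨h, _⟩ | ⟨h, _⟩ <;> rw [h] at h₄ <;> omega
    rw [e2, e4, ggWeight_self, ggWeight_self]
    norm_num
  · have l2 : B < c₂ := by
      rcases abs_cases ((B : ℤ) - 2 * A) with ⟨h, _⟩ | ⟨h, _⟩ <;> rw [h] at h₂ <;> omega
    rw [ggWeight_of_lt l2]
    linarith [ggWeight_le A c₄]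

/-- A change of sign of a or b at most exchanges the two sheared distances. Their weights therefore
depend only on the absolute values, as `ggWeight_sum_le` requires. -/
theorem ggWeight_add_le (C : ℕ) (a b : ZMod m) (h : 2 * (zmodAbs a + zmodAbs b) < m) :
    ∃ c₁ c₂ : ℕ, (c₁ : ℤ) = min ((zmodAbs b : ℤ) + 2 * zmodAbs a)
        (m - (zmodAbs b + 2 * zmodAbs a)) ∧
      (c₂ : ℤ) = min |(zmodAbs b : ℤ) - 2 * zmodAbs a| (m - |(zmodAbs b : ℤ) - 2 * zmodAbs a|) ∧
      ggWeight C (zmodAbs (b + 2 * a)) + ggWeight C (zmodAbs (b - 2 * a)) =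
        ggWeight C c₁ + ggWeight C c₂ := by
  set x := a.valMinAbs with hx
  set y := b.valMinAbs with hy
  have hxa : (zmodAbs a : ℤ) = |x| := by unfold zmodAbs; rw [Int.natCast_natAbs]
  have hyb : (zmodAbs b : ℤ) = |y| := by unfold zmodAbs; rw [Int.natCast_natAbs]
  have hm : 2 * (|x| + |y|) < m := by rw [← hxa, ← hyb]; exact_mod_cast h
  have hplus : b + 2 * a = ((y + 2 * x : ℤ) : ZMod m) := by
    push_cast; rw [hx, hy, ZMod.coe_valMinAbs, ZMod.coe_valMinAbs]
  have hminus : b - 2 * a = ((y - 2 * x : ℤ) : ZMod m) := by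
    push_cast; rw [hx, hy, ZMod.coe_valMinAbs, ZMod.coe_valMinAbs]
  have bounds : |y + 2 * x| < m ∧ |y - 2 * x| < m := by
    rw [abs_lt, abs_lt]
    rcases abs_cases x with ⟨h1, _⟩ | ⟨h1, _⟩ <;> rcases abs_cases y with ⟨h2, _⟩ | ⟨h2, _⟩ <;>
      rw [h1, h2] at hm <;> omega
  have v1 := zmodAbs_intCast bounds.1
  have v2 := zmodAbs_intCast bounds.2
  rw [← hplus] at v1
  rw [← hminus] at v2
  rw [hxa, hyb]
  have cases : (|y + 2 * x| = |y| + 2 * |x| ∧ |y - 2 * x| = abs (|y| - 2 * |x|)) ∨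
      (|y - 2 * x| = |y| + 2 * |x| ∧ |y + 2 * x| = abs (|y| - 2 * |x|)) := by
    rcases abs_cases x with ⟨h1, _⟩ | ⟨h1, _⟩ <;> rcases abs_cases y with ⟨h2, _⟩ | ⟨h2, _⟩ <;>
      rw [h1, h2]
    · left; exact ⟨abs_of_nonneg (by omega), rfl⟩
    · right; exact ⟨by rw [abs_of_nonpos (by omega)]; ring, by rw [← abs_neg]; congr 1; ring⟩
    · right; exact ⟨by rw [abs_of_nonneg (by omega)]; ring, by congr 1; ring⟩
    · left; exact ⟨by rw [abs_of_nonpos (by omega)]; ring, by rw [← abs_neg]; congr 1; ring⟩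
  rcases cases with ⟨e1, e2⟩ | ⟨e1, e2⟩
  · rw [e1] at v1; rw [e2] at v2
    exact ⟨_, _, v1, v2, rfl⟩
  · rw [e2] at v1; rw [e1] at v2
    exact ⟨_, _, v2, v1, add_comm _ _⟩

/-- Inside the diamond the weights are good and κ ≤ 2 suffices. Outside, the weights are bounded
trivially by 5/4 and the phases help instead: 5/2 · 71/25 = 71/10 < 73/10. -/
theorem ggWeight_coefficient_le {κ : ZMod m → ℝ} (hκ0 : ∀ t, 0 ≤ κ t) (hκ2 : ∀ t, κ t ≤ 2)
    (hκ : ∀ a b : ZMod m, m ≤ 2 * (zmodAbs a + zmodAbs b) → κ a + κ b ≤ 71 / 25)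
    (a b : ZMod m) (hab : a ≠ 0 ∨ b ≠ 0) :
    κ a * (ggWeight (zmodAbs b) (zmodAbs (b + 2 * a)) +
        ggWeight (zmodAbs b) (zmodAbs (b - 2 * a))) +
      κ b * (ggWeight (zmodAbs a) (zmodAbs (a + 2 * b)) +
        ggWeight (zmodAbs a) (zmodAbs (a - 2 * b))) ≤ 73 / 10 := by
  have ne_zero : ∀ t : ZMod m, t ≠ 0 → zmodAbs t ≠ 0 := fun t ht h =>
    ht ((ZMod.valMinAbs_eq_zero t).mp (Int.natAbs_eq_zero.mp h))
  rcases lt_or_ge (2 * (zmodAbs a + zmodAbs b)) m with h | h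
  · obtain ⟨c₁, c₂, h₁, h₂, e₁⟩ := ggWeight_add_le (zmodAbs b) a b h
    obtain ⟨c₃, c₄, h₃, h₄, e₂⟩ := ggWeight_add_le (zmodAbs a) b a (by omega)
    rw [e₁, e₂]
    have := ggWeight_sum_le (hab.imp (ne_zero a) (ne_zero b)) h h₁ h₂ h₃ h₄
    have p1 := ggWeight_pos (zmodAbs b) c₁
    have p2 := ggWeight_pos (zmodAbs b) c₂
    have p3 := ggWeight_pos (zmodAbs a) c₃
    have p4 := ggWeight_pos (zmodAbs a) c₄
    have q1 := mul_le_mul_of_nonneg_right (hκ2 a) (add_pos p1 p2).le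
    have q2 := mul_le_mul_of_nonneg_right (hκ2 b) (add_pos p3 p4).le
    linarith
  · have q1 := mul_le_mul_of_nonneg_left (add_le_add
      (ggWeight_le (zmodAbs b) (zmodAbs (b + 2 * a)))
      (ggWeight_le (zmodAbs b) (zmodAbs (b - 2 * a)))) (hκ0 a)
    have q2 := mul_le_mul_of_nonneg_left (add_le_add
      (ggWeight_le (zmodAbs a) (zmodAbs (a + 2 * b)))
      (ggWeight_le (zmodAbs a) (zmodAbs (a - 2 * b)))) (hκ0 b)
    have := hκ a b h
    linarith

theorem sum_mul_shear_le (κ : ZMod m → ℝ) (hκ0 : ∀ t, 0 ≤ κ t) (H : ZMod m → ZMod m → ℝ) :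
    2 * ∑ a, ∑ b, κ a * (H a b * H a (b - 2 * a)) ≤
      ∑ a, ∑ b, κ a * (ggWeight (zmodAbs b) (zmodAbs (b + 2 * a)) +
        ggWeight (zmodAbs b) (zmodAbs (b - 2 * a))) * H a b ^ 2 := by
  rw [Finset.mul_sum]
  refine Finset.sum_le_sum fun a _ => ?_
  -- Translating b by 2a moves the weight of the second square to the point where it is evaluated,
  -- so each point receives the weights of both shears through it.
  have shift : ∑ b, κ a * ggWeight (zmodAbs b) (zmodAbs (b + 2 * a)) * H a b ^ 2 =
      ∑ b, κ a * ggWeight (zmodAbs (b - 2 * a)) (zmodAbs b) * H a (b - 2 * a) ^ 2 := by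
    rw [← (Equiv.subRight (2 * a)).sum_comp]
    simp
  have split : ∑ b, κ a * (ggWeight (zmodAbs b) (zmodAbs (b + 2 * a)) +
        ggWeight (zmodAbs b) (zmodAbs (b - 2 * a))) * H a b ^ 2 =
      ∑ b, κ a * (ggWeight (zmodAbs b) (zmodAbs (b - 2 * a)) * H a b ^ 2 +
        ggWeight (zmodAbs (b - 2 * a)) (zmodAbs b) * H a (b - 2 * a) ^ 2) := by
    simp_rw [mul_add, add_mul, Finset.sum_add_distrib]
    rw [shift, add_comm]
    simp_rw [mul_assoc]
  rw [split, Finset.mul_sum]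
  refine Finset.sum_le_sum fun b _ => ?_
  have := mul_le_mul_of_nonneg_left
    (two_mul_le_ggWeight (zmodAbs b) (zmodAbs (b - 2 * a)) (H a b) (H a (b - 2 * a))) (hκ0 a)
  linarith

theorem sum_mul_shears_le {κ : ZMod m → ℝ} (hκ0 : ∀ t, 0 ≤ κ t) (hκ2 : ∀ t, κ t ≤ 2)
    (hκ : ∀ a b : ZMod m, m ≤ 2 * (zmodAbs a + zmodAbs b) → κ a + κ b ≤ 71 / 25)
    (H : ZMod m → ZMod m → ℝ) (h0 : H 0 0 = 0) :
    ∑ a, ∑ b, (κ a * (H a b * H a (b - 2 * a)) + κ b * (H a b * H (a - 2 * b) b)) ≤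
      73 / 20 * ∑ a, ∑ b, H a b ^ 2 := by
  have h1 := sum_mul_shear_le κ hκ0 H
  have h2 := sum_mul_shear_le κ hκ0 fun a b => H b a
  rw [Finset.sum_comm, Finset.sum_comm (f := fun a b => κ a * (_ + _) * H b a ^ 2)] at h2
  have coeff : ∑ a, ∑ b, (κ a * (ggWeight (zmodAbs b) (zmodAbs (b + 2 * a)) +
        ggWeight (zmodAbs b) (zmodAbs (b - 2 * a))) * H a b ^ 2 +
      κ b * (ggWeight (zmodAbs a) (zmodAbs (a + 2 * b)) +
        ggWeight (zmodAbs a) (zmodAbs (a - 2 * b))) * H a b ^ 2) ≤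
      73 / 10 * ∑ a, ∑ b, H a b ^ 2 := by
    rw [Finset.mul_sum]
    refine Finset.sum_le_sum fun a _ => ?_
    rw [Finset.mul_sum]
    refine Finset.sum_le_sum fun b _ => ?_
    rw [← add_mul]
    -- At the origin no distance changes and the coefficient can be as large as 8; here `h0` is
    -- indispensable.
    by_cases hab : a = 0 ∧ b = 0
    · rw [hab.1, hab.2, h0]; simp
    · exact mul_le_mul_of_nonneg_right (ggWeight_coefficient_le hκ0 hκ2 hκ a b
        (by tauto)) (sq_nonneg _)
  simp_rw [Finset.sum_add_distrib] at coeff ⊢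
  linarith

/-- The Fourier transform on `(ℤ/m)²`. -/
noncomputable def torusFourier (g : ZMod m → ZMod m → ℝ) (a b : ZMod m) : ℂ :=
  ∑ x, ∑ y, (g x y : ℂ) * ZMod.stdAddChar (a * x + b * y)

theorem sum_stdAddChar_mul (t : ZMod m) :
    ∑ a : ZMod m, (ZMod.stdAddChar (a * t) : ℂ) = if t = 0 then (m : ℂ) else 0 := by
  rw [AddChar.sum_mulShift t (ZMod.isPrimitive_stdAddChar m), ZMod.card]
  split_ifs <;> simp

theorem conj_stdAddChar (t : ZMod m) :
    (starRingEnd ℂ) (ZMod.stdAddChar t) = ZMod.stdAddChar (-t) := by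
  rw [AddChar.map_neg_eq_conj]

theorem parseval_torusFourier (g h : ZMod m → ZMod m → ℝ) :
    ∑ a, ∑ b, (starRingEnd ℂ) (torusFourier g a b) * torusFourier h a b =
      (m : ℂ) ^ 2 * ∑ x, ∑ y, (g x y : ℂ) * h x y := by
  have expand : ∀ a b, (starRingEnd ℂ) (torusFourier g a b) * torusFourier h a b =
      ∑ x, ∑ y, ∑ x', ∑ y', ((g x y : ℂ) * h x' y') *
        (ZMod.stdAddChar (a * (x' - x)) * ZMod.stdAddChar (b * (y' - y))) := by
    intro a b
    simp only [torusFourier, map_sum, map_mul, Complex.conj_ofReal, conj_stdAddChar,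
      Finset.sum_mul]
    refine Finset.sum_congr rfl fun x _ => Finset.sum_congr rfl fun y _ => ?_
    simp only [Finset.mul_sum]
    refine Finset.sum_congr rfl fun x' _ => Finset.sum_congr rfl fun y' _ => ?_
    have : a * (x' - x) + b * (y' - y) = -(a * x + b * y) + (a * x' + b * y') := by ring
    rw [← AddChar.map_add_eq_mul, this, AddChar.map_add_eq_mul _ (-(a * x + b * y))]
    exact mul_mul_mul_comm _ _ _ _
  have move : ∀ f : ZMod m → ZMod m → ZMod m → ZMod m → ZMod m → ZMod m → ℂ,
      ∑ a, ∑ b, ∑ x, ∑ y, ∑ x', ∑ y', f a b x y x' y' =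
      ∑ x, ∑ y, ∑ x', ∑ y', ∑ a, ∑ b, f a b x y x' y' := by
    intro f
    simp only [← Fintype.sum_prod_type']
    exact Fintype.sum_equiv
      ⟨fun p => (p.2.2.1, p.2.2.2.1, p.2.2.2.2.1, p.2.2.2.2.2, p.1, p.2.1),
        fun p => (p.2.2.2.2.1, p.2.2.2.2.2, p.1, p.2.1, p.2.2.1, p.2.2.2.1),
        fun _ => rfl, fun _ => rfl⟩ _ _ fun _ => rfl
  simp_rw [expand]
  rw [move]
  simp_rw [← Finset.mul_sum, ← Finset.sum_mul, sum_stdAddChar_mul, sub_eq_zero]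
  rw [Finset.mul_sum]
  refine Finset.sum_congr rfl fun x _ => ?_
  rw [Finset.mul_sum]
  refine Finset.sum_congr rfl fun y _ => ?_
  rw [Finset.sum_eq_single x, Finset.sum_eq_single y]
  · simp; ring
  · intro y' _ hy; simp [hy]
  · simp
  · intro x' _ hx; simp [hx]
  · simp

/-- Substituting x for x + 2y + c moves the shear to the dual variable. The translation c leaves
only a phase, so the two shears with c = 0 and c = 1 add up to the factor 1 + e(-a). -/
theorem torusFourier_shear_left (g : ZMod m → ZMod m → ℝ) (c a b : ZMod m) :
    torusFourier (fun x y => g (x + 2 * y + c) y) a b =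
      ZMod.stdAddChar (-(a * c)) * torusFourier g a (b - 2 * a) := by
  unfold torusFourier
  rw [Finset.sum_comm]
  nth_rw 2 [Finset.sum_comm]
  rw [Finset.mul_sum]
  refine Finset.sum_congr rfl fun y _ => ?_
  rw [← Equiv.sum_comp (Equiv.addRight (2 * y + c))
    (fun x => (g x y : ℂ) * ZMod.stdAddChar (a * x + (b - 2 * a) * y)), Finset.mul_sum]
  refine Finset.sum_congr rfl fun x _ => ?_
  have arg : a * (x + (2 * y + c)) + (b - 2 * a) * y = a * c + (a * x + b * y) := by ring
  have inv : (ZMod.stdAddChar (-(a * c)) : ℂ) * ZMod.stdAddChar (a * c) = 1 := by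
    rw [← AddChar.map_add_eq_mul, neg_add_cancel, AddChar.map_zero_eq_one]
  rw [Equiv.coe_addRight, arg, AddChar.map_add_eq_mul _ (a * c), mul_left_comm, ← mul_assoc _ _
    (ZMod.stdAddChar (a * x + b * y)), inv, one_mul]
  simp only [add_assoc]

theorem torusFourier_swap (g : ZMod m → ZMod m → ℝ) (a b : ZMod m) :
    torusFourier (fun x y => g y x) a b = torusFourier g b a := by
  unfold torusFourier
  rw [Finset.sum_comm]
  exact Finset.sum_congr rfl fun y _ => Finset.sum_congr rfl fun x _ => by rw [add_comm]

theorem torusFourier_shear_right (g : ZMod m → ZMod m → ℝ) (c a b : ZMod m) :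
    torusFourier (fun x y => g x (y + 2 * x + c)) a b =
      ZMod.stdAddChar (-(b * c)) * torusFourier g (a - 2 * b) b := by
  have := torusFourier_shear_left (fun x y => g y x) c b a
  rw [torusFourier_swap g] at this
  rw [← this, ← torusFourier_swap fun x y => g x (y + 2 * x + c)]

/-- This is |1 + exp(2iθ)| = 2 |cos θ|; the cosine is non-negative since the distance to 0 is at
most m/2. -/
theorem norm_one_add_stdAddChar_neg (t : ZMod m) :
    ‖(1 + ZMod.stdAddChar (-t) : ℂ)‖ = 2 * Real.cos (Real.pi * zmodAbs t / m) := by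
  have hm : (0 : ℝ) < m := by exact_mod_cast Nat.pos_of_ne_zero (NeZero.ne m)
  have hle : (2 : ℝ) * zmodAbs t ≤ m := by exact_mod_cast two_mul_zmodAbs_le t
  set j := (-t).valMinAbs with hj
  have hj_abs : (zmodAbs t : ℝ) = |(j : ℝ)| := by
    rw [zmodAbs, ← ZMod.natAbs_valMinAbs_neg, ← hj, Nat.cast_natAbs, Int.cast_abs]
  set θ : ℝ := Real.pi * j / m with hθ
  have hcos : Real.cos (Real.pi * zmodAbs t / m) = Real.cos θ := by
    rw [← Real.cos_abs θ, hθ, abs_div, abs_mul, abs_of_pos Real.pi_pos, abs_of_pos hm, hj_abs]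
  have hchar : (ZMod.stdAddChar (-t) : ℂ) = Complex.exp ((2 * θ : ℝ) * Complex.I) := by
    rw [← ZMod.coe_valMinAbs (-t), ← hj, ZMod.stdAddChar_coe, hθ]
    congr 1
    push_cast
    ring
  have hnonneg : 0 ≤ Real.cos (Real.pi * zmodAbs t / m) := by
    refine Real.cos_nonneg_of_neg_pi_div_two_le_of_le ?_ ?_
    · have : 0 ≤ Real.pi * zmodAbs t / m := by positivity
      linarith [Real.pi_pos]
    · rw [div_le_iff₀ hm]
      nlinarith [Real.pi_pos]
  rw [← sq_eq_sq₀ (norm_nonneg _) (by linarith), hchar, hcos, ← Complex.normSq_eq_norm_sq,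
    Complex.normSq_apply]
  simp only [Complex.add_re, Complex.one_re, Complex.exp_ofReal_mul_I_re, Complex.add_im,
    Complex.one_im, Complex.exp_ofReal_mul_I_im]
  rw [Real.cos_two_mul, Real.sin_two_mul]
  nlinarith [Real.sin_sq_add_cos_sq θ]

/-- Outside the diamond the two angles add up to at least π/2, so the sum is at most 2 (cos x + sin
x) ≤ 2√2 < 71/25. -/
theorem norm_one_add_stdAddChar_add_le (a b : ZMod m) (h : m ≤ 2 * (zmodAbs a + zmodAbs b)) :
    ‖(1 + ZMod.stdAddChar (-a) : ℂ)‖ + ‖(1 + ZMod.stdAddChar (-b) : ℂ)‖ ≤ 71 / 25 := by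
  have hm : (0 : ℝ) < m := by exact_mod_cast Nat.pos_of_ne_zero (NeZero.ne m)
  have h' : (m : ℝ) ≤ 2 * (zmodAbs a + zmodAbs b) := by exact_mod_cast h
  have ha : (2 : ℝ) * zmodAbs a ≤ m := by exact_mod_cast two_mul_zmodAbs_le a
  have hb : (2 : ℝ) * zmodAbs b ≤ m := by exact_mod_cast two_mul_zmodAbs_le b
  rw [norm_one_add_stdAddChar_neg, norm_one_add_stdAddChar_neg]
  set x := Real.pi * zmodAbs a / m with hx
  have hle : Real.cos (Real.pi * zmodAbs b / m) ≤ Real.sin x := by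
    rw [← Real.cos_pi_div_two_sub]
    refine Real.cos_le_cos_of_nonneg_of_le_pi ?_ ?_ ?_
    · rw [hx, sub_nonneg, div_le_iff₀ hm]
      nlinarith [Real.pi_pos]
    · rw [div_le_iff₀ hm]
      nlinarith [Real.pi_pos]
    · rw [hx, sub_le_iff_le_add, ← add_div, le_div_iff₀ hm]
      nlinarith [Real.pi_pos]
  have : Real.cos x + Real.sin x ≤ 71 / 50 := by
    nlinarith [Real.sin_sq_add_cos_sq x, sq_nonneg (Real.cos x - Real.sin x)]
  linarith

/-- The theorem of Gabber and Galil (with the constant of Jimbo and Maruoka's argument). -/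
theorem gabberGalil (g : ZMod m → ZMod m → ℝ) (hg : ∑ x, ∑ y, g x y = 0) :
    ∑ x, ∑ y, g x y * (g (x + 2 * y) y + g (x + 2 * y + 1) y + g x (y + 2 * x) +
      g x (y + 2 * x + 1)) ≤ 73 / 20 * ∑ x, ∑ y, g x y ^ 2 := by
  have hm : (0 : ℝ) < m := by exact_mod_cast Nat.pos_of_ne_zero (NeZero.ne m)
  set F := torusFourier g with hF
  set κ : ZMod m → ℝ := fun t => ‖(1 + ZMod.stdAddChar (-t) : ℂ)‖ with hκ_def
  have hF0 : ‖F 0 0‖ = 0 := by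
    have : F 0 0 = ((∑ x, ∑ y, g x y : ℝ) : ℂ) := by
      simp [hF, torusFourier]
    rw [this, hg]
    simp
  have hκ2 : ∀ t, κ t ≤ 2 := fun t => by
    simp only [hκ_def, norm_one_add_stdAddChar_neg]
    linarith [Real.cos_le_one (Real.pi * zmodAbs t / m)]
  have core := sum_mul_shears_le (κ := κ) (fun t => norm_nonneg _) hκ2
    norm_one_add_stdAddChar_add_le (fun a b => ‖F a b‖) hF0
  have norm_sum : ∑ a, ∑ b, ‖F a b‖ ^ 2 = (m : ℝ) ^ 2 * ∑ x, ∑ y, g x y ^ 2 := by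
    have := parseval_torusFourier g g
    have h2 : ∀ a b, (starRingEnd ℂ) (torusFourier g a b) * torusFourier g a b =
        ((‖F a b‖ ^ 2 : ℝ) : ℂ) := fun a b => by
      rw [mul_comm, Complex.mul_conj, Complex.normSq_eq_norm_sq]
    simp_rw [h2] at this
    have h3 : ∀ x y, (g x y : ℂ) * g x y = ((g x y ^ 2 : ℝ) : ℂ) := fun x y => by
      push_cast; ring
    simp_rw [h3] at this
    exact_mod_cast this
  set h : ZMod m → ZMod m → ℝ := fun x y => g (x + 2 * y) y + g (x + 2 * y + 1) y +
    g x (y + 2 * x) + g x (y + 2 * x + 1)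
  have hFh : ∀ a b, torusFourier h a b = (1 + ZMod.stdAddChar (-a)) * F a (b - 2 * a) +
      (1 + ZMod.stdAddChar (-b)) * F (a - 2 * b) b := by
    intro a b
    have e1 := torusFourier_shear_left g 0 a b
    have e2 := torusFourier_shear_left g 1 a b
    have e3 := torusFourier_shear_right g 0 a b
    have e4 := torusFourier_shear_right g 1 a b
    simp only [add_zero, mul_zero, neg_zero, AddChar.map_zero_eq_one, one_mul, mul_one]
      at e1 e2 e3 e4
    have : torusFourier h a b = torusFourier (fun x y => g (x + 2 * y) y) a b +
        torusFourier (fun x y => g (x + 2 * y + 1) y) a b +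
        torusFourier (fun x y => g x (y + 2 * x)) a b +
        torusFourier (fun x y => g x (y + 2 * x + 1)) a b := by
      simp only [torusFourier, ← Finset.sum_add_distrib, h]
      refine Finset.sum_congr rfl fun x _ => Finset.sum_congr rfl fun y _ => ?_
      push_cast
      ring
    rw [this, e1, e2, e3, e4]
    ring
  have pars := parseval_torusFourier g h
  -- By Parseval the quadratic form becomes a sum over frequencies, where only absolute values are
  -- kept.
  have bound : (m : ℝ) ^ 2 * ∑ x, ∑ y, g x y * h x y ≤ ∑ a, ∑ b,
      (κ a * (‖F a b‖ * ‖F a (b - 2 * a)‖) + κ b * (‖F a b‖ * ‖F (a - 2 * b) b‖)) := by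
    have cast : ((m : ℝ) ^ 2 * ∑ x, ∑ y, g x y * h x y : ℝ) =
        ((m : ℂ) ^ 2 * ∑ x, ∑ y, (g x y : ℂ) * h x y).re := by
      rw [← Complex.ofReal_re ((m : ℝ) ^ 2 * ∑ x, ∑ y, g x y * h x y)]
      push_cast
      rfl
    rw [cast, ← pars]
    refine (Complex.re_le_norm _).trans ((norm_sum_le _ _).trans
      (Finset.sum_le_sum fun a _ => (norm_sum_le _ _).trans (Finset.sum_le_sum fun b _ => ?_)))
    rw [norm_mul, RCLike.norm_conj, hFh]
    calc _ ≤ ‖F a b‖ * (κ a * ‖F a (b - 2 * a)‖ + κ b * ‖F (a - 2 * b) b‖) := by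
          refine mul_le_mul_of_nonneg_left ((norm_add_le _ _).trans ?_) (norm_nonneg _)
          rw [norm_mul, norm_mul]
      _ = _ := by ring
  refine le_of_mul_le_mul_left ?_ (pow_pos hm 2)
  calc _ ≤ _ := bound
    _ ≤ _ := core
    _ = _ := by rw [norm_sum]; ring

end GabberGalil

/-! ### The same inequality on encoded points -/

section GabberGalilEncoding

variable {m : ℕ} [NeZero m]

/-- The number that encodes a point of `(ℤ/m)²`. -/
def torusCode (x y : ZMod m) : ℕ := x.val * m + y.val

theorem torusCode_div (x y : ZMod m) : torusCode x y / m = x.val := by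
  have := ZMod.val_lt y
  rw [torusCode, add_comm, Nat.add_mul_div_right _ _ (by omega), Nat.div_eq_of_lt this, zero_add]

theorem torusCode_mod (x y : ZMod m) : torusCode x y % m = y.val := by
  rw [torusCode, add_comm, Nat.add_mul_mod_self_right, Nat.mod_eq_of_lt (ZMod.val_lt y)]

theorem torusCode_lt (x y : ZMod m) : torusCode x y < m ^ 2 := by
  have hx := ZMod.val_lt x
  have hy := ZMod.val_lt y
  unfold torusCode
  nlinarith

theorem torusCode_inj {x y x' y' : ZMod m} (h : torusCode x y = torusCode x' y') :
    x = x' ∧ y = y' := by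
  constructor
  · exact ZMod.val_injective m (by rw [← torusCode_div x y, h, torusCode_div])
  · exact ZMod.val_injective m (by rw [← torusCode_mod x y, h, torusCode_mod])

theorem exists_torusCode_eq {c : ℕ} (hc : c < m ^ 2) : ∃ x y : ZMod m, torusCode x y = c := by
  have hm : 0 < m := Nat.pos_of_ne_zero (NeZero.ne m)
  refine ⟨(c / m : ℕ), (c % m : ℕ), ?_⟩
  rw [torusCode, ZMod.val_natCast, ZMod.val_natCast, Nat.mod_mod,
    Nat.mod_eq_of_lt (Nat.div_lt_of_lt_mul (by rwa [← pow_two]))]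
  exact Nat.div_add_mod' c m

theorem sum_range_sq_eq_sum_torusCode (f : ℕ → ℝ) :
    ∑ c ∈ range (m ^ 2), f c = ∑ x : ZMod m, ∑ y : ZMod m, f (torusCode x y) := by
  rw [← Fintype.sum_prod_type' fun x y : ZMod m => f (torusCode x y)]
  symm
  refine Finset.sum_nbij (fun p => torusCode p.1 p.2) (fun p _ => ?_) (fun p _ q _ h => ?_)
    (fun c hc => ?_) fun _ _ => rfl
  · exact mem_range.mpr (torusCode_lt _ _)
  · exact Prod.ext (torusCode_inj h).1 (torusCode_inj h).2
  · obtain ⟨x, y, h⟩ := exists_torusCode_eq (mem_range.mp (mem_coe.mp hc))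
    exact ⟨(x, y), mem_coe.mpr (mem_univ _), h⟩

theorem ggMap_torusCode (x y : ZMod m) :
    ggMap m 0 (torusCode x y) = torusCode (x + 2 * y) y ∧
    ggMap m 1 (torusCode x y) = torusCode (x + 2 * y + 1) y ∧
    ggMap m 2 (torusCode x y) = torusCode x (y + 2 * x) ∧
    ggMap m 3 (torusCode x y) = torusCode x (y + 2 * x + 1) := by
  have val1 : ∀ x y : ZMod m, (x.val + 2 * y.val) % m = (x + 2 * y).val := fun x y => by
    rw [← ZMod.val_natCast]; simp
  have val2 : ∀ x y : ZMod m, (x.val + 2 * y.val + 1) % m = (x + 2 * y + 1).val := fun x y => by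
    rw [← ZMod.val_natCast]; simp
  refine ⟨?_, ?_, ?_, ?_⟩ <;> simp only [ggMap, torusCode_div, torusCode_mod, val1, val2] <;> rfl

theorem ggMap_of_four_le {m s : ℕ} (hs : 4 ≤ s) (c : ℕ) : ggMap m s c = c := by
  obtain ⟨s, rfl⟩ := Nat.exists_eq_add_of_le' hs
  rfl

theorem ggMap_lt (s : ℕ) {c : ℕ} (hc : c < m ^ 2) : ggMap m s c < m ^ 2 := by
  obtain ⟨x, y, rfl⟩ := exists_torusCode_eq hc
  obtain ⟨h0, h1, h2, h3⟩ := ggMap_torusCode x y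
  rcases Nat.lt_or_ge s 4 with hs | hs
  · interval_cases s
    · rw [h0]; exact torusCode_lt _ _
    · rw [h1]; exact torusCode_lt _ _
    · rw [h2]; exact torusCode_lt _ _
    · rw [h3]; exact torusCode_lt _ _
  · rwa [ggMap_of_four_le hs]

theorem exists_ggMap_eq (s : ℕ) {c : ℕ} (hc : c < m ^ 2) : ∃ c' < m ^ 2, ggMap m s c' = c := by
  obtain ⟨x, y, rfl⟩ := exists_torusCode_eq hc
  rcases Nat.lt_or_ge s 4 with hs | hs
  · interval_cases s
    · refine ⟨torusCode (x - 2 * y) y, torusCode_lt _ _, ?_⟩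
      rw [(ggMap_torusCode _ _).1]; congr 1; ring
    · refine ⟨torusCode (x - 2 * y - 1) y, torusCode_lt _ _, ?_⟩
      rw [(ggMap_torusCode _ _).2.1]; congr 1; ring
    · refine ⟨torusCode x (y - 2 * x), torusCode_lt _ _, ?_⟩
      rw [(ggMap_torusCode _ _).2.2.1]; congr 1; ring
    · refine ⟨torusCode x (y - 2 * x - 1), torusCode_lt _ _, ?_⟩
      rw [(ggMap_torusCode _ _).2.2.2]; congr 1; ring
  · exact ⟨_, hc, ggMap_of_four_le hs _⟩

theorem ggMap_surjOn (s : ℕ) :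
    Set.SurjOn (ggMap m s) (range (m ^ 2) : Finset ℕ) (range (m ^ 2) : Finset ℕ) := fun c hc => by
  obtain ⟨c', hc', h⟩ := exists_ggMap_eq s (mem_range.mp (mem_coe.mp hc))
  exact ⟨c', mem_coe.mpr (mem_range.mpr hc'), h⟩

theorem ggMap_injOn (s : ℕ) : Set.InjOn (ggMap m s) (range (m ^ 2) : Finset ℕ) :=
  Finset.injOn_of_surjOn_of_card_le _
    (fun _ hc => mem_coe.mpr (mem_range.mpr (ggMap_lt s (mem_range.mp (mem_coe.mp hc)))))
    (ggMap_surjOn s) le_rfl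

theorem sum_comp_ggMap (s : ℕ) (f : ℕ → ℝ) :
    ∑ c ∈ range (m ^ 2), f (ggMap m s c) = ∑ c ∈ range (m ^ 2), f c :=
  Finset.sum_nbij (ggMap m s) (fun _ hc => mem_range.mpr (ggMap_lt s (mem_range.mp hc)))
    (ggMap_injOn s) (ggMap_surjOn s) fun _ _ => rfl

theorem exists_ggMap_eq_iff (s : ℕ) {c : ℕ} (hc : c < m ^ 2) :
    ∃ q < m ^ 2, ∀ c' < m ^ 2, c = ggMap m s c' ↔ c' = q := by
  obtain ⟨q, hq, h⟩ := exists_ggMap_eq s hc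
  refine ⟨q, hq, fun c' hc' => ⟨fun h' => ?_, fun h' => by rw [h', h]⟩⟩
  exact ggMap_injOn s (mem_coe.mpr (mem_range.mpr hc')) (mem_coe.mpr (mem_range.mpr hq))
    (h'.symm.trans h.symm)

/-- For g minus its mean, expanding the squares gives 8 times the squared norm minus twice the
Gabber–Galil form, hence at least 8 - 2 · 73/20 = 7/10 of the squared norm. -/
theorem exists_sum_sq_sub_le_ggMap (g : ℕ → ℝ) :
    ∃ μ : ℝ, ∑ c ∈ range (m ^ 2), (g c - μ) ^ 2 ≤
      10 / 7 * ∑ s ∈ range 4, ∑ c ∈ range (m ^ 2), (g c - g (ggMap m s c)) ^ 2 := by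
  have hm : (0 : ℝ) < (m : ℝ) ^ 2 :=
    pow_pos (by exact_mod_cast Nat.pos_of_ne_zero (NeZero.ne m)) 2
  set μ : ℝ := (∑ c ∈ range (m ^ 2), g c) / (m : ℝ) ^ 2
  set h : ℕ → ℝ := fun c => g c - μ
  have mean : ∑ c ∈ range (m ^ 2), h c = 0 := by
    simp only [h, Finset.sum_sub_distrib, Finset.sum_const, card_range, nsmul_eq_mul]
    push_cast
    rw [mul_div_cancel₀ _ hm.ne', sub_self]
  have gg := gabberGalil (fun x y : ZMod m => h (torusCode x y)) (by
    rw [← sum_range_sq_eq_sum_torusCode h, mean])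
  have inner : ∑ c ∈ range (m ^ 2), h c * (h (ggMap m 0 c) + h (ggMap m 1 c) +
      h (ggMap m 2 c) + h (ggMap m 3 c)) ≤ 73 / 20 * ∑ c ∈ range (m ^ 2), h c ^ 2 := by
    rw [sum_range_sq_eq_sum_torusCode, sum_range_sq_eq_sum_torusCode (fun c => h c ^ 2)]
    refine le_trans (le_of_eq ?_) gg
    refine Finset.sum_congr rfl fun x _ => Finset.sum_congr rfl fun y _ => ?_
    obtain ⟨h0, h1, h2, h3⟩ := ggMap_torusCode x y
    rw [h0, h1, h2, h3]
  have expand : ∀ s, ∑ c ∈ range (m ^ 2), (g c - g (ggMap m s c)) ^ 2 =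
      2 * ∑ c ∈ range (m ^ 2), h c ^ 2 - 2 * ∑ c ∈ range (m ^ 2), h c * h (ggMap m s c) := by
    intro s
    have : ∀ c, (g c - g (ggMap m s c)) ^ 2 =
        h c ^ 2 + h (ggMap m s c) ^ 2 - 2 * (h c * h (ggMap m s c)) := fun c => by
      simp only [h]; ring
    simp_rw [this, Finset.sum_sub_distrib, Finset.sum_add_distrib, ← Finset.mul_sum]
    rw [sum_comp_ggMap s fun c => h c ^ 2]
    ring
  refine ⟨μ, ?_⟩
  change ∑ c ∈ range (m ^ 2), h c ^ 2 ≤ _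
  simp only [Finset.sum_range_succ _ 3, Finset.sum_range_succ _ 2, Finset.sum_range_succ _ 1,
    Finset.sum_range_one, expand]
  simp only [mul_add, Finset.sum_add_distrib] at inner
  linarith

end GabberGalilEncoding

/-! ### Regularity of the explicit graphs -/

section ExplicitGraphAdjacency

variable {n m : ℕ}

theorem clusterRel_slot_slot {c s c' s' : ℕ} (hc : c < m ^ 2) (hs : s < 5) (hc' : c' < m ^ 2)
    (hs' : s' < 5) : clusterRel n m (5 * c + s) (5 * c' + s') ↔
      (s' = (s + 1) % 5 ∧ c' = ggMap m s c) ∨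
      (c' = c ∧ s' = (s + 2) % 5 ∧ ¬ (5 * m ^ 2 + c < n ∧ (s = 1 ∨ s = 2))) := by
  have h1 : (5 * c + s) % 5 = s := by omega
  have h2 : (5 * c + s) / 5 = c := by omega
  have h3 : (5 * c' + s') % 5 = s' := by omega
  have h4 : (5 * c' + s') / 5 = c' := by omega
  unfold clusterRel
  rw [h1, h2, h3, h4]
  constructor
  · rintro (⟨-, -, h⟩ | ⟨-, -, h⟩ | ⟨-, -, h⟩)
    · exact Or.inl h
    · exact Or.inr h
    · omega
  · rintro (h | h)
    · exact Or.inl ⟨by omega, by omega, h⟩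
    · exact Or.inr (Or.inl ⟨by omega, by omega, h⟩)

theorem clusterRel_slot_extra {c s c' : ℕ} (hc : c < m ^ 2) (hs : s < 5) :
    clusterRel n m (5 * c + s) (5 * m ^ 2 + c') ↔ s ≠ 0 ∧ c' = c := by
  have h1 : (5 * c + s) % 5 = s := by omega
  have h2 : (5 * c + s) / 5 = c := by omega
  unfold clusterRel
  rw [h1, h2]
  constructor
  · rintro (⟨-, h, -⟩ | ⟨-, h, -⟩ | ⟨-, h, h'⟩)
    · omega
    · omega
    · exact ⟨h, by omega⟩
  · rintro ⟨h, h'⟩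
    exact Or.inr (Or.inr ⟨by omega, h, by omega⟩)

theorem not_clusterRel_extra (c w : ℕ) : ¬ clusterRel n m (5 * m ^ 2 + c) w := by
  unfold clusterRel
  omega

theorem exists_slot_or_extra {v : ℕ} (hv : v < n) (hn : n ≤ 6 * m ^ 2) :
    (∃ c < m ^ 2, ∃ s < 5, v = 5 * c + s) ∨
      ∃ c < m ^ 2, v = 5 * m ^ 2 + c ∧ 5 * m ^ 2 + c < n := by
  rcases lt_or_ge v (5 * m ^ 2) with h | h
  · exact Or.inl ⟨v / 5, by omega, v % 5, by omega, by omega⟩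
  · exact Or.inr ⟨v - 5 * m ^ 2, by omega, by omega, by omega⟩

/-- The adjacency relation of the cluster graph on vertex numbers. -/
def clusterAdj (n m v w : ℕ) : Prop := v ≠ w ∧ (clusterRel n m v w ∨ clusterRel n m w v)

/-- The neighbours lie in the slots s + 1, s - 1, s + 2 and s - 2, the second one in the cluster
given by the inverse permutation. Leaving out the edges 1–3 and 2–4 frees one place at each of the
slots 1, 2, 3, 4, which the additional vertex takes. -/
theorem exists_clusterAdj_slot_iff [NeZero m] (hn5 : 5 * m ^ 2 ≤ n) (hn : n ≤ 6 * m ^ 2)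
    {c s : ℕ} (hc : c < m ^ 2) (hs : s < 5) :
    ∃ w₁ w₂ w₃ w₄, w₁ ≠ w₂ ∧ w₁ ≠ w₃ ∧ w₁ ≠ w₄ ∧ w₂ ≠ w₃ ∧ w₂ ≠ w₄ ∧ w₃ ≠ w₄ ∧
      ∀ w, (w < n ∧ clusterAdj n m (5 * c + s) w) ↔ w = w₁ ∨ w = w₂ ∨ w = w₃ ∨ w = w₄ := by
  have hp := ggMap_lt s hc
  obtain ⟨q, hq, hq'⟩ := exists_ggMap_eq_iff ((s + 4) % 5) hc
  refine ⟨5 * ggMap m s c + (s + 1) % 5, 5 * q + (s + 4) % 5,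
    if 5 * m ^ 2 + c < n ∧ (s = 1 ∨ s = 2) then 5 * m ^ 2 + c else 5 * c + (s + 2) % 5,
    if 5 * m ^ 2 + c < n ∧ (s = 3 ∨ s = 4) then 5 * m ^ 2 + c else 5 * c + (s + 3) % 5, ?_⟩
  have slots : ∀ c' < m ^ 2, ∀ s' < 5, clusterAdj n m (5 * c + s) (5 * c' + s') ↔
      5 * c + s ≠ 5 * c' + s' ∧ (((s' = (s + 1) % 5 ∧ c' = ggMap m s c) ∨
      (c' = c ∧ s' = (s + 2) % 5 ∧ ¬ (5 * m ^ 2 + c < n ∧ (s = 1 ∨ s = 2)))) ∨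
      ((s' = (s + 4) % 5 ∧ c' = q) ∨
      (c = c' ∧ s = (s' + 2) % 5 ∧ ¬ (5 * m ^ 2 + c' < n ∧ (s' = 1 ∨ s' = 2))))) := by
    intro c' hc' s' hs'
    rw [clusterAdj, clusterRel_slot_slot hc hs hc' hs', clusterRel_slot_slot hc' hs' hc hs]
    have : (s = (s' + 1) % 5 ∧ c = ggMap m s' c') ↔ (s' = (s + 4) % 5 ∧ c' = q) := by
      constructor
      · rintro ⟨h1, h2⟩
        have h3 : s' = (s + 4) % 5 := by omega
        exact ⟨h3, (hq' c' hc').mp (h3 ▸ h2)⟩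
      · rintro ⟨h1, h2⟩
        refine ⟨by omega, ?_⟩
        rw [h1]
        exact (hq' c' hc').mpr h2
    rw [this]
  have extra : ∀ c', clusterAdj n m (5 * c + s) (5 * m ^ 2 + c') ↔ s ≠ 0 ∧ c' = c := by
    intro c'
    rw [clusterAdj, clusterRel_slot_extra hc hs]
    have := not_clusterRel_extra (n := n) (m := m) c' (5 * c + s)
    constructor
    · tauto
    · exact fun h => ⟨by omega, Or.inl h⟩
  generalize ggMap m s c = p at *
  clear hq'
  refine ⟨?_, ?_, ?_, ?_, ?_, ?_, fun w => ?_⟩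
  · omega
  · split_ifs <;> omega
  · split_ifs <;> omega
  · split_ifs <;> omega
  · split_ifs <;> omega
  · split_ifs <;> omega
  constructor
  · rintro ⟨hw, hadj⟩
    rcases exists_slot_or_extra hw hn with ⟨c', hc', s', hs', rfl⟩ | ⟨c', hc', rfl, he⟩
    · rw [slots c' hc' s' hs'] at hadj
      obtain ⟨-, (⟨rfl, rfl⟩ | ⟨rfl, rfl, h1⟩) | ⟨rfl, rfl⟩ | ⟨rfl, h1, h2⟩⟩ := hadj
      · exact Or.inl rfl
      · exact Or.inr (Or.inr (Or.inl (if_neg h1).symm))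
      · exact Or.inr (Or.inl rfl)
      · refine Or.inr (Or.inr (Or.inr ?_))
        rw [if_neg] <;> omega
    · obtain ⟨hs0, rfl⟩ := (extra c').mp hadj
      refine Or.inr (Or.inr ?_)
      by_cases h12 : s = 1 ∨ s = 2
      · exact Or.inl (if_pos ⟨he, h12⟩).symm
      · exact Or.inr (if_pos ⟨he, by omega⟩).symm
  · rintro (rfl | rfl | rfl | rfl)
    · exact ⟨by omega, (slots _ hp _ (Nat.mod_lt _ (by norm_num))).mpr
        ⟨by omega, Or.inl (Or.inl ⟨rfl, rfl⟩)⟩⟩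
    · exact ⟨by omega, (slots _ hq _ (Nat.mod_lt _ (by norm_num))).mpr
        ⟨by omega, Or.inr (Or.inl ⟨rfl, rfl⟩)⟩⟩
    · split_ifs with h
      · exact ⟨h.1, (extra c).mpr ⟨by omega, rfl⟩⟩
      · exact ⟨by omega, (slots _ hc _ (Nat.mod_lt _ (by norm_num))).mpr
          ⟨by omega, Or.inl (Or.inr ⟨rfl, rfl, h⟩)⟩⟩
    · split_ifs with h
      · exact ⟨h.1, (extra c).mpr ⟨by omega, rfl⟩⟩
      · exact ⟨by omega, (slots _ hc _ (Nat.mod_lt _ (by norm_num))).mpr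
          ⟨by omega, Or.inr (Or.inr ⟨rfl, by omega, by omega⟩)⟩⟩

theorem clusterAdj_extra_iff (hn5 : 5 * m ^ 2 ≤ n) {c : ℕ} (hc : c < m ^ 2) (w : ℕ)
    (hn : n ≤ 6 * m ^ 2) : (w < n ∧ clusterAdj n m (5 * m ^ 2 + c) w) ↔
      w = 5 * c + 1 ∨ w = 5 * c + 2 ∨ w = 5 * c + 3 ∨ w = 5 * c + 4 := by
  have hno := not_clusterRel_extra (n := n) (m := m) c
  constructor
  · rintro ⟨hw, -, h⟩
    rcases exists_slot_or_extra hw hn with ⟨c', hc', s', hs', rfl⟩ | ⟨c', hc', rfl, -⟩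
    · have := (clusterRel_slot_extra hc' hs').mp (h.resolve_left (hno _))
      omega
    · exact absurd h (not_or.mpr ⟨hno _, not_clusterRel_extra _ _⟩)
  · intro h
    refine ⟨by omega, by omega, Or.inr ?_⟩
    obtain ⟨s, hs, hs0, rfl⟩ : ∃ s < 5, s ≠ 0 ∧ w = 5 * c + s :=
      ⟨w - 5 * c, by omega, by omega, by omega⟩
    exact (clusterRel_slot_extra hc hs).mpr ⟨hs0, rfl⟩

theorem explicitGraph_adj {v w : Fin n} : (explicitGraph n).Adj v w ↔
    v.1 ≠ w.1 ∧ (explicitRel n v w ∨ explicitRel n w v) := by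
  rw [explicitGraph, SimpleGraph.fromRel_adj, Fin.ne_iff_vne]

theorem degree_explicitGraph_eq_four {v : Fin n} {w₁ w₂ w₃ w₄ : ℕ} (h12 : w₁ ≠ w₂)
    (h13 : w₁ ≠ w₃) (h14 : w₁ ≠ w₄) (h23 : w₂ ≠ w₃) (h24 : w₂ ≠ w₄) (h34 : w₃ ≠ w₄)
    (h : ∀ w, (w < n ∧ v.1 ≠ w ∧ (explicitRel n v w ∨ explicitRel n w v)) ↔
      w = w₁ ∨ w = w₂ ∨ w = w₃ ∨ w = w₄) : (explicitGraph n).degree v = 4 := by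
  have image : ((explicitGraph n).neighborFinset v).map Fin.valEmbedding = {w₁, w₂, w₃, w₄} := by
    ext w
    simp only [Finset.mem_map, SimpleGraph.mem_neighborFinset, Fin.valEmbedding_apply,
      Finset.mem_insert, Finset.mem_singleton, ← h, explicitGraph_adj]
    constructor
    · rintro ⟨u, hu, rfl⟩
      exact ⟨u.2, hu⟩
    · rintro ⟨hw, hw'⟩
      exact ⟨⟨w, hw⟩, hw', rfl⟩
  rw [← SimpleGraph.card_neighborFinset_eq_degree, ← Finset.card_map Fin.valEmbedding, image]
  rw [Finset.card_insert_of_notMem, Finset.card_insert_of_notMem, Finset.card_insert_of_notMem,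
    Finset.card_singleton] <;> simp <;> omega

theorem one_le_sqrt_div_five (hn : 4 < n) : 1 ≤ (n / 5).sqrt := by
  rw [Nat.le_sqrt]; omega

theorem five_mul_sqrt_sq_le (n : ℕ) : 5 * (n / 5).sqrt ^ 2 ≤ n := by
  have := Nat.sqrt_le' (n / 5)
  omega

theorem isRegularOfDegree_explicitGraph (hn : 4 < n) : (explicitGraph n).IsRegularOfDegree 4 := by
  intro v
  have hv := v.2
  by_cases hcase : n ≤ 6 * (n / 5).sqrt ^ 2
  · have : NeZero (n / 5).sqrt := ⟨by have := one_le_sqrt_div_five hn; omega⟩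
    rcases exists_slot_or_extra hv hcase with ⟨c, hc, s, hs, hvc⟩ | ⟨c, hc, hvc, -⟩
    · obtain ⟨w₁, w₂, w₃, w₄, h12, h13, h14, h23, h24, h34, h⟩ :=
        exists_clusterAdj_slot_iff (five_mul_sqrt_sq_le n) hcase hc hs
      refine degree_explicitGraph_eq_four h12 h13 h14 h23 h24 h34 fun w => ?_
      rw [← h, hvc]
      simp only [explicitRel, if_pos hcase, clusterAdj]
    · refine degree_explicitGraph_eq_four (w₁ := 5 * c + 1) (w₂ := 5 * c + 2) (w₃ := 5 * c + 3)
        (w₄ := 5 * c + 4) (by omega) (by omega) (by omega) (by omega) (by omega) (by omega)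
        fun w => ?_
      rw [← clusterAdj_extra_iff (five_mul_sqrt_sq_le n) hc w hcase, hvc]
      simp only [explicitRel, if_pos hcase, clusterAdj]
  -- Explicit reductions leave the circulant case to linear arithmetic; v ± 1 and v ± 2 are distinct
  -- because n > 4.
  · have step : ∀ a < n, ∀ k < 5, (a + k) % n = if a + k < n then a + k else a + k - n := by
      intro a ha k hk
      split_ifs with h
      · exact Nat.mod_eq_of_lt h
      · rw [Nat.mod_eq_sub_mod (by omega), Nat.mod_eq_of_lt (by omega)]
    have hadj : ∀ w, (w < n ∧ v.1 ≠ w ∧ (explicitRel n v w ∨ explicitRel n w v)) ↔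
        (w < n ∧ v.1 ≠ w ∧ ((w = (v.1 + 1) % n ∨ w = (v.1 + 2) % n) ∨
          (v.1 = (w + 1) % n ∨ v.1 = (w + 2) % n))) := fun w => by
      simp only [explicitRel, if_neg hcase]
    refine degree_explicitGraph_eq_four (w₁ := (v.1 + 1) % n) (w₂ := (v.1 + 2) % n)
      (w₃ := if 1 ≤ v.1 then v.1 - 1 else v.1 + n - 1)
      (w₄ := if 2 ≤ v.1 then v.1 - 2 else v.1 + n - 2) ?_ ?_ ?_ ?_ ?_ ?_ fun w => ?_
    · rw [step v hv 1 (by omega), step v hv 2 (by omega)]; split_ifs <;> omega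
    · rw [step v hv 1 (by omega)]; split_ifs <;> omega
    · rw [step v hv 1 (by omega)]; split_ifs <;> omega
    · rw [step v hv 2 (by omega)]; split_ifs <;> omega
    · rw [step v hv 2 (by omega)]; split_ifs <;> omega
    · split_ifs <;> omega
    rw [hadj, step v hv 1 (by omega), step v hv 2 (by omega)]
    constructor
    · rintro ⟨hw, hne, h⟩
      rw [step w hw 1 (by omega), step w hw 2 (by omega)] at h
      split_ifs at h ⊢ <;> omega
    · intro h
      have hw : w < n := by split_ifs at h <;> omega
      rw [step w hw 1 (by omega), step w hw 2 (by omega)]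
      refine ⟨hw, ?_, ?_⟩ <;> split_ifs at h ⊢ <;> omega

end ExplicitGraphAdjacency

/-! ### Energy estimates on the cluster graph -/

section ClusterGraph

variable {n m : ℕ}

/-- The cluster of a vertex number. -/
def clusterOf (m v : ℕ) : ℕ := if v < 5 * m ^ 2 then v / 5 else v - 5 * m ^ 2

theorem clusterOf_slot {c s : ℕ} (hc : c < m ^ 2) (hs : s < 5) : clusterOf m (5 * c + s) = c := by
  rw [clusterOf, if_pos (by omega)]
  omega

theorem clusterOf_extra (c : ℕ) : clusterOf m (5 * m ^ 2 + c) = c := by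
  rw [clusterOf, if_neg (by omega)]
  omega

theorem clusterOf_lt {v : ℕ} (hv : v < n) (hn : n ≤ 6 * m ^ 2) : clusterOf m v < m ^ 2 := by
  rcases exists_slot_or_extra hv hn with ⟨c, hc, s, hs, rfl⟩ | ⟨c, hc, rfl, -⟩
  · rwa [clusterOf_slot hc hs]
  · rwa [clusterOf_extra]

theorem card_clusterOf_fiber_le (hn : n ≤ 6 * m ^ 2) (c : ℕ) :
    #{v ∈ range n | clusterOf m v = c} ≤ 6 := by
  have sub : {v ∈ range n | clusterOf m v = c} ⊆
      insert (5 * m ^ 2 + c) ((range 5).image fun s => 5 * c + s) := by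
    intro v hv
    obtain ⟨hv, hvc⟩ := mem_filter.mp hv
    rw [mem_insert, mem_image]
    rcases exists_slot_or_extra (mem_range.mp hv) hn with ⟨c', hc, s, hs, rfl⟩ | ⟨c', hc, rfl, -⟩
    · rw [clusterOf_slot hc hs] at hvc
      exact Or.inr ⟨s, mem_range.mpr hs, by rw [hvc]⟩
    · rw [clusterOf_extra] at hvc
      exact Or.inl (by rw [hvc])
  calc _ ≤ _ := card_le_card sub
    _ ≤ #((range 5).image fun s => 5 * c + s) + 1 := card_insert_le _ _
    _ ≤ #(range 5) + 1 := Nat.add_le_add_right card_image_le 1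
    _ = 6 := by simp

theorem sum_fiber_clusterOf (hn : n ≤ 6 * m ^ 2) (N : ℕ → ℝ) :
    ∑ c ∈ range (m ^ 2), ∑ v ∈ range n with clusterOf m v = c, N v = ∑ v ∈ range n, N v :=
  Finset.sum_fiberwise_of_maps_to
    (fun _ hv => mem_range.mpr (clusterOf_lt (mem_range.mp hv) hn)) N

theorem sum_comp_clusterOf_le (hn : n ≤ 6 * m ^ 2) {X : ℕ → ℝ} (hX : ∀ c, 0 ≤ X c) :
    ∑ v ∈ range n, X (clusterOf m v) ≤ 6 * ∑ c ∈ range (m ^ 2), X c := by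
  rw [← sum_fiber_clusterOf hn, Finset.mul_sum]
  refine Finset.sum_le_sum fun c _ => ?_
  rw [Finset.sum_congr rfl fun v hv => by rw [(mem_filter.mp hv).2], Finset.sum_const,
    nsmul_eq_mul]
  exact mul_le_mul_of_nonneg_right (by exact_mod_cast card_clusterOf_fiber_le hn c) (hX c)

theorem clusterAdj_slot_next {c s : ℕ} [NeZero m] (hc : c < m ^ 2) (hs : s < 4) :
    clusterAdj n m (5 * c + s) (5 * ggMap m s c + (s + 1)) :=
  ⟨by omega, Or.inl ((clusterRel_slot_slot hc (by omega) (ggMap_lt s hc) (by omega)).mpr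
    (Or.inl ⟨by omega, rfl⟩))⟩

theorem clusterAdj_slot_slot {c s s' : ℕ} (hc : c < m ^ 2) (hs : s < 5) (hs' : s' = (s + 2) % 5)
    (h : ¬ (5 * m ^ 2 + c < n ∧ (s = 1 ∨ s = 2))) :
    clusterAdj n m (5 * c + s) (5 * c + s') :=
  ⟨by omega, Or.inl ((clusterRel_slot_slot hc hs hc (by omega)).mpr (Or.inr ⟨rfl, hs', h⟩))⟩

theorem clusterAdj_extra_slot {c s : ℕ} (hc : c < m ^ 2) (hs : s < 5) (hs0 : s ≠ 0) :
    clusterAdj n m (5 * m ^ 2 + c) (5 * c + s) :=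
  ⟨by omega, Or.inr ((clusterRel_slot_extra hc hs).mpr ⟨hs0, rfl⟩)⟩

/-- Along the edges inside a cluster, `σ = ±1` times the value at one end is close to the negative
of the value at the other end. -/
theorem cluster_edges_abs_le (hn5 : 5 * m ^ 2 ≤ n) {c : ℕ} (hc : c < m ^ 2) {F : ℕ → ℝ} {σ r : ℝ}
    (hE : ∀ v < n, ∀ w < n, clusterAdj n m v w → clusterOf m v = c → |F v + σ * F w| ≤ r) :
    |F (5 * c) + σ * F (5 * c + 2)| ≤ r ∧ |F (5 * c + 3) + σ * F (5 * c)| ≤ r ∧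
    |F (5 * c + 4) + σ * F (5 * c + 1)| ≤ r ∧
    ((|F (5 * c + 1) + σ * F (5 * c + 3)| ≤ r ∧ |F (5 * c + 2) + σ * F (5 * c + 4)| ≤ r ∧
      ¬ 5 * m ^ 2 + c < n) ∨
    (∀ s < 5, s ≠ 0 → |F (5 * m ^ 2 + c) + σ * F (5 * c + s)| ≤ r)) := by
  have slot : ∀ s < 5, ∀ s', s' = (s + 2) % 5 → ¬ (5 * m ^ 2 + c < n ∧ (s = 1 ∨ s = 2)) →
      |F (5 * c + s) + σ * F (5 * c + s')| ≤ r := fun s hs s' hs' h =>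
    hE _ (by omega) _ (by omega) (clusterAdj_slot_slot hc hs hs' h) (clusterOf_slot hc hs)
  refine ⟨slot 0 (by norm_num) 2 rfl (by omega), slot 3 (by norm_num) 0 rfl (by omega),
    slot 4 (by norm_num) 1 rfl (by omega), ?_⟩
  by_cases he : 5 * m ^ 2 + c < n
  · exact Or.inr fun s hs hs0 => hE _ he _ (by omega) (clusterAdj_extra_slot hc hs hs0)
      (clusterOf_extra c)
  · exact Or.inl ⟨slot 1 (by norm_num) 3 rfl (by omega), slot 2 (by norm_num) 4 rfl (by omega), he⟩

/-- Every vertex is at most three edges away from slot 0 inside its cluster. The longest such path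
is needed for the slots 1 and 4 when there is an additional vertex. -/
theorem abs_sub_le_of_cluster (hn5 : 5 * m ^ 2 ≤ n) (hn : n ≤ 6 * m ^ 2) {F : ℕ → ℝ} {r : ℝ}
    {v : ℕ} (hv : v < n)
    (hE : ∀ u < n, ∀ w < n, clusterAdj n m u w → clusterOf m u = clusterOf m v →
      |F u + (-1) * F w| ≤ r) : |F v - F (5 * clusterOf m v)| ≤ 3 * r := by
  obtain ⟨e02, e30, e41, hcase⟩ :=
    cluster_edges_abs_le hn5 (clusterOf_lt hv hn) hE
  generalize hcv : clusterOf m v = c at *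
  rw [abs_le] at e02 e30 e41 ⊢
  rcases hcase with ⟨e13, e24, he⟩ | he
  · rw [abs_le] at e13 e24
    rcases exists_slot_or_extra hv hn with ⟨c', hc, s, hs, rfl⟩ | ⟨c', hc, rfl, he'⟩
    · rw [clusterOf_slot hc hs] at hcv
      subst hcv
      interval_cases s <;> (try rw [add_zero]) <;> constructor <;> linarith
    · rw [clusterOf_extra] at hcv
      subst hcv
      exact absurd he' he
  · have e1 := he 1 (by norm_num) (by norm_num)
    have e2 := he 2 (by norm_num) (by norm_num)
    have e3 := he 3 (by norm_num) (by norm_num)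
    have e4 := he 4 (by norm_num) (by norm_num)
    rw [abs_le] at e1 e2 e3 e4
    rcases exists_slot_or_extra hv hn with ⟨c', hc, s, hs, rfl⟩ | ⟨c', hc, rfl, -⟩
    · rw [clusterOf_slot hc hs] at hcv
      subst hcv
      interval_cases s <;> (try rw [add_zero]) <;> constructor <;> linarith
    · rw [clusterOf_extra] at hcv
      subst hcv
      constructor <;> linarith

/-- The cluster contains an odd cycle, around which the signs do not close up: the pentagon 0, 2, 4,
1, 3, or the triangle of slots 1, 4 and the additional vertex. In the second case values are at most
3r/2 on the triangle, and two further edges reach slot 0. -/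
theorem abs_le_of_cluster (hn5 : 5 * m ^ 2 ≤ n) (hn : n ≤ 6 * m ^ 2) {F : ℕ → ℝ} {r : ℝ}
    {v : ℕ} (hv : v < n)
    (hE : ∀ u < n, ∀ w < n, clusterAdj n m u w → clusterOf m u = clusterOf m v →
      |F u + 1 * F w| ≤ r) : |F v| ≤ 4 * r := by
  obtain ⟨e02, e30, e41, hcase⟩ :=
    cluster_edges_abs_le hn5 (clusterOf_lt hv hn) hE
  generalize hcv : clusterOf m v = c at *
  rw [abs_le] at e02 e30 e41 ⊢
  rcases hcase with ⟨e13, e24, he⟩ | he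
  · rw [abs_le] at e13 e24
    rcases exists_slot_or_extra hv hn with ⟨c', hc, s, hs, rfl⟩ | ⟨c', hc, rfl, he'⟩
    · rw [clusterOf_slot hc hs] at hcv
      subst hcv
      interval_cases s <;> (try rw [add_zero]) <;> constructor <;> linarith
    · rw [clusterOf_extra] at hcv
      subst hcv
      exact absurd he' he
  · have e1 := he 1 (by norm_num) (by norm_num)
    have e2 := he 2 (by norm_num) (by norm_num)
    have e3 := he 3 (by norm_num) (by norm_num)
    have e4 := he 4 (by norm_num) (by norm_num)
    rw [abs_le] at e1 e2 e3 e4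
    rcases exists_slot_or_extra hv hn with ⟨c', hc, s, hs, rfl⟩ | ⟨c', hc, rfl, -⟩
    · rw [clusterOf_slot hc hs] at hcv
      subst hcv
      interval_cases s <;> (try rw [add_zero]) <;> constructor <;> linarith
    · rw [clusterOf_extra] at hcv
      subst hcv
      constructor <;> linarith

theorem abs_add_mul_le_sqrt_fiber {F N : ℕ → ℝ} {σ : ℝ} (hN : ∀ v, 0 ≤ N v)
    (hE : ∀ v < n, ∀ w < n, clusterAdj n m v w → (F v + σ * F w) ^ 2 ≤ N v) {v w : ℕ}
    (hv : v < n) (hw : w < n) (hvw : clusterAdj n m v w) {c : ℕ} (hc : clusterOf m v = c) :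
    |F v + σ * F w| ≤ √(∑ u ∈ range n with clusterOf m u = c, N u) := by
  refine Real.abs_le_sqrt ((hE v hv w hw hvw).trans ?_)
  exact Finset.single_le_sum (fun u _ => hN u) (mem_filter.mpr ⟨mem_range.mpr hv, hc⟩)

theorem cluster_sum_sq_le (hn5 : 5 * m ^ 2 ≤ n) (hn : n ≤ 6 * m ^ 2) {F N : ℕ → ℝ}
    (hN : ∀ v, 0 ≤ N v)
    (hE : ∀ v < n, ∀ w < n, clusterAdj n m v w → (F v + 1 * F w) ^ 2 ≤ N v) :
    ∑ v ∈ range n, F v ^ 2 ≤ 96 * ∑ v ∈ range n, N v := by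
  set T : ℕ → ℝ := fun c => ∑ u ∈ range n with clusterOf m u = c, N u with hT_def
  have hT : ∀ c, 0 ≤ T c := fun c => Finset.sum_nonneg fun u _ => hN u
  calc ∑ v ∈ range n, F v ^ 2 ≤ ∑ v ∈ range n, 16 * T (clusterOf m v) := by
        refine Finset.sum_le_sum fun v hv => ?_
        have := abs_le_of_cluster hn5 hn (mem_range.mp hv) fun u hu w hw huw huc =>
          abs_add_mul_le_sqrt_fiber hN hE hu hw huw huc
        calc F v ^ 2 = |F v| ^ 2 := (sq_abs _).symm
          _ ≤ (4 * √(T (clusterOf m v))) ^ 2 := pow_le_pow_left₀ (abs_nonneg _) this 2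
          _ = 16 * T (clusterOf m v) := by rw [mul_pow, Real.sq_sqrt (hT _)]; norm_num
    _ ≤ 6 * ∑ c ∈ range (m ^ 2), 16 * T c :=
        sum_comp_clusterOf_le hn (X := fun c => 16 * T c) fun c => by linarith [hT c]
    _ = 96 * ∑ v ∈ range n, N v := by
        rw [← Finset.mul_sum, hT_def, sum_fiber_clusterOf hn]; ring

/-- Each cluster is represented by its slot 0. Inside a cluster F is almost constant, and the edges
between clusters compare representatives along the four Gabber–Galil maps. -/
theorem cluster_exists_sum_sq_sub_le [NeZero m] (hn5 : 5 * m ^ 2 ≤ n) (hn : n ≤ 6 * m ^ 2)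
    {F N : ℕ → ℝ} (hN : ∀ v, 0 ≤ N v)
    (hE : ∀ v < n, ∀ w < n, clusterAdj n m v w → (F v + (-1) * F w) ^ 2 ≤ N v) :
    ∃ μ : ℝ, ∑ v ∈ range n, (F v - μ) ^ 2 ≤ 5000 * ∑ v ∈ range n, N v := by
  set T : ℕ → ℝ := fun c => ∑ u ∈ range n with clusterOf m u = c, N u with hT_def
  have hT : ∀ c, 0 ≤ T c := fun c => Finset.sum_nonneg fun u _ => hN u
  have sumT : ∑ c ∈ range (m ^ 2), T c = ∑ v ∈ range n, N v := sum_fiber_clusterOf hn N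
  have near : ∀ v < n, (F v - F (5 * clusterOf m v)) ^ 2 ≤ 9 * T (clusterOf m v) := by
    intro v hv
    have := abs_sub_le_of_cluster hn5 hn hv fun u hu w hw huw huc =>
      abs_add_mul_le_sqrt_fiber hN hE hu hw huw huc
    calc _ = |F v - F (5 * clusterOf m v)| ^ 2 := (sq_abs _).symm
      _ ≤ (3 * √(T (clusterOf m v))) ^ 2 := pow_le_pow_left₀ (abs_nonneg _) this 2
      _ = 9 * T (clusterOf m v) := by rw [mul_pow, Real.sq_sqrt (hT _)]; norm_num
  have nearSlot : ∀ c < m ^ 2, ∀ s < 5, (F (5 * c + s) - F (5 * c)) ^ 2 ≤ 9 * T c := by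
    intro c hc s hs
    have := near (5 * c + s) (by omega)
    rwa [clusterOf_slot hc hs] at this
  obtain ⟨μ, hμ⟩ := exists_sum_sq_sub_le_ggMap (m := m) fun c => F (5 * c)
  refine ⟨μ, ?_⟩
  have steps : ∀ s < 4, ∑ c ∈ range (m ^ 2), (F (5 * c) - F (5 * ggMap m s c)) ^ 2 ≤
      57 * ∑ v ∈ range n, N v := by
    intro s hs
    have pointwise : ∀ c ∈ range (m ^ 2), (F (5 * c) - F (5 * ggMap m s c)) ^ 2 ≤
        30 * T c + 27 * T (ggMap m s c) := by
      intro c hc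
      have hc := mem_range.mp hc
      have hp := ggMap_lt s hc
      have h1 := nearSlot c hc s (by omega)
      have h2 := nearSlot _ hp (s + 1) (by omega)
      have h3 : (F (5 * c + s) + (-1) * F (5 * ggMap m s c + (s + 1))) ^ 2 ≤ T c :=
        (hE _ (by omega) _ (by omega) (clusterAdj_slot_next hc hs)).trans
          (Finset.single_le_sum (f := N) (fun u _ => hN u)
            (mem_filter.mpr ⟨mem_range.mpr (by omega), clusterOf_slot hc (by omega)⟩))
      set x := F (5 * c + s) - F (5 * c)
      set y := F (5 * ggMap m s c + (s + 1)) - F (5 * ggMap m s c)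
      set z := F (5 * c + s) + (-1) * F (5 * ggMap m s c + (s + 1))
      have : F (5 * c) - F (5 * ggMap m s c) = z - x + y := by simp only [x, y, z]; ring
      rw [this]
      -- The square of a three-term sum is at most three times the sum of squares: 3 (T + 9 T + 9
      -- T') = 30 T + 27 T'.
      nlinarith [sq_nonneg (z + x), sq_nonneg (z - y), sq_nonneg (x + y)]
    calc _ ≤ ∑ c ∈ range (m ^ 2), (30 * T c + 27 * T (ggMap m s c)) := Finset.sum_le_sum pointwise
      _ = _ := by
        rw [Finset.sum_add_distrib, ← Finset.mul_sum, ← Finset.mul_sum, sum_comp_ggMap s T, sumT]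
        ring
  -- Here 10/7 · 4 · 57 is just below 326. With at most six vertices per cluster, the final constant
  -- is 6 (18 + 2 · 326) = 4020 < 5000.
  have hμ' : ∑ c ∈ range (m ^ 2), (F (5 * c) - μ) ^ 2 ≤ 326 * ∑ v ∈ range n, N v := by
    refine hμ.trans ?_
    have := Finset.sum_le_sum fun s hs => steps s (mem_range.mp hs)
    rw [Finset.sum_const, card_range, nsmul_eq_mul] at this
    have hnn : 0 ≤ ∑ v ∈ range n, N v := Finset.sum_nonneg fun v _ => hN v
    push_cast at this
    linarith
  have pointwise : ∀ v ∈ range n, (F v - μ) ^ 2 ≤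
      18 * T (clusterOf m v) + 2 * (F (5 * clusterOf m v) - μ) ^ 2 := by
    intro v hv
    have := near v (mem_range.mp hv)
    nlinarith [sq_nonneg ((F v - F (5 * clusterOf m v)) - (F (5 * clusterOf m v) - μ))]
  have collect := sum_comp_clusterOf_le hn (X := fun c => 18 * T c + 2 * (F (5 * c) - μ) ^ 2)
    fun c => by have := hT c; positivity
  have total := (Finset.sum_le_sum pointwise).trans collect
  rw [Finset.sum_add_distrib (f := fun c => 18 * T c), ← Finset.mul_sum, ← Finset.mul_sum,
    sumT] at total
  have hnn : 0 ≤ ∑ v ∈ range n, N v := Finset.sum_nonneg fun v _ => hN v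
  linarith

end ClusterGraph

/-! ### The finitely many circulant graphs -/

section CirculantGraph

variable {n : ℕ}

/-- The failure of the cluster condition gives 6m² < n < 5 (m + 1)², hence m ≤ 10 and n < 5 · 11².
-/
theorem lt_of_six_mul_sqrt_sq_lt (hn : 6 * (n / 5).sqrt ^ 2 < n) : n < 605 := by
  set m := (n / 5).sqrt with hm
  have h1 : n / 5 < (m + 1) ^ 2 := Nat.lt_succ_sqrt' (n / 5)
  have h2 : n < 5 * (m + 1) ^ 2 := by omega
  have h3 : m ≤ 10 := by by_contra! h; nlinarith
  nlinarith

/-- The path 0, 1, 2, … alone suffices, by Cauchy–Schwarz along it; 366025 is 605². -/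
theorem circulant_sum_sq_sub_le {F N : ℕ → ℝ} (hn : n < 605) (hN : ∀ v, 0 ≤ N v)
    (hE : ∀ v, v + 1 < n → (F v + (-1) * F (v + 1)) ^ 2 ≤ N v) :
    ∑ v ∈ range n, (F v - F 0) ^ 2 ≤ 366025 * ∑ v ∈ range n, N v := by
  have hnn : 0 ≤ ∑ v ∈ range n, N v := Finset.sum_nonneg fun v _ => hN v
  have hn' : (n : ℝ) ≤ 605 := by exact_mod_cast hn.le
  have pointwise : ∀ v ∈ range n, (F v - F 0) ^ 2 ≤ 605 * ∑ v ∈ range n, N v := by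
    intro v hv
    have hv := mem_range.mp hv
    rw [← Finset.sum_range_sub F v]
    have hv' : (v : ℝ) ≤ 605 := by exact_mod_cast (by omega : v ≤ 605)
    calc (∑ i ∈ range v, (F (i + 1) - F i)) ^ 2
        ≤ v * ∑ i ∈ range v, (F (i + 1) - F i) ^ 2 := by
          simpa using sq_sum_le_card_mul_sum_sq (s := range v) (f := fun i => F (i + 1) - F i)
      _ ≤ v * ∑ i ∈ range n, N i := by
          refine mul_le_mul_of_nonneg_left ?_ (Nat.cast_nonneg v)
          refine (Finset.sum_le_sum fun i hi => ?_).trans (Finset.sum_le_sum_of_subset_of_nonneg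
            (range_subset_range.mpr hv.le) fun i _ _ => hN i)
          have := hE i (by have := mem_range.mp hi; omega)
          calc _ = (F i + (-1) * F (i + 1)) ^ 2 := by ring
            _ ≤ _ := this
      _ ≤ 605 * ∑ i ∈ range n, N i := mul_le_mul_of_nonneg_right hv' hnn
  refine (Finset.sum_le_sum pointwise).trans ?_
  rw [Finset.sum_const, card_range, nsmul_eq_mul]
  nlinarith

theorem circulant_sum_sq_le {F N : ℕ → ℝ} (hn : n < 605) (hn0 : 0 < n) (hN : ∀ v, 0 ≤ N v)
    (hE : ∀ v < n, ∀ k, k = 1 ∨ k = 2 → (F v + 1 * F ((v + k) % n)) ^ 2 ≤ N v) :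
    ∑ v ∈ range n, F v ^ 2 ≤ 366025 * ∑ v ∈ range n, N v := by
  have hnn : 0 ≤ ∑ v ∈ range n, N v := Finset.sum_nonneg fun v _ => hN v
  have hn' : (n : ℝ) ≤ 605 := by exact_mod_cast hn.le
  have le_sum : ∀ v < n, N v ≤ ∑ v ∈ range n, N v := fun v hv =>
    Finset.single_le_sum (fun u _ => hN u) (mem_range.mpr hv)
  have pointwise : ∀ v ∈ range n, F v ^ 2 ≤ 605 * ∑ v ∈ range n, N v := by
    intro v hv
    have hv := mem_range.mp hv
    have hw : (v + 1) % n < n := Nat.mod_lt _ hn0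
    have h1 := (hE v hv 1 (Or.inl rfl)).trans (le_sum v hv)
    have h2 := (hE v hv 2 (Or.inr rfl)).trans (le_sum v hv)
    have h3 := (hE _ hw 1 (Or.inl rfl)).trans (le_sum _ hw)
    rw [Nat.mod_add_mod] at h3
    set x := F v + 1 * F ((v + 1) % n)
    set y := F v + 1 * F ((v + 2) % n)
    set z := F ((v + 1) % n) + 1 * F ((v + 1 + 1) % n)
    -- The triangle v, v + 1, v + 2 is an odd cycle, and its alternating sum isolates `F v`.
    have : F v = (x + y - z) / 2 := by simp only [x, y, z]; ring
    rw [this]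
    nlinarith [sq_nonneg (x - y), sq_nonneg (x + z), sq_nonneg (y + z)]
  refine (Finset.sum_le_sum pointwise).trans ?_
  rw [Finset.sum_const, card_range, nsmul_eq_mul]
  nlinarith

end CirculantGraph

/-! ### The explicit graphs are expanders -/

section ExplicitExpander

open Matrix

variable {n : ℕ}

/-- The sum over the neighbours `w` of `v` of `(f v + σ f w) ^ 2`. -/
noncomputable def edgeEnergy (f : Fin n → ℝ) (σ : ℝ) (v : ℕ) : ℝ :=
  if hv : v < n then
    ∑ w, (if (explicitGraph n).Adj ⟨v, hv⟩ w then (f ⟨v, hv⟩ + σ * f w) ^ 2 else 0) else 0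

theorem edgeEnergy_nonneg (f : Fin n → ℝ) (σ : ℝ) (v : ℕ) : 0 ≤ edgeEnergy f σ v := by
  unfold edgeEnergy
  split_ifs with hv
  · exact Finset.sum_nonneg fun w _ => by split_ifs <;> positivity
  · exact le_rfl

theorem sum_edgeEnergy (f : Fin n → ℝ) (σ : ℝ) : ∑ v ∈ range n, edgeEnergy f σ v =
    ∑ v, ∑ w, (if (explicitGraph n).Adj v w then (f v + σ * f w) ^ 2 else 0) := by
  rw [Finset.sum_range]
  exact Finset.sum_congr rfl fun v _ => by rw [edgeEnergy, dif_pos v.2]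

/-- The extension by zero of a vector to all natural numbers. -/
noncomputable def extendZero (f : Fin n → ℝ) (v : ℕ) : ℝ := if hv : v < n then f ⟨v, hv⟩ else 0

theorem extendZero_apply (f : Fin n → ℝ) (v : Fin n) : extendZero f v = f v := by
  rw [extendZero, dif_pos v.2]

theorem sq_le_edgeEnergy (f : Fin n → ℝ) (σ : ℝ) {v w : ℕ} (hv : v < n) (hw : w < n)
    (hne : v ≠ w) (h : explicitRel n v w ∨ explicitRel n w v) :
    (extendZero f v + σ * extendZero f w) ^ 2 ≤ edgeEnergy f σ v := by
  have hadj : (explicitGraph n).Adj ⟨v, hv⟩ ⟨w, hw⟩ := explicitGraph_adj.mpr ⟨hne, h⟩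
  rw [edgeEnergy, dif_pos hv, extendZero, extendZero, dif_pos hv, dif_pos hw]
  have := Finset.single_le_sum (s := univ) (a := (⟨w, hw⟩ : Fin n)) (f := fun w =>
    if (explicitGraph n).Adj ⟨v, hv⟩ w then (f ⟨v, hv⟩ + σ * f w) ^ 2 else 0)
    (fun w _ => by split_ifs <;> positivity) (mem_univ _)
  simpa only [if_pos hadj] using this

theorem exists_sum_sq_sub_le_edgeEnergy (hn : 4 < n) (f : Fin n → ℝ) :
    ∃ μ : ℝ, ∑ v ∈ range n, (extendZero f v - μ) ^ 2 ≤
      366025 * ∑ v ∈ range n, edgeEnergy f (-1) v := by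
  by_cases hcase : n ≤ 6 * (n / 5).sqrt ^ 2
  · have : NeZero (n / 5).sqrt := ⟨by have := one_le_sqrt_div_five hn; omega⟩
    obtain ⟨μ, hμ⟩ := cluster_exists_sum_sq_sub_le (five_mul_sqrt_sq_le n) hcase
      (F := extendZero f) (N := edgeEnergy f (-1)) (edgeEnergy_nonneg f _)
      fun v hv w hw ⟨hne, h⟩ => sq_le_edgeEnergy f _ hv hw hne (by
        simpa only [explicitRel, if_pos hcase] using h)
    have hnn : 0 ≤ ∑ v ∈ range n, edgeEnergy f (-1) v :=
      Finset.sum_nonneg fun v _ => edgeEnergy_nonneg f _ v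
    exact ⟨μ, by linarith⟩
  · refine ⟨_, circulant_sum_sq_sub_le (lt_of_six_mul_sqrt_sq_lt (not_le.mp hcase))
      (edgeEnergy_nonneg f _) fun v hv => ?_⟩
    refine sq_le_edgeEnergy f _ (by omega) hv (by omega) (Or.inl ?_)
    rw [explicitRel, if_neg hcase]
    exact Or.inl (Nat.mod_eq_of_lt hv).symm

theorem sum_sq_le_edgeEnergy (hn : 4 < n) (f : Fin n → ℝ) :
    ∑ v ∈ range n, extendZero f v ^ 2 ≤ 366025 * ∑ v ∈ range n, edgeEnergy f 1 v := by
  by_cases hcase : n ≤ 6 * (n / 5).sqrt ^ 2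
  · have := cluster_sum_sq_le (five_mul_sqrt_sq_le n) hcase
      (F := extendZero f) (N := edgeEnergy f 1) (edgeEnergy_nonneg f _)
      fun v hv w hw ⟨hne, h⟩ => sq_le_edgeEnergy f _ hv hw hne (by
        simpa only [explicitRel, if_pos hcase] using h)
    have hnn : 0 ≤ ∑ v ∈ range n, edgeEnergy f 1 v :=
      Finset.sum_nonneg fun v _ => edgeEnergy_nonneg f _ v
    linarith
  · refine circulant_sum_sq_le (lt_of_six_mul_sqrt_sq_lt (not_le.mp hcase)) (by omega)
      (edgeEnergy_nonneg f _) fun v hv k hk => ?_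
    have hmod : (v + k) % n = if v + k < n then v + k else v + k - n := by
      split_ifs with h
      · exact Nat.mod_eq_of_lt h
      · rw [Nat.mod_eq_sub_mod (by omega), Nat.mod_eq_of_lt (by omega)]
    refine sq_le_edgeEnergy f _ hv (Nat.mod_lt _ (by omega)) ?_ (Or.inl ?_)
    · rw [hmod]; split_ifs <;> omega
    · rw [explicitRel, if_neg hcase]
      rcases hk with rfl | rfl
      exacts [Or.inl rfl, Or.inr rfl]

theorem isExpanderSeq_explicitGraph : IsExpanderSeq 4 explicitGraph := by
  -- With K = 366025, both signs of the energy bound read ‖f‖² ≤ 2K (4 ‖f‖² ± ⟨f, A f⟩). So |⟨f, A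
  -- f⟩| ≤ (4 - 1/(2K)) ‖f‖², which is 4 (1 - 1/(8K)) ‖f‖².
  refine ⟨by norm_num, 1 / (8 * 366025), by norm_num, fun n hn =>
    ⟨isRegularOfDegree_explicitGraph hn, ?_⟩⟩
  have hreg := isRegularOfDegree_explicitGraph hn
  refine secondEigenvalueLE_of_abs_dotProduct_mulVec_le _ hreg (by norm_num) (by omega)
    fun f hf => ?_
  have dot_self : f ⬝ᵥ f = ∑ v, f v ^ 2 :=
    Finset.sum_congr rfl fun v _ => (pow_two _).symm
  have minus : f ⬝ᵥ f ≤ 366025 * ∑ v ∈ range n, edgeEnergy f (-1) v := by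
    obtain ⟨μ, hμ⟩ := exists_sum_sq_sub_le_edgeEnergy hn f
    refine le_trans ?_ hμ
    rw [Finset.sum_range]
    simp only [extendZero_apply]
    have expand : ∀ v, (f v - μ) ^ 2 = f v ^ 2 - 2 * μ * f v + μ ^ 2 := fun v => by ring
    have mean : ∑ v, f v = 0 := by simpa [dotProduct] using hf
    simp_rw [expand, Finset.sum_add_distrib, Finset.sum_sub_distrib, ← Finset.mul_sum, mean,
      mul_zero, sub_zero, dot_self]
    exact le_add_of_nonneg_right (Finset.sum_nonneg fun _ _ => sq_nonneg μ)
  have plus : f ⬝ᵥ f ≤ 366025 * ∑ v ∈ range n, edgeEnergy f 1 v := by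
    refine le_trans (le_of_eq ?_) (sum_sq_le_edgeEnergy hn f)
    rw [Finset.sum_range]
    simp only [extendZero_apply, dot_self]
  rw [sum_edgeEnergy, sum_sum_sq_sub_eq _ hreg f _ (by norm_num)] at minus plus
  rw [abs_le]
  push_cast at minus plus ⊢
  constructor <;> linarith

end ExplicitExpander

end MonotoneVNP

theorem theorem1 :
    -- the explicit sequence of graphs is a sequence of 4-regular expanders
    IsExpanderSeq 4 explicitGraph ∧
    -- and for every sequence of constant-degree expanders (in particular the explicit one):
    ∀ (d : ℕ) (G : ∀ n : ℕ, SimpleGraph (Fin n)) [∀ n, DecidableRel (G n).Adj],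
      IsExpanderSeq d G →
        -- the polynomials are multilinear with non-negative coefficients
        (∀ n, (∀ i, (hardPoly (G n)).degreeOf i ≤ 1) ∧
          ∀ e, 0 ≤ (hardPoly (G n)).coeff e) ∧
        -- they are `∑_S x^S B^|S| A^|E(S)|` with `A = 10/9` and `B = (3/2)^d`
        (∀ n, d < n → hardPoly (G n) =
          ∑ S : Finset (Fin n), MvPolynomial.C
            ((((3 : ℝ) / 2) ^ d) ^ #S * ((10 : ℝ) / 9) ^ edgesInside (G n) S) *
              ∏ i ∈ S, MvPolynomial.X i) ∧
        -- the sequence is in MVNP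
        InMVNP (fun n => hardPoly (G n)) ∧
        -- every monotone circuit for the `n`-th polynomial has size `2^Ω(n)`
        (∃ c : ℝ, 0 < c ∧ ∃ n₀ : ℕ, ∀ n, n₀ ≤ n →
          ∀ C : Circuit (Fin n), C.IsMonotone → C.Computes (hardPoly (G n)) →
            (2 : ℝ) ^ (c * n) ≤ C.size) ∧
        -- in particular the sequence is not in MVP
        ¬ InMVP (fun n => hardPoly (G n)) := by
  refine ⟨isExpanderSeq_explicitGraph, fun d G _ hG => ⟨fun n => ⟨degreeOf_hardPoly_le_one (G n),
    coeff_hardPoly_nonneg (G n)⟩, fun n hn => ?_, inMVNP_hardPoly G,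
    hG.exists_exponential_lower_bound, ?_⟩⟩
  · obtain ⟨-, ε, -, hexp⟩ := hG
    exact hardPoly_eq_of_isRegular (G n) (hexp n hn).1
  · obtain ⟨c, hc, n₀, h⟩ := hG.exists_exponential_lower_bound
    exact not_inMVP_of_exponential_lower_bound hc h
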